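/- Let $\mathbb S=\mathbb R/2\pi\mathbb Z$ with the geodesic distance $d_{\mathbb S}$, $I=[0,1]$, and $G=\mathbb S\times\mathbb R\times I$ with points $P=(\theta,\omega,x)$, Lebesgue measure $dP=d\theta\,d\omega\,dx$ and distance $d_G(P,P')=\sqrt{d_{\mathbb S}(\theta,\theta')^2+(\omega-\omega')^2+(x-x')^2}$. For finite Borel measures $\mu,\nu$ on $G$ let $$d(\mu,\nu)=\sup\Big\{\Big|\int_G f\,d\mu-\int_G f\,d\nu\Big| : f:G\to[0,1],\ |f(P)-f(Q)|\le d_G(P,Q)\ \ \forall P,Q\in G\Big\}$$ be the bounded Lipschitz distance. Let $K\in\mathbb R$, let $W:I^2\to\mathbb R$ be Lipschitz continuous, let $g$ be a continuous probability density on $\mathbb R$, and let $\hat\rho^0_{\theta|\omega}(\theta,\omega,\xi)$ be a nonnegative continuous function on $G$ that is continuous in $\xi\in I$ uniformly in all its arguments (for every $\varepsilon>0$ there is $\delta>0$ such that $|\xi_1-\xi_2|<\delta$ implies $|\hat\rho^0_{\theta|\omega}(\theta,\omega,\xi_1)-\hat\rho^0_{\theta|\omega}(\theta,\omega,\xi_2)|<\varepsilon$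 for all $\theta,\omega$) and satisfies $\int_{\mathbb S}\hat\rho^0_{\theta|\omega}(\phi,\omega,\xi)\,d\phi=1$ for all $(\omega,\xi)$. Consider the initial value problem $$\partial_t\hat\rho+\partial_\theta\{\hat\rho\,V\}=0,\qquad V(t,\theta,\omega,x)=\omega+K\int_I\int_{\mathbb R}\int_{\mathbb S}W(x,y)\sin(\phi-\theta)\,\hat\rho(t,\phi,\lambda,y)\,d\phi\,d\lambda\,dy,$$ $$\hat\rho(0,\theta,\omega,x)=\hat\rho^0_{\theta|\omega}(\theta,\omega,x)\,g(\omega).$$ A weak solution on $[0,T]$ is a measurable function $\hat\rho:[0,T]\times G\to\mathbb R$ such that $\hat\rho(t,\cdot)$ is integrable on $G$ for every $t\in[0,T]$, $t\mapsto\int_G f(P)\hat\rho(t,P)\,dP$ is continuous on $[0,T]$ for every bounded continuous $f:G\to\mathbb R$, and $$\int_0^T\!\!\int_G\hat\rho\,(\partial_t w+V\,\partial_\theta w)\,dP\,dt+\int_G\hat\rho^0_{\theta|\omega}(\theta,\omega,x)\,g(\omega)\,w(0,P)\,dP=0$$ for every smooth $w$ with compact support in $[0,T)\times G$. Then for every $T>0$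 the following hold. 1. The initial value problem has a weak solution $\hat\rho$ on $[0,T]$, and it is unique: any other weak solution agrees with $\hat\rho(t,\cdot)$ almost everywhere on $G$ for every $t\in[0,T]$. 2. For every $t\in[0,T]$, $\hat\rho(t,\cdot)\ge0$ almost everywhere and $\int_G\hat\rho(t,P)\,dP=1$, so that $\mu_t(A)=\int_A\hat\rho(t,P)\,dP$ defines a Borel probability measure on $G$. 3. Let $\omega_1,\omega_2,\dots\in\mathbb R$ and, for each $n$, let $X_n=\{\xi_{n1},\dots,\xi_{nn}\}\subset I$ and let $\theta_{n1},\dots,\theta_{nn}:[0,T]\to\mathbb S$ solve the Kuramoto model on the weighted graph $G(W,X_n)$ (the graph on the nodes $1,\dots,n$ with the weights $W(\xi_{ni},\xi_{nj})$), $$\dot\theta_{ni}=\omega_i+\frac Kn\sum_{j=1}^nW(\xi_{ni},\xi_{nj})\sin(\theta_{nj}-\theta_{ni}),\qquad i=1,\dots,n.$$ Let $\mu^n_t=\frac1n\sum_{i=1}^n\delta_{(\theta_{ni}(t),\,\omega_i,\,\xi_{ni})}$. If $d(\mu^n_0,\mu_0)\to0$ as $n\to\infty$, then $\sup_{t\in[0,T]}d(\mu^n_t,\mu_t)\to0$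 as $n\to\infty$. -/

import Mathlib

open Real Set Filter Topology MeasureTheory
open scoped ENNReal

namespace KuramotoGraph

noncomputable section

/-- The circle `ℝ / 2πℤ`. Mathlib's distance on it is the geodesic one,
`min {|θ - θ'|, 2π - |θ - θ'|}` for representatives in `[0, 2π)`, and its volume is Lebesgue
measure of total mass `2π`. -/
abbrev Circ : Type := AddCircle (2 * π)

/-- The length of the circle is positive (this provides its measure). -/
instance fact_two_pi_pos : Fact (0 < 2 * π) := ⟨Real.two_pi_pos⟩

/-- The phase space `G = 𝕊 × ℝ × I` with points `(θ, ω, x)`; `dP` is the product of the Lebesgue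
measures (`volume`). -/
abbrev PhaseSpace : Type := Circ × ℝ × unitInterval

/-- The sine of a point of the circle. -/
def circSin (θ : Circ) : ℝ := Real.sin_periodic.lift θ

/-- The Euclidean product distance on `G`. -/
def dG (P Q : PhaseSpace) : ℝ :=
  √(dist P.1 Q.1 ^ 2 + (P.2.1 - Q.2.1) ^ 2 + ((P.2.2 : ℝ) - (Q.2.2 : ℝ)) ^ 2)

/-- The functions `f : G → [0, 1]` that are `1`-Lipschitz for `dG`. -/
def lipClass : Set (PhaseSpace → ℝ) :=
  {f | (∀ P, f P ∈ Icc (0 : ℝ) 1) ∧ ∀ P Q, |f P - f Q| ≤ dG P Q}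

/-- The bounded Lipschitz distance between measures on `G`. -/
def dBL (μ ν : Measure PhaseSpace) : ℝ :=
  sSup {r : ℝ | ∃ f ∈ lipClass, r = |(∫ P, f P ∂μ) - ∫ P, f P ∂ν|}

/-- `W` is Lipschitz continuous on `I²`. -/
def IsLipschitzGraphon (W : unitInterval → unitInterval → ℝ) : Prop :=
  ∃ L : ℝ, ∀ x₁ y₁ x₂ y₂ : unitInterval,
    |W x₁ y₁ - W x₂ y₂| ≤ L * √(((x₁ : ℝ) - x₂) ^ 2 + ((y₁ : ℝ) - y₂) ^ 2)

/-- The edge weights of the weighted graph `G(W, X_n)` on the nodes `[n]`, `X_n = {ξ i}`. -/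
def graphWeight (W : unitInterval → unitInterval → ℝ) {n : ℕ} (ξ : Fin n → unitInterval)
    (i j : Fin n) : ℝ :=
  W (ξ i) (ξ j)

/-- The circle-valued phases `θ` solve, on the time interval `[0, T]`, the Kuramoto model
`θ_i' = ω_i + K n⁻¹ ∑_j w_ij sin (θ_j - θ_i)`. The derivative of a circle-valued function is
that of a real-valued lift (one-sided at the two ends of the interval). -/
def IsKuramotoSolution (K T : ℝ) {n : ℕ} (w : Fin n → Fin n → ℝ) (ω : Fin n → ℝ)
    (θ : Fin n → ℝ → Circ) : Prop :=
  ∃ φ : Fin n → ℝ → ℝ,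
    (∀ i, ∀ t ∈ Icc 0 T, ((φ i t : ℝ) : Circ) = θ i t) ∧
    ∀ i, ∀ t ∈ Icc 0 T,
      HasDerivWithinAt (φ i)
        (ω i + K * (n : ℝ)⁻¹ * ∑ j, w i j * circSin (θ j t - θ i t)) (Icc 0 T) t

/-- The empirical measure `n⁻¹ ∑ δ_{P_i}`. -/
def empiricalMeasure {n : ℕ} (P : Fin n → PhaseSpace) : Measure PhaseSpace :=
  (n : ℝ≥0∞)⁻¹ • ∑ i, Measure.dirac (P i)

/-- `g` is a continuous probability density on `ℝ`. -/
structure IsFrequencyDensity (g : ℝ → ℝ) : Prop where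
  continuous : Continuous g
  nonneg : ∀ ω, 0 ≤ g ω
  integrable : Integrable g
  integral_eq_one : ∫ ω, g ω = 1

/-- The conditional densities `p (θ, ω, ξ)` of the initial phase given `(ω, ξ)`. -/
structure IsInitialConditionalDensity (p : PhaseSpace → ℝ) : Prop where
  continuous : Continuous p
  nonneg : ∀ P, 0 ≤ p P
  uniform_in_xi : ∀ ε > 0, ∃ δ > 0, ∀ ξ₁ ξ₂ : unitInterval, |(ξ₁ : ℝ) - ξ₂| < δ →
    ∀ (θ : Circ) (ω : ℝ), |p (θ, ω, ξ₁) - p (θ, ω, ξ₂)| < ε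
  integral_eq_one : ∀ (ω : ℝ) (ξ : unitInterval), ∫ θ : Circ, p (θ, ω, ξ) = 1

/-- The velocity field
`V(θ, ω, x) = ω + K ∫ W(x, y) sin (φ - θ) ρ(φ, λ, y) dφ dλ dy` of a density `ρ` on `G`. -/
def velocity (W : unitInterval → unitInterval → ℝ) (K : ℝ) (ρ : PhaseSpace → ℝ)
    (P : PhaseSpace) : ℝ :=
  P.2.1 + K * ∫ Q : PhaseSpace, W P.2.2 Q.2.2 * circSin (Q.1 - P.1) * ρ Q

/-- The derivative with respect to the angle. -/
def derivTheta (f : PhaseSpace → ℝ) (P : PhaseSpace) : ℝ :=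
  deriv (fun s : ℝ => f (P.1 + (s : Circ), P.2)) 0

/-- Test functions: smooth functions of `(t, θ, ω, x)` (up to the boundary of `I`) whose support
in `[0, T] × G` is a compact subset of `[0, T) × G`. -/
structure IsTestFunction (T : ℝ) (w : ℝ → PhaseSpace → ℝ) : Prop where
  smooth : ∃ F : ℝ × ℝ × ℝ × ℝ → ℝ, ContDiff ℝ (⊤ : ℕ∞) F ∧
    ∀ (t θ ω : ℝ) (x : unitInterval), w t ((θ : Circ), ω, x) = F (t, θ, ω, (x : ℝ))
  support : ∃ τ < T, ∃ R : ℝ, ∀ (t : ℝ) (θ : Circ) (ω : ℝ) (x : unitInterval),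
    (τ ≤ t ∨ R ≤ |ω|) → w t (θ, ω, x) = 0

/-- `ρ` is a weak solution on `[0, T]` of `∂_t ρ + ∂_θ (ρ V) = 0`, `ρ(0, ·) = ρ₀`, where `V` is
the velocity field of `ρ` itself: an integrable density (of no prescribed sign or mass) for every
time, weakly continuous in time, that satisfies the equation and the initial condition when
tested against smooth functions. -/
structure IsWeakSolution (W : unitInterval → unitInterval → ℝ) (K T : ℝ)
    (ρ₀ : PhaseSpace → ℝ) (ρ : ℝ → PhaseSpace → ℝ) : Prop where
  measurable : AEStronglyMeasurable (fun z : ℝ × PhaseSpace => ρ z.1 z.2)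
    (((volume : Measure ℝ).restrict (Icc 0 T)).prod (volume : Measure PhaseSpace))
  integrable : ∀ t ∈ Icc 0 T, Integrable (ρ t)
  weak_continuous : ∀ f : BoundedContinuousFunction PhaseSpace ℝ,
    ContinuousOn (fun t => ∫ P, f P * ρ t P) (Icc 0 T)
  weak_eq : ∀ w : ℝ → PhaseSpace → ℝ, IsTestFunction T w →
    (∫ t in (0 : ℝ)..T, ∫ P, ρ t P *
      (deriv (fun s => w s P) t + velocity W K (ρ t) P * derivTheta (w t) P))
    + ∫ P, ρ₀ P * w 0 P = 0

/-- The measure `A ↦ ∫_A ρ dP`. -/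
def densityMeasure (ρ : PhaseSpace → ℝ) : Measure PhaseSpace :=
  (volume : Measure PhaseSpace).withDensity (fun P => ENNReal.ofReal (ρ P))

end

end KuramotoGraph

open scoped BoundedContinuousFunction

namespace KuramotoGraph

noncomputable section

/-! Expanding `sin (φ - θ)` shows that the velocity of an oscillator depends on the rest of the
system only through a pair of numbers attached to its site: the integrals of `K W(x, y) cos φ` and
`K W(x, y) sin φ`. Once this mean field `Z t x` is known, frequencies and sites are constant and
each phase solves a scalar ODE with globally Lipschitz right-hand side. The flow `flowMap Z` is
explicit enough for its Jacobian to be an exponential, so a continuous initial density is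
transported to a continuous density (`densityMeasure_flowDensity`). The nonlinear problem becomes a
fixed point problem for `Z`: the field must be the one generated by the image of the initial measure
under its own flow (`IsSelfConsistent`).

Dobrushin's argument handles the fixed point. In a norm weighted by `exp (-fieldRate B * t)`,
passing from a field to the field generated by its flow halves distances
(`norm_meanField_map_sub_le_half`). Iteration from zero gives existence (`exists_isSelfConsistent`);
the same inequality for two initial measures gives uniqueness of the field and Lipschitz dependence
on the initial measure in the bounded Lipschitz distance (`IsSelfConsistent.dBL_map_le`). The
transported initial density is a weak solution by differentiation of test functions along
characteristics (`isWeakSolution_flowDensity`).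

Uniqueness among all weak solutions, which carry no sign or mass condition, is the delicate part.
The field of such a solution is regular enough to have a flow, because weak continuity and
Banach–Steinhaus bound its L¹ norms uniformly. It remains to identify the solution with the
transported density for that field. The flow need not be smooth in `t` and `x`, so instead of
transporting test functions backward one expands in Fourier modes in the phase. The speed is a
trigonometric polynomial of degree one, hence mode `k` is driven only by the modes `k - 1`, `k`, `k
+ 1`, with a factor `k`. Iterating the integrated equation `n` times produces a binomial coefficient
times `(M t) ^ n`, which tends to zero for short time with a step that depends on neither the mode
nor the solution (`modes_eq_zero`). So the solution is the transport of its initial density along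
its own field (`IsWeakSolution.ae_eq_flowDensity`), that field is self-consistent, and uniqueness of
the field applies.

Finally, the empirical measure of a Kuramoto solution is also transported by a self-consistent field
(`IsKuramotoSolution.exists_isSelfConsistent`), so the convergence claim is the stability estimate
with a constant that does not depend on `n`. -/

/-! ### Phase curves in a prescribed mean field -/

/-- The speed `ω + z₂ cos θ - z₁ sin θ` of an oscillator of frequency `ω` in the mean field `z`. -/
def phaseSpeed (z : ℝ × ℝ) (ω θ : ℝ) : ℝ := ω + z.2 * cos θ - z.1 * sin θ

lemma abs_fst_le_norm (z : ℝ × ℝ) : |z.1| ≤ ‖z‖ := norm_fst_le z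
lemma abs_snd_le_norm (z : ℝ × ℝ) : |z.2| ≤ ‖z‖ := norm_snd_le z

lemma abs_cos_sub_cos_le (a b : ℝ) : |cos a - cos b| ≤ |a - b| := by
  rw [cos_sub_cos]
  have h1 := abs_sin_le_one ((a + b) / 2)
  have h2 : |sin ((a - b) / 2)| ≤ |(a - b) / 2| := abs_sin_le_abs
  rw [abs_mul, abs_mul, abs_neg, abs_two]
  rw [abs_div, abs_two] at h2
  nlinarith [abs_nonneg (sin ((a - b) / 2)), abs_nonneg (sin ((a + b) / 2))]

lemma abs_sin_sub_sin_le (a b : ℝ) : |sin a - sin b| ≤ |a - b| := by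
  rw [sin_sub_sin]
  have h1 := abs_cos_le_one ((a + b) / 2)
  have h2 : |sin ((a - b) / 2)| ≤ |(a - b) / 2| := abs_sin_le_abs
  rw [abs_mul, abs_mul, abs_two]
  rw [abs_div, abs_two] at h2
  nlinarith [abs_nonneg (sin ((a - b) / 2)), abs_nonneg (cos ((a + b) / 2))]

lemma abs_phaseSpeed_sub_le (z : ℝ × ℝ) (ω a b : ℝ) :
    |phaseSpeed z ω a - phaseSpeed z ω b| ≤ 2 * ‖z‖ * |a - b| := by
  have h : phaseSpeed z ω a - phaseSpeed z ω b
      = z.2 * (cos a - cos b) - z.1 * (sin a - sin b) := by unfold phaseSpeed; ring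
  rw [h]
  calc _ ≤ |z.2 * (cos a - cos b)| + |z.1 * (sin a - sin b)| := abs_sub _ _
    _ = |z.2| * |cos a - cos b| + |z.1| * |sin a - sin b| := by rw [abs_mul, abs_mul]
    _ ≤ ‖z‖ * |a - b| + ‖z‖ * |a - b| := by
      exact add_le_add
        (mul_le_mul (abs_snd_le_norm z) (abs_cos_sub_cos_le a b) (abs_nonneg _) (norm_nonneg _))
        (mul_le_mul (abs_fst_le_norm z) (abs_sin_sub_sin_le a b) (abs_nonneg _) (norm_nonneg _))
    _ = _ := by ring

lemma abs_phaseSpeed_sub_le' (z z' : ℝ × ℝ) (ω ω' a : ℝ) :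
    |phaseSpeed z ω a - phaseSpeed z' ω' a| ≤ |ω - ω'| + 2 * ‖z - z'‖ := by
  have h : phaseSpeed z ω a - phaseSpeed z' ω' a
      = (ω - ω') + ((z - z').2 * cos a - (z - z').1 * sin a) := by
    unfold phaseSpeed; simp only [Prod.fst_sub, Prod.snd_sub]; ring
  rw [h]
  calc _ ≤ |ω - ω'| + |(z - z').2 * cos a - (z - z').1 * sin a| := abs_add_le _ _
    _ ≤ |ω - ω'| + (|(z - z').2 * cos a| + |(z - z').1 * sin a|) := by gcongr; exact abs_sub _ _
    _ = |ω - ω'| + (|(z - z').2| * |cos a| + |(z - z').1| * |sin a|) := by rw [abs_mul, abs_mul]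
    _ ≤ |ω - ω'| + (‖z - z'‖ * 1 + ‖z - z'‖ * 1) := by
      gcongr
      exacts [abs_snd_le_norm _, abs_cos_le_one a, abs_fst_le_norm _, abs_sin_le_one a]
    _ = _ := by ring

lemma abs_phaseSpeed_le (z : ℝ × ℝ) (ω a : ℝ) : |phaseSpeed z ω a| ≤ |ω| + 2 * ‖z‖ := by
  have := abs_phaseSpeed_sub_le' z 0 ω 0 a
  simpa [phaseSpeed] using this

/-- An exponential barrier for differential inequalities `|D'| ≤ b |D| + m exp (λ t)`. -/
lemma abs_le_exp_barrier {D D' : ℝ → ℝ} {T b lam m : ℝ} (hc : ContinuousOn D (Icc 0 T))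
    (hD : ∀ t ∈ Ico 0 T, HasDerivWithinAt D (D' t) (Ici t) t)
    (hb : ∀ t ∈ Ico 0 T, |D' t| ≤ b * |D t| + m * exp (lam * t)) (hl : b < lam) (hm : 0 ≤ m) :
    ∀ t ∈ Icc 0 T, |D t| ≤ (|D 0| + m / (lam - b)) * exp (lam * t) := by
  intro t ht
  have hlb : 0 < lam - b := by linarith
  -- The comparison theorem wants a strict inequality between derivatives wherever `|D|` meets the
  -- barrier. The slack `ε` provides it, and `m / (lam - b)` is the amplitude whose excess growth
  -- `lam - b` pays exactly for the forcing `m`.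
  have key : ∀ ε > 0, |D t| ≤ (|D 0| + m / (lam - b) + ε) * exp (lam * t) := by
    intro ε hε
    have hE : ∀ x : ℝ, HasDerivAt (fun t => (|D 0| + m / (lam - b) + ε) * exp (lam * t))
        ((|D 0| + m / (lam - b) + ε) * (exp (lam * x) * lam)) x := by
      intro x
      have h := ((hasDerivAt_id x).const_mul lam).exp.const_mul (|D 0| + m / (lam - b) + ε)
      simpa using h
    refine image_norm_le_of_norm_deriv_right_lt_deriv_boundary' (f := D) (f' := D')
      (a := 0) (b := T)
      (B := fun t => (|D 0| + m / (lam - b) + ε) * exp (lam * t))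
      (B' := fun x => (|D 0| + m / (lam - b) + ε) * (exp (lam * x) * lam)) hc hD ?_
      (fun x _ => (hE x).continuousAt.continuousWithinAt) (fun x _ => (hE x).hasDerivWithinAt) ?_ ht
    · simp only [mul_zero, exp_zero, mul_one, norm_eq_abs]
      have : 0 ≤ m / (lam - b) := by positivity
      linarith
    · intro x hx he
      simp only [norm_eq_abs] at he ⊢
      refine (hb x hx).trans_lt ?_
      rw [he]
      have hpos := exp_pos (lam * x)
      have h1 : m / (lam - b) * (lam - b) = m := div_mul_cancel₀ _ hlb.ne'
      have h2 : 0 ≤ |D 0| * (lam - b) := by positivity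
      have h3 : 0 < ε * (lam - b) := by positivity
      have h4 : b * (|D 0| + m / (lam - b) + ε) + m < (|D 0| + m / (lam - b) + ε) * lam := by
        nlinarith
      nlinarith
  have hlim : Tendsto (fun ε : ℝ => (|D 0| + m / (lam - b) + ε) * exp (lam * t)) (𝓝[>] 0)
      (𝓝 ((|D 0| + m / (lam - b) + 0) * exp (lam * t))) := by
    apply Tendsto.mono_left _ nhdsWithin_le_nhds
    exact Continuous.tendsto (f := fun ε : ℝ => (|D 0| + m / (lam - b) + ε) * exp (lam * t))
      (by fun_prop) 0
  rw [add_zero] at hlim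
  exact ge_of_tendsto hlim (eventually_mem_nhdsWithin.mono key)

/-- A phase moves on the line with frequency `ω` in the mean field `z`. -/
def IsPhaseCurve (z : ℝ → ℝ × ℝ) (ω : ℝ) (γ : ℝ → ℝ) : Prop :=
  ∀ t, HasDerivAt γ (phaseSpeed (z t) ω (γ t)) t

lemma lipschitzWith_phaseSpeed {z : ℝ × ℝ} {B : ℝ} (h : ‖z‖ ≤ B) (ω : ℝ) :
    LipschitzWith (2 * B).toNNReal (phaseSpeed z ω) := by
  refine LipschitzWith.of_dist_le_mul fun a b => ?_
  have hB : 0 ≤ B := (norm_nonneg z).trans h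
  rw [Real.dist_eq, Real.dist_eq, Real.coe_toNNReal _ (by positivity)]
  refine (abs_phaseSpeed_sub_le z ω a b).trans ?_
  gcongr

/-- The speed is bounded by `M` independently of the phase, so Picard–Lindelöf applies on every
interval around `s`, with a ball that the solution cannot leave. Uniqueness glues these solutions
into one on the whole line. -/
lemma exists_isPhaseCurve {z : ℝ → ℝ × ℝ} (hz : Continuous z) {B : ℝ} (hB : ∀ t, ‖z t‖ ≤ B)
    (ω s θ : ℝ) : ∃ γ, γ s = θ ∧ IsPhaseCurve z ω γ := by
  have hB0 : 0 ≤ B := (norm_nonneg _).trans (hB 0)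
  set M : ℝ := |ω| + 2 * B with hM
  have hM0 : 0 ≤ M := by positivity
  have hex : ∀ n : ℕ, ∃ α : ℝ → ℝ, α s = θ ∧ ∀ t ∈ Icc (s - (n + 1)) (s + (n + 1)),
      HasDerivWithinAt α (phaseSpeed (z t) ω (α t)) (Icc (s - (n + 1)) (s + (n + 1))) t := by
    intro n
    have hs : s ∈ Icc (s - ((n : ℝ) + 1)) (s + (n + 1)) :=
      ⟨by linarith [n.cast_nonneg (α := ℝ)], by linarith [n.cast_nonneg (α := ℝ)]⟩
    have hpl : IsPicardLindelof (fun t => phaseSpeed (z t) ω) (⟨s, hs⟩ : Icc _ _) θ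
        (M * (n + 1)).toNNReal 0 M.toNNReal (2 * B).toNNReal := by
      refine ⟨fun t _ => (lipschitzWith_phaseSpeed (hB t) ω).lipschitzOnWith, fun x _ => ?_,
        fun t _ x _ => ?_, ?_⟩
      · have : Continuous fun t => phaseSpeed (z t) ω x := by unfold phaseSpeed; fun_prop
        exact this.continuousOn
      · rw [Real.coe_toNNReal _ hM0, norm_eq_abs]
        exact (abs_phaseSpeed_le _ _ _).trans (by rw [hM]; linarith [hB t])
      · rw [Real.coe_toNNReal _ hM0, Real.coe_toNNReal _ (by positivity)]
        simp
    exact hpl.exists_eq_forall_mem_Icc_hasDerivWithinAt₀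
  choose α hα0 hα using hex
  have hα' : ∀ n : ℕ, ∀ t ∈ Ioo (s - ((n : ℝ) + 1)) (s + (n + 1)),
      HasDerivAt (α n) (phaseSpeed (z t) ω (α n t)) t := fun n t ht =>
    (hα n t (Ioo_subset_Icc_self ht)).hasDerivAt (Icc_mem_nhds ht.1 ht.2)
  have hle : ∀ m n : ℕ, m ≤ n → ∀ t ∈ Ioo (s - ((m : ℝ) + 1)) (s + (m + 1)), α m t = α n t := by
    intro m n hmn
    have hmn' : (m : ℝ) ≤ n := by exact_mod_cast hmn
    have hm0 : (0 : ℝ) ≤ m := m.cast_nonneg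
    refine ODE_solution_unique_of_mem_Ioo (v := fun t => phaseSpeed (z t) ω) (s := fun _ => univ)
      (fun t _ => (lipschitzWith_phaseSpeed (hB t) ω).lipschitzOnWith) (t₀ := s)
      ⟨by linarith, by linarith⟩ (fun t ht => ⟨hα' m t ht, mem_univ _⟩)
      (fun t ht => ⟨hα' n t ⟨by linarith [ht.1], by linarith [ht.2]⟩, mem_univ _⟩) ?_
    rw [hα0, hα0]
  -- At the time `t` the solution with index `⌈|t - s|⌉₊` is used. Moving `t` by less than one
  -- raises this index by at most one, so near `t` all these choices agree with the solution of
  -- index `n`.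
  refine ⟨fun t => α ⌈|t - s|⌉₊ t, hα0 _, fun t => ?_⟩
  set n := ⌈|t - s|⌉₊ + 1 with hn
  have hmem : ∀ (t : ℝ) (k : ℕ), |t - s| ≤ k → t ∈ Ioo (s - ((k : ℝ) + 1)) (s + (k + 1)) := by
    intro t k h
    obtain ⟨h1, h2⟩ := abs_le.1 h
    exact ⟨by linarith, by linarith⟩
  have hev : (fun t => α ⌈|t - s|⌉₊ t) =ᶠ[𝓝 t] α n := by
    filter_upwards [Metric.ball_mem_nhds t one_pos] with t' ht'
    refine hle _ _ ?_ t' (hmem _ _ (Nat.le_ceil _))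
    rw [hn, Nat.ceil_le]
    rw [Metric.mem_ball, Real.dist_eq] at ht'
    have h1 : |t' - s| ≤ |t' - t| + |t - s| := abs_sub_le _ _ _
    have h2 := Nat.le_ceil (|t - s|)
    push_cast
    linarith
  have hval : α ⌈|t - s|⌉₊ t = α n t := hev.self_of_nhds
  simp only [hval]
  refine (hα' n t (hmem _ _ ?_)).congr_of_eventuallyEq hev
  rw [hn]; push_cast
  linarith [Nat.le_ceil (|t - s|)]

/-- Two phases in two mean fields stay close, forward from the time `0`. -/
lemma abs_sub_le_of_hasDerivWithinAt {z z' : ℝ → ℝ × ℝ} {ω ω' B T lam m : ℝ} {γ γ' : ℝ → ℝ}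
    (hB : ∀ t ∈ Icc 0 T, ‖z t‖ ≤ B)
    (hγ : ∀ t ∈ Icc 0 T, HasDerivWithinAt γ (phaseSpeed (z t) ω (γ t)) (Icc 0 T) t)
    (hγ' : ∀ t ∈ Icc 0 T, HasDerivWithinAt γ' (phaseSpeed (z' t) ω' (γ' t)) (Icc 0 T) t)
    (hm : 0 ≤ m) (hzz : ∀ t ∈ Icc 0 T, |ω - ω'| + 2 * ‖z t - z' t‖ ≤ m * exp (lam * t))
    (hl : 2 * B < lam) :
    ∀ t ∈ Icc 0 T, |γ t - γ' t| ≤ (|γ 0 - γ' 0| + m / (lam - 2 * B)) * exp (lam * t) := by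
  refine abs_le_exp_barrier (D := fun t => γ t - γ' t)
    (D' := fun t => phaseSpeed (z t) ω (γ t) - phaseSpeed (z' t) ω' (γ' t)) (b := 2 * B)
    (fun t ht => ((hγ t ht).sub (hγ' t ht)).continuousWithinAt) (fun t ht => ?_) (fun t ht => ?_)
    hl hm
  · refine ((hγ t (Ico_subset_Icc_self ht)).sub
      (hγ' t (Ico_subset_Icc_self ht))).mono_of_mem_nhdsWithin ?_
    exact Icc_mem_nhdsGE_of_mem ht
  · have ht' := Ico_subset_Icc_self ht
    calc |phaseSpeed (z t) ω (γ t) - phaseSpeed (z' t) ω' (γ' t)|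
        ≤ |phaseSpeed (z t) ω (γ t) - phaseSpeed (z t) ω (γ' t)|
          + |phaseSpeed (z t) ω (γ' t) - phaseSpeed (z' t) ω' (γ' t)| := abs_sub_le _ _ _
      _ ≤ 2 * ‖z t‖ * |γ t - γ' t| + (|ω - ω'| + 2 * ‖z t - z' t‖) :=
        add_le_add (abs_phaseSpeed_sub_le _ _ _ _) (abs_phaseSpeed_sub_le' _ _ _ _ _)
      _ ≤ 2 * B * |γ t - γ' t| + m * exp (lam * t) := by
        gcongr
        exacts [hB t ht', hzz t ht']

lemma IsPhaseCurve.shift {z : ℝ → ℝ × ℝ} {ω : ℝ} {γ : ℝ → ℝ} (h : IsPhaseCurve z ω γ) (s : ℝ) :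
    IsPhaseCurve (fun t => z (s + t)) ω (fun t => γ (s + t)) := fun t =>
  (h (s + t)).comp_const_add s t

/-- At a fixed phase the speed is linear in the pair of field and frequency, so the sign produced by
reversing time can be moved onto both. -/
lemma IsPhaseCurve.reverse {z : ℝ → ℝ × ℝ} {ω : ℝ} {γ : ℝ → ℝ} (h : IsPhaseCurve z ω γ) (s : ℝ) :
    IsPhaseCurve (fun t => -z (s - t)) (-ω) (fun t => γ (s - t)) := fun t => by
  have := (h (s - t)).comp_const_sub s t
  refine this.congr_deriv ?_
  simp only [phaseSpeed, Prod.fst_neg, Prod.snd_neg]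
  ring

/-- Two phases in two mean fields stay close, forward and backward in time. -/
lemma IsPhaseCurve.abs_sub_le {z z' : ℝ → ℝ × ℝ} {ω ω' B m : ℝ} {γ γ' : ℝ → ℝ}
    (hB : ∀ t, ‖z t‖ ≤ B) (hγ : IsPhaseCurve z ω γ) (hγ' : IsPhaseCurve z' ω' γ')
    (hzz : ∀ t, |ω - ω'| + 2 * ‖z t - z' t‖ ≤ m) (s t : ℝ) :
    |γ t - γ' t| ≤ (|γ s - γ' s| + m) * exp ((2 * B + 1) * |t - s|) := by
  have hB0 : 0 ≤ B := (norm_nonneg _).trans (hB 0)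
  have hm : 0 ≤ m := (by positivity : (0 : ℝ) ≤ |ω - ω'| + 2 * ‖z 0 - z' 0‖).trans (hzz 0)
  have fwd : ∀ {z z' : ℝ → ℝ × ℝ} {ω ω' : ℝ} {γ γ' : ℝ → ℝ}, (∀ t, ‖z t‖ ≤ B) →
      IsPhaseCurve z ω γ → IsPhaseCurve z' ω' γ' → (∀ t, |ω - ω'| + 2 * ‖z t - z' t‖ ≤ m) →
      ∀ t, 0 ≤ t → |γ t - γ' t| ≤ (|γ 0 - γ' 0| + m) * exp ((2 * B + 1) * t) := by
    intro z z' ω ω' γ γ' hB hγ hγ' hzz t ht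
    -- At this rate `lam - 2 * B = 1`, so the denominator disappears. The backward estimate below is
    -- this forward one for the reversed curves.
    have := abs_sub_le_of_hasDerivWithinAt (T := t) (lam := 2 * B + 1) (m := m) (fun t _ => hB t)
      (fun t _ => (hγ t).hasDerivWithinAt) (fun t _ => (hγ' t).hasDerivWithinAt) hm
      (fun u hu => (hzz u).trans (le_mul_of_one_le_right hm
        (one_le_exp (mul_nonneg (by positivity) hu.1)))) (by linarith) t ⟨ht, le_rfl⟩
    simpa using this
  rcases le_total s t with h | h
  · have := fwd (fun t => hB (s + t)) (hγ.shift s) (hγ'.shift s) (fun t => hzz (s + t)) (t - s)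
      (by linarith)
    simpa [abs_of_nonneg (sub_nonneg.2 h)] using this
  · have := fwd (fun t => by simpa using hB (s - t)) (hγ.reverse s) (hγ'.reverse s)
      (fun t => by
        have := hzz (s - t)
        rwa [neg_sub_neg, neg_sub_neg, abs_sub_comm, norm_sub_rev]) (s - t) (by linarith)
    rw [abs_sub_comm t s, abs_of_nonneg (sub_nonneg.2 h)]
    simpa using this

/-! ### The flow on lifted phases -/

/-- Time-dependent mean fields on `I`, continuous in time, bounded and Lipschitz in space. -/
structure IsMeanField (B : ℝ) (Z : ℝ → unitInterval → ℝ × ℝ) : Prop where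
  continuous : ∀ x, Continuous fun t => Z t x
  norm_le : ∀ t x, ‖Z t x‖ ≤ B
  lipschitz : ∀ t x y, ‖Z t x - Z t y‖ ≤ B * |(x : ℝ) - y|

lemma IsMeanField.nonneg {B : ℝ} {Z : ℝ → unitInterval → ℝ × ℝ} (hZ : IsMeanField B Z) : 0 ≤ B :=
  (norm_nonneg _).trans (hZ.norm_le 0 0)

lemma IsMeanField.continuous_uncurry {B : ℝ} {Z : ℝ → unitInterval → ℝ × ℝ}
    (hZ : IsMeanField B Z) : Continuous fun q : ℝ × unitInterval => Z q.1 q.2 := by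
  refine continuous_prod_of_continuous_lipschitzWith' _ B.toNNReal (fun t => ?_)
    (fun x => hZ.continuous x)
  refine LipschitzWith.of_dist_le_mul fun x y => ?_
  rw [Real.coe_toNNReal _ hZ.nonneg, dist_eq_norm, Subtype.dist_eq, Real.dist_eq]
  exact hZ.lipschitz t x y

open Classical in
/-- The position at the time `t` of the phase, of frequency `ω` at the site `x` in the mean field
`Z`, that is `θ` at the time `s`. -/
def phaseFlow (Z : ℝ → unitInterval → ℝ × ℝ) (s t θ ω : ℝ) (x : unitInterval) : ℝ :=
  if h : ∃ γ : ℝ → ℝ, γ s = θ ∧ IsPhaseCurve (fun t => Z t x) ω γ then h.choose t else θ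

lemma phaseFlow_spec {B : ℝ} {Z : ℝ → unitInterval → ℝ × ℝ}
    (hZ : IsMeanField B Z) (s θ ω : ℝ) (x : unitInterval) :
    phaseFlow Z s s θ ω x = θ ∧
      IsPhaseCurve (fun t => Z t x) ω fun t => phaseFlow Z s t θ ω x := by
  have h := exists_isPhaseCurve (hZ.continuous x) (fun t => hZ.norm_le t x) ω s θ
  have h1 : ∀ t, phaseFlow Z s t θ ω x = h.choose t := fun t => by
    unfold phaseFlow; rw [dif_pos h]
  simp_rw [h1]
  exact h.choose_spec

lemma phaseFlow_self {B : ℝ} {Z : ℝ → unitInterval → ℝ × ℝ}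
    (hZ : IsMeanField B Z) (s θ ω : ℝ) (x : unitInterval) : phaseFlow Z s s θ ω x = θ :=
  (phaseFlow_spec hZ s θ ω x).1

lemma isPhaseCurve_phaseFlow {B : ℝ} {Z : ℝ → unitInterval → ℝ × ℝ}
    (hZ : IsMeanField B Z) (s θ ω : ℝ) (x : unitInterval) :
    IsPhaseCurve (fun t => Z t x) ω fun t => phaseFlow Z s t θ ω x :=
  (phaseFlow_spec hZ s θ ω x).2

/-- A change of site acts as a change of field of size `B * |x - x'|`. This single inequality yields
uniqueness, the group law and Lipschitz dependence on phase, frequency and site. -/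
lemma IsPhaseCurve.abs_sub_le_of_isMeanField {B : ℝ} {Z : ℝ → unitInterval → ℝ × ℝ}
    (hZ : IsMeanField B Z) {ω ω' : ℝ} {x x' : unitInterval} {γ γ' : ℝ → ℝ}
    (hγ : IsPhaseCurve (fun t => Z t x) ω γ) (hγ' : IsPhaseCurve (fun t => Z t x') ω' γ')
    (s t : ℝ) :
    |γ t - γ' t| ≤ (|γ s - γ' s| + (|ω - ω'| + 2 * (B * |(x : ℝ) - x'|)))
      * exp ((2 * B + 1) * |t - s|) :=
  IsPhaseCurve.abs_sub_le (fun t => hZ.norm_le t x) hγ hγ'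
    (fun t => by gcongr; exact hZ.lipschitz t x x') s t

lemma IsPhaseCurve.eq_phaseFlow {B : ℝ} {Z : ℝ → unitInterval → ℝ × ℝ}
    (hZ : IsMeanField B Z) {ω : ℝ} {x : unitInterval} {γ : ℝ → ℝ}
    (hγ : IsPhaseCurve (fun t => Z t x) ω γ) (s t : ℝ) : γ t = phaseFlow Z s t (γ s) ω x := by
  have := hγ.abs_sub_le_of_isMeanField hZ (isPhaseCurve_phaseFlow hZ s (γ s) ω x) s t
  rw [phaseFlow_self hZ] at this
  simp only [sub_self, abs_zero, mul_zero, add_zero, zero_mul] at this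
  exact sub_eq_zero.1 (abs_nonpos_iff.1 this)

lemma phaseFlow_phaseFlow {B : ℝ} {Z : ℝ → unitInterval → ℝ × ℝ}
    (hZ : IsMeanField B Z) (s u t θ ω : ℝ) (x : unitInterval) :
    phaseFlow Z u t (phaseFlow Z s u θ ω x) ω x = phaseFlow Z s t θ ω x :=
  ((isPhaseCurve_phaseFlow hZ s θ ω x).eq_phaseFlow hZ u t).symm

lemma abs_phaseFlow_sub_le {B : ℝ} {Z : ℝ → unitInterval → ℝ × ℝ}
    (hZ : IsMeanField B Z) (s t θ θ' ω ω' : ℝ) (x x' : unitInterval) :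
    |phaseFlow Z s t θ ω x - phaseFlow Z s t θ' ω' x'| ≤
      (|θ - θ'| + (|ω - ω'| + 2 * (B * |(x : ℝ) - x'|))) * exp ((2 * B + 1) * |t - s|) := by
  have := (isPhaseCurve_phaseFlow hZ s θ ω x).abs_sub_le_of_isMeanField hZ
    (isPhaseCurve_phaseFlow hZ s θ' ω' x') s t
  simpa only [phaseFlow_self hZ] using this

/-- Every nearby curve is compared with the fixed curve `γ` through the base point, starting from
the new initial time. This gives an explicit continuous majorant `E` that vanishes at `q₀`, so all
five variables are treated at once. -/
lemma continuous_phaseFlow {B : ℝ} {Z : ℝ → unitInterval → ℝ × ℝ}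
    (hZ : IsMeanField B Z) : Continuous fun q : ℝ × ℝ × ℝ × ℝ × unitInterval =>
    phaseFlow Z q.1 q.2.1 q.2.2.1 q.2.2.2.1 q.2.2.2.2 := by
  refine continuous_iff_continuousAt.2 fun q₀ => ?_
  set γ : ℝ → ℝ := fun t => phaseFlow Z q₀.1 t q₀.2.2.1 q₀.2.2.2.1 q₀.2.2.2.2 with hγdef
  have hγ := isPhaseCurve_phaseFlow hZ q₀.1 q₀.2.2.1 q₀.2.2.2.1 q₀.2.2.2.2
  have hγc : Continuous γ := continuous_iff_continuousAt.2 fun t => (hγ t).continuousAt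
  have hγ0 : γ q₀.1 = q₀.2.2.1 := phaseFlow_self hZ _ _ _ _
  set E : ℝ × ℝ × ℝ × ℝ × unitInterval → ℝ := fun q =>
    (|q.2.2.1 - γ q.1| + (|q.2.2.2.1 - q₀.2.2.2.1| + 2 * (B * |(q.2.2.2.2 : ℝ) - q₀.2.2.2.2|)))
      * exp ((2 * B + 1) * |q.2.1 - q.1|) + |γ q.2.1 - γ q₀.2.1| with hE
  have hEc : Continuous E := by fun_prop
  have hE0 : E q₀ = 0 := by simp [hE, hγ0]
  rw [ContinuousAt, tendsto_iff_dist_tendsto_zero]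
  refine squeeze_zero (fun _ => dist_nonneg) (fun q => ?_) (hE0 ▸ hEc.tendsto q₀)
  rw [Real.dist_eq]
  refine (abs_sub_le _ (γ q.2.1) _).trans (add_le_add ?_ le_rfl)
  have := (isPhaseCurve_phaseFlow hZ q.1 q.2.2.1 q.2.2.2.1 q.2.2.2.2).abs_sub_le_of_isMeanField hZ
    hγ q.1 q.2.1
  rwa [phaseFlow_self hZ] at this

lemma phaseFlow_add_two_pi {B : ℝ} {Z : ℝ → unitInterval → ℝ × ℝ}
    (hZ : IsMeanField B Z) (s t θ ω : ℝ) (x : unitInterval) :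
    phaseFlow Z s t (θ + 2 * π) ω x = phaseFlow Z s t θ ω x + 2 * π := by
  have h : IsPhaseCurve (fun t => Z t x) ω fun t => phaseFlow Z s t θ ω x + 2 * π := fun t => by
    refine ((isPhaseCurve_phaseFlow hZ s θ ω x t).add_const (2 * π)).congr_deriv ?_
    simp [phaseSpeed]
  have := h.eq_phaseFlow hZ s t
  simp only [phaseFlow_self hZ] at this
  exact this.symm

/-! ### Differentiability of the flow in the phase -/

/-- The difference quotient in the phase of the speed. -/
def speedSlope (z : ℝ × ℝ) (a b : ℝ) : ℝ :=
  (-z.2 * sin ((a + b) / 2) - z.1 * cos ((a + b) / 2)) * sinc ((a - b) / 2)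

/-- The sum-to-product formulas extract the factor `sin ((a - b) / 2)`, and `sinc` extends the
quotient continuously across the diagonal. -/
lemma phaseSpeed_sub (z : ℝ × ℝ) (ω a b : ℝ) :
    phaseSpeed z ω a - phaseSpeed z ω b = speedSlope z a b * (a - b) := by
  have hs : sinc ((a - b) / 2) * (a - b) = 2 * sin ((a - b) / 2) := by
    rcases eq_or_ne ((a - b) / 2) 0 with h | h
    · have : a - b = 0 := by linarith
      simp [this]
    · rw [sinc_of_ne_zero h]
      have : a - b ≠ 0 := fun h' => h (by rw [h']; simp)
      field_simp
  have h : phaseSpeed z ω a - phaseSpeed z ω b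
      = z.2 * (cos a - cos b) - z.1 * (sin a - sin b) := by unfold phaseSpeed; ring
  rw [h, cos_sub_cos, sin_sub_sin, speedSlope]
  linear_combination (z.2 * sin ((a + b) / 2) + z.1 * cos ((a + b) / 2)) * hs

lemma continuous_speedSlope :
    Continuous fun q : (ℝ × ℝ) × ℝ × ℝ => speedSlope q.1 q.2.1 q.2.2 := by
  unfold speedSlope
  have := Real.continuous_sinc
  fun_prop

lemma speedSlope_add_two_pi (z : ℝ × ℝ) (a b : ℝ) :
    speedSlope z (a + 2 * π) (b + 2 * π) = speedSlope z a b := by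
  unfold speedSlope
  have h1 : (a + 2 * π + (b + 2 * π)) / 2 = (a + b) / 2 + 2 * π := by ring
  have h2 : (a + 2 * π - (b + 2 * π)) / 2 = (a - b) / 2 := by ring
  rw [h1, h2, sin_add_two_pi, cos_add_two_pi]

/-- The derivative of the flow with respect to the phase. -/
def phaseJac (Z : ℝ → unitInterval → ℝ × ℝ) (s t θ ω : ℝ) (x : unitInterval) : ℝ :=
  exp (∫ τ in s..t, speedSlope (Z τ x) (phaseFlow Z s τ θ ω x) (phaseFlow Z s τ θ ω x))

lemma phaseJac_pos (Z : ℝ → unitInterval → ℝ × ℝ) (s t θ ω : ℝ) (x : unitInterval) :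
    0 < phaseJac Z s t θ ω x := exp_pos _

lemma continuous_speedSlope_phaseFlow {B : ℝ} {Z : ℝ → unitInterval → ℝ × ℝ}
    (hZ : IsMeanField B Z) (s ω : ℝ) (x : unitInterval) :
    Continuous fun q : (ℝ × ℝ) × ℝ => speedSlope (Z q.2 x) (phaseFlow Z s q.2 q.1.1 ω x)
      (phaseFlow Z s q.2 q.1.2 ω x) := by
  have h1 : Continuous fun q : (ℝ × ℝ) × ℝ => Z q.2 x := (hZ.continuous x).comp continuous_snd
  have h2 : Continuous fun q : (ℝ × ℝ) × ℝ => phaseFlow Z s q.2 q.1.1 ω x :=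
    (continuous_phaseFlow hZ).comp
      (f := fun q : (ℝ × ℝ) × ℝ => (s, q.2, q.1.1, ω, x)) (by fun_prop)
  have h3 : Continuous fun q : (ℝ × ℝ) × ℝ => phaseFlow Z s q.2 q.1.2 ω x :=
    (continuous_phaseFlow hZ).comp
      (f := fun q : (ℝ × ℝ) × ℝ => (s, q.2, q.1.2, ω, x)) (by fun_prop)
  exact continuous_speedSlope.comp (h1.prodMk (h2.prodMk h3))

/-- The difference of two curves in the same field solves a linear scalar equation with coefficient
`speedSlope`, so it is an exponential. Being exact, the formula replaces the linearised equation for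
the derivative in the initial phase. -/
lemma phaseFlow_sub {B : ℝ} {Z : ℝ → unitInterval → ℝ × ℝ}
    (hZ : IsMeanField B Z) (s t θ θ' ω : ℝ) (x : unitInterval) :
    phaseFlow Z s t θ ω x - phaseFlow Z s t θ' ω x = (θ - θ') *
      exp (∫ τ in s..t, speedSlope (Z τ x) (phaseFlow Z s τ θ ω x) (phaseFlow Z s τ θ' ω x)) := by
  set q : ℝ → ℝ := fun τ => speedSlope (Z τ x) (phaseFlow Z s τ θ ω x) (phaseFlow Z s τ θ' ω x)
    with hq
  have hqc : Continuous q := (continuous_speedSlope_phaseFlow hZ s ω x).comp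
    (f := fun τ : ℝ => ((θ, θ'), τ)) (by fun_prop)
  set u : ℝ → ℝ := fun t => (phaseFlow Z s t θ ω x - phaseFlow Z s t θ' ω x)
    * exp (-∫ τ in s..t, q τ) with hu
  have hd : ∀ t, HasDerivAt u 0 t := by
    intro t
    have h1 := (isPhaseCurve_phaseFlow hZ s θ ω x t).sub (isPhaseCurve_phaseFlow hZ s θ' ω x t)
    have h2 := (hqc.integral_hasStrictDerivAt s t).hasDerivAt.neg.exp
    refine (h1.mul h2).congr_deriv ?_
    simp only [Pi.sub_apply]
    rw [phaseSpeed_sub]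
    ring
  have hconst := is_const_of_deriv_eq_zero (fun t => (hd t).differentiableAt)
    (fun t => (hd t).deriv) t s
  simp only [hu, intervalIntegral.integral_same, neg_zero, exp_zero, mul_one,
    phaseFlow_self hZ] at hconst
  rw [exp_neg, ← div_eq_mul_inv, div_eq_iff (exp_pos _).ne'] at hconst
  exact hconst

lemma hasDerivAt_phaseFlow {B : ℝ} {Z : ℝ → unitInterval → ℝ × ℝ}
    (hZ : IsMeanField B Z) (s t θ ω : ℝ) (x : unitInterval) :
    HasDerivAt (fun θ => phaseFlow Z s t θ ω x) (phaseJac Z s t θ ω x) θ := by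
  rw [hasDerivAt_iff_tendsto_slope]
  have hc : Continuous fun θ' => exp (∫ τ in s..t, speedSlope (Z τ x) (phaseFlow Z s τ θ' ω x)
      (phaseFlow Z s τ θ ω x)) := by
    refine continuous_exp.comp
      (intervalIntegral.continuous_parametric_intervalIntegral_of_continuous' ?_ s t)
    exact (continuous_speedSlope_phaseFlow hZ s ω x).comp
      (f := fun q : ℝ × ℝ => ((q.1, θ), q.2)) (by fun_prop)
  -- The difference quotient is the exponential in `hc`, which remains continuous at `θ' = θ` and
  -- takes the value of the Jacobian there.
  refine Tendsto.congr' ?_ ((hc.tendsto θ).mono_left nhdsWithin_le_nhds)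
  filter_upwards [self_mem_nhdsWithin] with θ' hθ'
  rw [slope_def_field, phaseFlow_sub hZ]
  have : θ' - θ ≠ 0 := sub_ne_zero.2 hθ'
  field_simp

lemma continuous_phaseJac {B : ℝ} {Z : ℝ → unitInterval → ℝ × ℝ}
    (hZ : IsMeanField B Z) : Continuous fun q : ℝ × ℝ × ℝ × ℝ × unitInterval =>
    phaseJac Z q.1 q.2.1 q.2.2.1 q.2.2.2.1 q.2.2.2.2 := by
  set f : ℝ × ℝ × ℝ × ℝ × unitInterval → ℝ → ℝ := fun q τ => speedSlope (Z τ q.2.2.2.2)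
    (phaseFlow Z q.1 τ q.2.2.1 q.2.2.2.1 q.2.2.2.2)
    (phaseFlow Z q.1 τ q.2.2.1 q.2.2.2.1 q.2.2.2.2) with hf
  have hfc : Continuous f.uncurry := by
    have h1 : Continuous fun q : (ℝ × ℝ × ℝ × ℝ × unitInterval) × ℝ => Z q.2 q.1.2.2.2.2 :=
      hZ.continuous_uncurry.comp
        (f := fun q : (ℝ × ℝ × ℝ × ℝ × unitInterval) × ℝ => (q.2, q.1.2.2.2.2)) (by fun_prop)
    have h2 : Continuous fun q : (ℝ × ℝ × ℝ × ℝ × unitInterval) × ℝ =>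
        phaseFlow Z q.1.1 q.2 q.1.2.2.1 q.1.2.2.2.1 q.1.2.2.2.2 :=
      (continuous_phaseFlow hZ).comp (f := fun q : (ℝ × ℝ × ℝ × ℝ × unitInterval) × ℝ =>
        (q.1.1, q.2, q.1.2.2.1, q.1.2.2.2.1, q.1.2.2.2.2)) (by fun_prop)
    exact continuous_speedSlope.comp (h1.prodMk (h2.prodMk h2))
  -- Both endpoints vary, so the integral is split at the fixed time `0`.
  have h1 : Continuous fun q : ℝ × ℝ × ℝ × ℝ × unitInterval => ∫ τ in (0 : ℝ)..q.2.1, f q τ :=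
    intervalIntegral.continuous_parametric_intervalIntegral_of_continuous hfc (by fun_prop)
  have h2 : Continuous fun q : ℝ × ℝ × ℝ × ℝ × unitInterval => ∫ τ in (0 : ℝ)..q.1, f q τ :=
    intervalIntegral.continuous_parametric_intervalIntegral_of_continuous hfc (by fun_prop)
  refine continuous_exp.comp ((h1.sub h2).congr fun q => ?_)
  have hi : ∀ a b, IntervalIntegrable (f q) volume a b := fun a b =>
    (hfc.comp (f := fun τ => (q, τ)) (by fun_prop)).intervalIntegrable a b
  exact intervalIntegral.integral_interval_sub_left (hi _ _) (hi _ _)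

lemma phaseJac_add_two_pi {B : ℝ} {Z : ℝ → unitInterval → ℝ × ℝ}
    (hZ : IsMeanField B Z) (s t θ ω : ℝ) (x : unitInterval) :
    phaseJac Z s t (θ + 2 * π) ω x = phaseJac Z s t θ ω x := by
  unfold phaseJac
  simp only [phaseFlow_add_two_pi hZ, speedSlope_add_two_pi]

/-! ### Descent to the circle and transport of densities -/

/-- A real lift of a point of the circle. -/
def circRep (θ : Circ) : ℝ := Quotient.out θ

@[simp] lemma coe_circRep (θ : Circ) : ((circRep θ : ℝ) : Circ) = θ := Quotient.out_eq θ

lemma _root_.Function.Periodic.eq_of_coe_eq {β : Type*} {f : ℝ → β} {c : ℝ}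
    (hf : Function.Periodic f c)
    {a b : ℝ} (h : (a : AddCircle c) = b) : f a = f b := by
  rw [← hf.lift_coe a, ← hf.lift_coe b]
  exact congrArg _ h

lemma _root_.Function.Periodic.apply_circRep {β : Type*} {f : ℝ → β}
    (hf : Function.Periodic f (2 * π))
    (a : ℝ) : f (circRep (a : Circ)) = f a := hf.eq_of_coe_eq (coe_circRep _)

/-- The lift of `θ'` nearest to `a` realises the geodesic distance on the line. This is how
Lipschitz estimates for lifted phases become estimates on the circle. -/
lemma exists_lift_dist_eq (θ θ' : Circ) (a : ℝ) (ha : (a : Circ) = θ) :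
    ∃ b : ℝ, (b : Circ) = θ' ∧ |a - b| = dist θ θ' := by
  set c := circRep θ'
  refine ⟨c + round ((2 * π)⁻¹ * (a - c)) * (2 * π), ?_, ?_⟩
  · have : ((round ((2 * π)⁻¹ * (a - c)) * (2 * π) : ℝ) : Circ) = 0 := by
      rw [← zsmul_eq_mul]
      simp only [AddCircle.coe_zsmul, AddCircle.coe_period, smul_zero]
    rw [AddCircle.coe_add, this, add_zero, coe_circRep]
  · rw [dist_eq_norm, ← ha, ← coe_circRep θ', ← AddCircle.coe_sub, AddCircle.norm_eq]
    congr 1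
    ring

lemma dist_coe_le (a b : ℝ) : dist (a : Circ) (b : Circ) ≤ |a - b| := by
  rw [dist_eq_norm, ← AddCircle.coe_sub]
  exact QuotientAddGroup.norm_mk_le_norm

/-- Open quotient maps are stable under products, so continuity on the phase space, with parameters
in `X`, can be tested on real phases. -/
lemma isOpenQuotientMap_lift (X : Type*) [TopologicalSpace X] :
    IsOpenQuotientMap fun q : X × ℝ × ℝ × unitInterval =>
      ((q.1, ((q.2.1 : Circ), q.2.2)) : X × PhaseSpace) :=
  IsOpenQuotientMap.id.prodMap
    ((QuotientAddGroup.isOpenQuotientMap_mk (N := AddSubgroup.zmultiples (2 * π))).prodMap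
      IsOpenQuotientMap.id)

lemma continuous_of_continuous_lift {X Y : Type*} [TopologicalSpace X] [TopologicalSpace Y]
    {f : X × PhaseSpace → Y}
    (h : Continuous fun q : X × ℝ × ℝ × unitInterval => f (q.1, ((q.2.1 : Circ), q.2.2))) :
    Continuous f :=
  (isOpenQuotientMap_lift X).isQuotientMap.continuous_iff.2 h

/-- The flow of the mean field `Z` on the phase space. -/
def flowMap (Z : ℝ → unitInterval → ℝ × ℝ) (s t : ℝ) (P : PhaseSpace) : PhaseSpace :=
  ((phaseFlow Z s t (circRep P.1) P.2.1 P.2.2 : ℝ), P.2)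

/-- The Jacobian of the flow of the mean field `Z` on the phase space. -/
def flowJac (Z : ℝ → unitInterval → ℝ × ℝ) (s t : ℝ) (P : PhaseSpace) : ℝ :=
  phaseJac Z s t (circRep P.1) P.2.1 P.2.2

/-- The density at the time `t` of the image under the flow of a measure of density `r`. -/
def flowDensity (Z : ℝ → unitInterval → ℝ × ℝ) (r : PhaseSpace → ℝ) (t : ℝ) (P : PhaseSpace) : ℝ :=
  r (flowMap Z t 0 P) * flowJac Z t 0 P

lemma flowMap_snd (Z : ℝ → unitInterval → ℝ × ℝ) (s t : ℝ) (P : PhaseSpace) :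
    (flowMap Z s t P).2 = P.2 := rfl

lemma flowMap_coe {B : ℝ} {Z : ℝ → unitInterval → ℝ × ℝ} (hZ : IsMeanField B Z) (s t θ ω : ℝ)
    (x : unitInterval) :
    flowMap Z s t ((θ : Circ), ω, x) = (((phaseFlow Z s t θ ω x : ℝ) : Circ), ω, x) := by
  have hp : Function.Periodic (fun θ => ((phaseFlow Z s t θ ω x : ℝ) : Circ)) (2 * π) := fun θ => by
    simp only [phaseFlow_add_two_pi hZ, AddCircle.coe_add_period]
  exact Prod.ext (hp.apply_circRep θ) rfl

lemma flowJac_coe {B : ℝ} {Z : ℝ → unitInterval → ℝ × ℝ} (hZ : IsMeanField B Z) (s t θ ω : ℝ)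
    (x : unitInterval) : flowJac Z s t ((θ : Circ), ω, x) = phaseJac Z s t θ ω x :=
  Function.Periodic.apply_circRep (f := fun θ => phaseJac Z s t θ ω x)
    (fun θ => phaseJac_add_two_pi hZ s t θ ω x) θ

lemma flowMap_self {B : ℝ} {Z : ℝ → unitInterval → ℝ × ℝ} (hZ : IsMeanField B Z) (s : ℝ)
    (P : PhaseSpace) : flowMap Z s s P = P := by
  refine Prod.ext ?_ rfl
  simp only [flowMap, phaseFlow_self hZ, coe_circRep]

lemma continuous_flowMap {B : ℝ} {Z : ℝ → unitInterval → ℝ × ℝ} (hZ : IsMeanField B Z) :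
    Continuous fun q : (ℝ × ℝ) × PhaseSpace => flowMap Z q.1.1 q.1.2 q.2 := by
  apply continuous_of_continuous_lift
  simp only [flowMap_coe hZ]
  have h : Continuous fun q : (ℝ × ℝ) × ℝ × ℝ × unitInterval =>
      phaseFlow Z q.1.1 q.1.2 q.2.1 q.2.2.1 q.2.2.2 :=
    (continuous_phaseFlow hZ).comp (f := fun q : (ℝ × ℝ) × ℝ × ℝ × unitInterval =>
      (q.1.1, q.1.2, q.2.1, q.2.2.1, q.2.2.2)) (by fun_prop)
  exact ((AddCircle.continuous_mk' (2 * π)).comp h).prodMk (by fun_prop)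

lemma continuous_flowMap_apply {B : ℝ} {Z : ℝ → unitInterval → ℝ × ℝ} (hZ : IsMeanField B Z)
    (s t : ℝ) : Continuous (flowMap Z s t) :=
  (continuous_flowMap hZ).comp (f := fun P : PhaseSpace => ((s, t), P)) (by fun_prop)

lemma continuous_flowJac {B : ℝ} {Z : ℝ → unitInterval → ℝ × ℝ} (hZ : IsMeanField B Z) :
    Continuous fun q : (ℝ × ℝ) × PhaseSpace => flowJac Z q.1.1 q.1.2 q.2 := by
  apply continuous_of_continuous_lift
  simp only [flowJac_coe hZ]
  exact (continuous_phaseJac hZ).comp (f := fun q : (ℝ × ℝ) × ℝ × ℝ × unitInterval =>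
      (q.1.1, q.1.2, q.2.1, q.2.2.1, q.2.2.2)) (by fun_prop)

lemma continuous_flowDensity {B : ℝ} {Z : ℝ → unitInterval → ℝ × ℝ} (hZ : IsMeanField B Z)
    {r : PhaseSpace → ℝ} (hr : Continuous r) :
    Continuous fun q : ℝ × PhaseSpace => flowDensity Z r q.1 q.2 := by
  have h : Continuous fun q : ℝ × PhaseSpace => (((q.1, 0), q.2) : (ℝ × ℝ) × PhaseSpace) := by
    fun_prop
  exact (hr.comp ((continuous_flowMap hZ).comp h)).mul ((continuous_flowJac hZ).comp h)

lemma measurable_flowDensity {B : ℝ} {Z : ℝ → unitInterval → ℝ × ℝ} (hZ : IsMeanField B Z)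
    {r : PhaseSpace → ℝ} (hr : Continuous r) (t : ℝ) : Measurable (flowDensity Z r t) :=
  ((continuous_flowDensity hZ hr).comp (f := fun P : PhaseSpace => (t, P)) (by fun_prop)).measurable

lemma flowDensity_nonneg (Z : ℝ → unitInterval → ℝ × ℝ) {r : PhaseSpace → ℝ} (hr : ∀ P, 0 ≤ r P)
    (t : ℝ) (P : PhaseSpace) : 0 ≤ flowDensity Z r t P :=
  mul_nonneg (hr _) (phaseJac_pos _ _ _ _ _ _).le

lemma flowDensity_zero {B : ℝ} {Z : ℝ → unitInterval → ℝ × ℝ} (hZ : IsMeanField B Z)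
    (r : PhaseSpace → ℝ) : flowDensity Z r 0 = r := by
  funext P
  simp [flowDensity, flowMap_self hZ, flowJac, phaseJac]

/-- The change of variables along the flow on a circle. -/
lemma integral_flowDensity_mul {B : ℝ} {Z : ℝ → unitInterval → ℝ × ℝ} (hZ : IsMeanField B Z)
    {r f : PhaseSpace → ℝ} (hr : Continuous r) (hf : Continuous f) (t ω : ℝ) (x : unitInterval) :
    ∫ θ : Circ, flowDensity Z r t (θ, ω, x) * f (θ, ω, x)
      = ∫ θ : Circ, r (θ, ω, x) * f (flowMap Z 0 t (θ, ω, x)) := by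
  set Ψ : ℝ → ℝ := fun θ => phaseFlow Z t 0 θ ω x with hΨ
  set G : ℝ → ℝ := fun θ => r ((θ : Circ), ω, x) * f (flowMap Z 0 t ((θ : Circ), ω, x)) with hG
  have hcoe : Continuous fun θ : ℝ => (((θ : Circ), ω, x) : PhaseSpace) :=
    (AddCircle.continuous_mk' (2 * π)).prodMk continuous_const
  have hGc : Continuous G :=
    (hr.comp hcoe).mul (hf.comp ((continuous_flowMap_apply hZ 0 t).comp hcoe))
  -- An integral over the circle may be computed over any interval of length `2 * π`. The one on the
  -- right starts at `Ψ 0`, so that it is the image of `[0, 2 * π]` under the lifted flow `Ψ`.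
  rw [← AddCircle.intervalIntegral_preimage (2 * π) 0,
    ← AddCircle.intervalIntegral_preimage (2 * π) (Ψ 0)]
  have hJ : Continuous fun θ => phaseJac Z t 0 θ ω x :=
    (continuous_phaseJac hZ).comp (f := fun θ : ℝ => (t, 0, θ, ω, x)) (by fun_prop)
  have hper : Ψ 0 + 2 * π = Ψ (0 + 2 * π) := (phaseFlow_add_two_pi hZ t 0 0 ω x).symm
  rw [hper]
  refine Eq.trans ?_ (intervalIntegral.integral_comp_mul_deriv (f := Ψ)
    (f' := fun θ => phaseJac Z t 0 θ ω x) (g := G)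
    (fun θ _ => hasDerivAt_phaseFlow hZ t 0 θ ω x) hJ.continuousOn hGc)
  refine intervalIntegral.integral_congr fun θ _ => ?_
  simp only [flowDensity, flowMap_coe hZ, flowJac_coe hZ, hG, hΨ, Function.comp,
    phaseFlow_phaseFlow hZ, phaseFlow_self hZ]
  ring

lemma lintegral_flowDensity_mul {B : ℝ} {Z : ℝ → unitInterval → ℝ × ℝ} (hZ : IsMeanField B Z)
    {r : PhaseSpace → ℝ} (hr : Continuous r) (hr0 : ∀ P, 0 ≤ r P) {f : PhaseSpace → ℝ}
    (hf : Continuous f) (hf0 : ∀ P, 0 ≤ f P) (t : ℝ) (y : ℝ × unitInterval) :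
    ∫⁻ θ : Circ, ENNReal.ofReal (flowDensity Z r t (θ, y) * f (θ, y))
      = ∫⁻ θ : Circ, ENNReal.ofReal (r (θ, y) * f (flowMap Z 0 t (θ, y))) := by
  have hpt : Continuous fun θ : Circ => ((θ, y) : PhaseSpace) := by fun_prop
  have hint : ∀ g : Circ → ℝ, Continuous g → Integrable g := fun g hg =>
    hg.integrable_of_hasCompactSupport (HasCompactSupport.of_compactSpace g)
  have h1 : Continuous fun θ : Circ => flowDensity Z r t (θ, y) * f (θ, y) :=
    ((continuous_flowDensity hZ hr).comp (f := fun θ : Circ => (t, ((θ, y) : PhaseSpace)))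
      (by fun_prop)).mul (hf.comp hpt)
  have h2 : Continuous fun θ : Circ => r (θ, y) * f (flowMap Z 0 t (θ, y)) :=
    (hr.comp hpt).mul (hf.comp ((continuous_flowMap_apply hZ 0 t).comp hpt))
  rw [← ofReal_integral_eq_lintegral_ofReal (hint _ h1)
      (Eventually.of_forall fun θ => mul_nonneg (flowDensity_nonneg Z hr0 t _) (hf0 _)),
    ← ofReal_integral_eq_lintegral_ofReal (hint _ h2)
      (Eventually.of_forall fun θ => mul_nonneg (hr0 _) (hf0 _))]
  exact congrArg _ (integral_flowDensity_mul hZ hr hf t y.1 y.2)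

/-- The image under the flow of a measure of continuous density. -/
lemma densityMeasure_flowDensity {B : ℝ} {Z : ℝ → unitInterval → ℝ × ℝ} (hZ : IsMeanField B Z)
    {r : PhaseSpace → ℝ} (hr : Continuous r) (hr0 : ∀ P, 0 ≤ r P)
    [IsFiniteMeasure (densityMeasure r)] (t : ℝ) :
    densityMeasure (flowDensity Z r t) = (densityMeasure r).map (flowMap Z 0 t) := by
  symm
  refine ext_of_forall_lintegral_eq_of_IsFiniteMeasure fun f => ?_
  have hΦ : Continuous (flowMap Z 0 t) := continuous_flowMap_apply hZ 0 t
  have hρ : Continuous (flowDensity Z r t) :=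
    (continuous_flowDensity hZ hr).comp (f := fun P : PhaseSpace => (t, P)) (by fun_prop)
  have hf : Continuous fun P => (f P : ℝ) := NNReal.continuous_coe.comp f.continuous
  have hfm : Measurable fun P => (f P : ℝ≥0∞) :=
    (ENNReal.continuous_coe.comp f.continuous).measurable
  have e1 : ∀ P, ENNReal.ofReal (r P) * (f (flowMap Z 0 t P) : ℝ≥0∞)
      = ENNReal.ofReal (r P * f (flowMap Z 0 t P)) := fun P => by
    rw [ENNReal.ofReal_mul (hr0 P), ENNReal.ofReal_coe_nnreal]
  have e2 : ∀ P, ENNReal.ofReal (flowDensity Z r t P) * (f P : ℝ≥0∞)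
      = ENNReal.ofReal (flowDensity Z r t P * f P) := fun P => by
    rw [ENNReal.ofReal_mul (flowDensity_nonneg Z hr0 t P), ENNReal.ofReal_coe_nnreal]
  have hfΦ : Measurable fun P => (f (flowMap Z 0 t P) : ℝ≥0∞) := hfm.comp hΦ.measurable
  rw [lintegral_map hfm hΦ.measurable, densityMeasure, densityMeasure,
    lintegral_withDensity_eq_lintegral_mul _ hr.measurable.ennreal_ofReal hfΦ,
    lintegral_withDensity_eq_lintegral_mul _ hρ.measurable.ennreal_ofReal hfm]
  simp only [Pi.mul_apply, e1, e2]
  have m1 : Measurable fun P => ENNReal.ofReal (r P * f (flowMap Z 0 t P)) :=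
    (hr.mul (hf.comp hΦ)).measurable.ennreal_ofReal
  have m2 : Measurable fun P => ENNReal.ofReal (flowDensity Z r t P * f P) :=
    (hρ.mul hf).measurable.ennreal_ofReal
  -- The flow fixes frequency and site, so after integrating the phase first the change of variables
  -- takes place on one circle at a time.
  rw [Measure.volume_eq_prod, lintegral_prod_symm _ m1.aemeasurable,
    lintegral_prod_symm _ m2.aemeasurable]
  exact lintegral_congr fun y =>
    (lintegral_flowDensity_mul hZ hr hr0 hf (fun P => (f P).coe_nonneg) t y).symm

lemma integral_densityMeasure {ρ : PhaseSpace → ℝ} (hρ : Measurable ρ) (hρ0 : ∀ P, 0 ≤ ρ P)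
    (f : PhaseSpace → ℝ) : ∫ P, f P ∂(densityMeasure ρ) = ∫ P, ρ P * f P := by
  rw [densityMeasure, integral_withDensity_eq_integral_toReal_smul hρ.ennreal_ofReal
    (Eventually.of_forall fun _ => ENNReal.ofReal_lt_top)]
  simp only [ENNReal.toReal_ofReal (hρ0 _), smul_eq_mul]

lemma integrable_of_isFiniteMeasure_densityMeasure {ρ : PhaseSpace → ℝ} (hρ : Measurable ρ)
    (hρ0 : ∀ P, 0 ≤ ρ P) [IsFiniteMeasure (densityMeasure ρ)] : Integrable ρ := by
  refine ⟨hρ.aestronglyMeasurable, ?_⟩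
  rw [hasFiniteIntegral_iff_ofReal (Eventually.of_forall hρ0)]
  have := measure_lt_top (densityMeasure ρ) univ
  rwa [densityMeasure, withDensity_apply _ MeasurableSet.univ, Measure.restrict_univ] at this

/-- The initial density `p (θ, ω, x) g (ω)` defines a probability measure. -/
lemma isProbabilityMeasure_initial {g : ℝ → ℝ} (hg : IsFrequencyDensity g) {p : PhaseSpace → ℝ}
    (hp : IsInitialConditionalDensity p) :
    IsProbabilityMeasure (densityMeasure fun P => p P * g P.2.1) := by
  constructor
  have hc : Continuous fun P : PhaseSpace => p P * g P.2.1 :=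
    hp.continuous.mul (hg.continuous.comp (by fun_prop))
  rw [densityMeasure, withDensity_apply _ MeasurableSet.univ, Measure.restrict_univ,
    Measure.volume_eq_prod, lintegral_prod_symm _ hc.measurable.ennreal_ofReal.aemeasurable]
  have h1 : ∀ y : ℝ × unitInterval, ∫⁻ θ : Circ, ENNReal.ofReal (p (θ, y) * g y.1)
      = ENNReal.ofReal (g y.1) := by
    intro y
    have hcy : Continuous fun θ : Circ => p (θ, y) * g y.1 :=
      hc.comp (f := fun θ : Circ => ((θ, y) : PhaseSpace)) (by fun_prop)
    rw [← ofReal_integral_eq_lintegral_ofReal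
      (hcy.integrable_of_hasCompactSupport (HasCompactSupport.of_compactSpace _))
      (Eventually.of_forall fun θ => mul_nonneg (hp.nonneg _) (hg.nonneg _)),
      integral_mul_const, hp.integral_eq_one, one_mul]
  simp only [h1]
  have hm : Measurable fun y : ℝ × unitInterval => ENNReal.ofReal (g y.1) :=
    (hg.continuous.comp continuous_fst).measurable.ennreal_ofReal
  rw [Measure.volume_eq_prod, lintegral_prod _ hm.aemeasurable]
  simp only [lintegral_const, measure_univ, mul_one]
  rw [← ofReal_integral_eq_lintegral_ofReal hg.integrable (Eventually.of_forall hg.nonneg),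
    hg.integral_eq_one, ENNReal.ofReal_one]

/-! ### Observables and the bounded Lipschitz distance -/

/-- The cosine of a point of the circle. -/
def circCos (θ : Circ) : ℝ := Real.cos_periodic.lift θ

@[simp] lemma circSin_coe (θ : ℝ) : circSin (θ : Circ) = sin θ := Real.sin_periodic.lift_coe θ
@[simp] lemma circCos_coe (θ : ℝ) : circCos (θ : Circ) = cos θ := Real.cos_periodic.lift_coe θ

lemma abs_circSin_le_one (θ : Circ) : |circSin θ| ≤ 1 := by
  rw [← coe_circRep θ, circSin_coe]; exact abs_sin_le_one _

lemma abs_circCos_le_one (θ : Circ) : |circCos θ| ≤ 1 := by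
  rw [← coe_circRep θ, circCos_coe]; exact abs_cos_le_one _

lemma abs_circSin_sub_le (θ θ' : Circ) : |circSin θ - circSin θ'| ≤ dist θ θ' := by
  obtain ⟨b, hb, h⟩ := exists_lift_dist_eq θ θ' (circRep θ) (coe_circRep θ)
  rw [← h, ← coe_circRep θ, ← hb, circSin_coe, circSin_coe, coe_circRep]
  exact abs_sin_sub_sin_le _ _

lemma abs_circCos_sub_le (θ θ' : Circ) : |circCos θ - circCos θ'| ≤ dist θ θ' := by
  obtain ⟨b, hb, h⟩ := exists_lift_dist_eq θ θ' (circRep θ) (coe_circRep θ)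
  rw [← h, ← coe_circRep θ, ← hb, circCos_coe, circCos_coe, coe_circRep]
  exact abs_cos_sub_cos_le _ _

lemma circSin_sub (θ θ' : Circ) :
    circSin (θ - θ') = circSin θ * circCos θ' - circCos θ * circSin θ' := by
  rw [← coe_circRep θ, ← coe_circRep θ', ← AddCircle.coe_sub]
  simp only [circSin_coe, circCos_coe, sin_sub]

/-- `W` is bounded by `A` and Lipschitz with the constant `A`. -/
structure IsGraphonBound (A : ℝ) (W : unitInterval → unitInterval → ℝ) : Prop where
  abs_le : ∀ x y, |W x y| ≤ A
  lipschitz : ∀ x y x' y', |W x y - W x' y'| ≤ A * (|(x : ℝ) - x'| + |(y : ℝ) - y'|)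

lemma IsLipschitzGraphon.exists_isGraphonBound {W : unitInterval → unitInterval → ℝ}
    (hW : IsLipschitzGraphon W) : ∃ A, IsGraphonBound A W := by
  obtain ⟨L, hL⟩ := hW
  have h1 : ∀ x y x' y', |W x y - W x' y'| ≤ |L| * (|(x : ℝ) - x'| + |(y : ℝ) - y'|) := by
    intro x y x' y'
    refine (hL x y x' y').trans ((mul_le_mul_of_nonneg_right (le_abs_self L) (sqrt_nonneg _)).trans
      (mul_le_mul_of_nonneg_left ?_ (abs_nonneg L)))
    rw [sqrt_le_left (by positivity), ← sq_abs ((x : ℝ) - x'), ← sq_abs ((y : ℝ) - y')]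
    nlinarith [abs_nonneg ((x : ℝ) - x'), abs_nonneg ((y : ℝ) - y')]
  have hd : ∀ x : unitInterval, |(x : ℝ) - (0 : unitInterval)| ≤ 1 := fun x => by
    rw [Set.Icc.coe_zero, sub_zero, abs_of_nonneg x.2.1]; exact x.2.2
  have h2 : ∀ x y, |W x y| ≤ |W 0 0| + |L| * 2 := fun x y => by
    have h3 : |W x y| ≤ |W 0 0| + |W x y - W 0 0| := by
      have := abs_add_le (W 0 0) (W x y - W 0 0)
      rwa [add_sub_cancel] at this
    refine h3.trans (add_le_add le_rfl ((h1 x y 0 0).trans ?_))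
    gcongr
    linarith [hd x, hd y]
  refine ⟨|W 0 0| + |L| * 2, h2, fun x y x' y' => (h1 x y x' y').trans ?_⟩
  gcongr
  linarith [abs_nonneg (W 0 0), abs_nonneg L]

/-- Observables that are bounded by `a`, and Lipschitz with the constant `a` in each variable. -/
structure IsObservable (a : ℝ) (f : PhaseSpace → ℝ) : Prop where
  abs_le : ∀ P, |f P| ≤ a
  lipschitz : ∀ P Q : PhaseSpace, |f P - f Q| ≤
    a * (dist P.1 Q.1 + |P.2.1 - Q.2.1| + |(P.2.2 : ℝ) - Q.2.2|)

lemma IsObservable.nonneg {a : ℝ} {f : PhaseSpace → ℝ} (hf : IsObservable a f) : 0 ≤ a :=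
  (abs_nonneg _).trans (hf.abs_le (0, 0, 0))

lemma IsObservable.continuous {a : ℝ} {f : PhaseSpace → ℝ} (hf : IsObservable a f) :
    Continuous f := by
  refine LipschitzWith.continuous (K := (3 * a).toNNReal) (LipschitzWith.of_dist_le_mul ?_)
  intro P Q
  have ha := hf.nonneg
  rw [Real.dist_eq, Real.coe_toNNReal _ (by positivity)]
  refine (hf.lipschitz P Q).trans ?_
  have h1 : dist P.1 Q.1 ≤ dist P Q := le_max_left _ _
  have h2 : |P.2.1 - Q.2.1| ≤ dist P Q := (le_max_left _ _).trans (le_max_right _ _)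
  have h3 : |(P.2.2 : ℝ) - Q.2.2| ≤ dist P Q := (le_max_right _ _).trans (le_max_right _ _)
  nlinarith

lemma integrable_of_continuous_of_abs_le {X : Type*} [TopologicalSpace X] [MeasurableSpace X]
    [OpensMeasurableSpace X] {μ : Measure X} [IsFiniteMeasure μ] {f : X → ℝ} (hf : Continuous f)
    {a : ℝ} (ha : ∀ P, |f P| ≤ a) : Integrable f μ :=
  Integrable.of_bound hf.aestronglyMeasurable a (Eventually.of_forall ha)

lemma IsObservable.integrable {a : ℝ} {f : PhaseSpace → ℝ} (hf : IsObservable a f)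
    (μ : Measure PhaseSpace) [IsFiniteMeasure μ] : Integrable f μ :=
  integrable_of_continuous_of_abs_le hf.continuous hf.abs_le

lemma dist_fst_le_dG (P Q : PhaseSpace) : dist P.1 Q.1 ≤ dG P Q :=
  le_sqrt_of_sq_le (by nlinarith [sq_nonneg (P.2.1 - Q.2.1), sq_nonneg ((P.2.2 : ℝ) - Q.2.2)])

lemma abs_frequency_sub_le_dG (P Q : PhaseSpace) : |P.2.1 - Q.2.1| ≤ dG P Q :=
  le_sqrt_of_sq_le (by
    rw [sq_abs]; nlinarith [sq_nonneg (dist P.1 Q.1), sq_nonneg ((P.2.2 : ℝ) - Q.2.2)])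

lemma abs_site_sub_le_dG (P Q : PhaseSpace) : |(P.2.2 : ℝ) - Q.2.2| ≤ dG P Q :=
  le_sqrt_of_sq_le (by
    rw [sq_abs]; nlinarith [sq_nonneg (dist P.1 Q.1), sq_nonneg (P.2.1 - Q.2.1)])

lemma dG_le (P Q : PhaseSpace) :
    dG P Q ≤ dist P.1 Q.1 + |P.2.1 - Q.2.1| + |(P.2.2 : ℝ) - Q.2.2| := by
  have h1 := dist_nonneg (x := P.1) (y := Q.1)
  have h2 := abs_nonneg (P.2.1 - Q.2.1)
  have h3 := abs_nonneg ((P.2.2 : ℝ) - Q.2.2)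
  rw [dG, sqrt_le_left (by positivity), ← sq_abs (P.2.1 - Q.2.1), ← sq_abs ((P.2.2 : ℝ) - Q.2.2)]
  nlinarith [mul_nonneg h1 h2, mul_nonneg h1 h3, mul_nonneg h2 h3]

lemma isObservable_of_mem_lipClass {f : PhaseSpace → ℝ} (hf : f ∈ lipClass) : IsObservable 1 f :=
  ⟨fun P => abs_le.2 ⟨by linarith [(hf.1 P).1], (hf.1 P).2⟩, fun P Q => by
    rw [one_mul]; exact (hf.2 P Q).trans (dG_le P Q)⟩

lemma abs_integral_le_of_abs_le {X : Type*} [MeasurableSpace X] {μ : Measure X}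
    [IsProbabilityMeasure μ] {f : X → ℝ} {a : ℝ} (ha : ∀ P, |f P| ≤ a) : |∫ P, f P ∂μ| ≤ a := by
  have := norm_integral_le_of_norm_le_const (μ := μ) (f := f) (C := a) (Eventually.of_forall ha)
  simpa using this

/-- The supremum of an unbounded set of reals is `0` by convention, so a bound is needed before
`dBL` can dominate any individual difference of integrals. -/
lemma bddAbove_dBL (μ ν : Measure PhaseSpace) [IsProbabilityMeasure μ] [IsProbabilityMeasure ν] :
    BddAbove {r : ℝ | ∃ f ∈ lipClass, r = |(∫ P, f P ∂μ) - ∫ P, f P ∂ν|} := by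
  refine ⟨2, ?_⟩
  rintro r ⟨f, hf, rfl⟩
  have hb := (isObservable_of_mem_lipClass hf).abs_le
  calc _ ≤ |∫ P, f P ∂μ| + |∫ P, f P ∂ν| := abs_sub _ _
    _ ≤ 1 + 1 := add_le_add (abs_integral_le_of_abs_le hb) (abs_integral_le_of_abs_le hb)
    _ = 2 := by norm_num

lemma abs_integral_sub_le_dBL {μ ν : Measure PhaseSpace} [IsProbabilityMeasure μ]
    [IsProbabilityMeasure ν] {f : PhaseSpace → ℝ} (hf : f ∈ lipClass) :
    |(∫ P, f P ∂μ) - ∫ P, f P ∂ν| ≤ dBL μ ν :=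
  le_csSup (bddAbove_dBL μ ν) ⟨f, hf, rfl⟩

lemma dBL_nonneg (μ ν : Measure PhaseSpace) : 0 ≤ dBL μ ν := by
  refine Real.sSup_nonneg ?_
  rintro r ⟨f, -, rfl⟩
  exact abs_nonneg _

lemma dBL_le {μ ν : Measure PhaseSpace} {C : ℝ} (hC : 0 ≤ C)
    (h : ∀ f ∈ lipClass, |(∫ P, f P ∂μ) - ∫ P, f P ∂ν| ≤ C) : dBL μ ν ≤ C := by
  refine Real.sSup_le ?_ hC
  rintro r ⟨f, hf, rfl⟩
  exact h f hf

lemma dBL_self (μ : Measure PhaseSpace) : dBL μ μ = 0 :=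
  le_antisymm (dBL_le le_rfl fun f _ => by simp) (dBL_nonneg _ _)

lemma IsObservable.abs_integral_sub_le {μ ν : Measure PhaseSpace} [IsProbabilityMeasure μ]
    [IsProbabilityMeasure ν] {f : PhaseSpace → ℝ} {a : ℝ} (hf : IsObservable a f) :
    |(∫ P, f P ∂μ) - ∫ P, f P ∂ν| ≤ 3 * a * dBL μ ν := by
  rcases hf.nonneg.eq_or_lt with ha | ha
  · have hz : ∀ P, f P = 0 := fun P => abs_nonpos_iff.1 (ha ▸ hf.abs_le P)
    simp [hz, ← ha]
  have ha3 : 0 < 3 * a := by positivity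
  -- The shift by `a` makes the function nonnegative. The factor `3` appears because the three
  -- coordinate distances are each at most `dG`; it also keeps the values below one.
  have hmem : (fun P => (f P + a) / (3 * a)) ∈ lipClass := by
    refine ⟨fun P => ?_, fun P Q => ?_⟩
    · obtain ⟨h1, h2⟩ := _root_.abs_le.1 (hf.abs_le P)
      exact ⟨div_nonneg (by linarith) ha3.le, (div_le_one ha3).2 (by linarith)⟩
    · rw [← sub_div, add_sub_add_right_eq_sub, abs_div, abs_of_pos ha3, div_le_iff₀ ha3]
      refine (hf.lipschitz P Q).trans ?_
      nlinarith [dist_fst_le_dG P Q, abs_frequency_sub_le_dG P Q, abs_site_sub_le_dG P Q]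
  have h := abs_integral_sub_le_dBL (μ := μ) (ν := ν) hmem
  have e : ∀ (μ : Measure PhaseSpace) [IsProbabilityMeasure μ],
      ∫ P, (f P + a) / (3 * a) ∂μ = (∫ P, f P ∂μ + a) / (3 * a) := by
    intro μ _
    rw [integral_div, integral_add (hf.integrable μ) (integrable_const a)]
    simp
  rw [e, e, ← sub_div, add_sub_add_right_eq_sub, abs_div, abs_of_pos ha3, div_le_iff₀ ha3] at h
  exact h.trans_eq (mul_comm _ _)

/-! ### Dobrushin estimates for transported measures -/

lemma dist_flowMap_le {B : ℝ} {Z : ℝ → unitInterval → ℝ × ℝ} (hZ : IsMeanField B Z) (s t : ℝ)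
    (P Q : PhaseSpace) : dist (flowMap Z s t P).1 (flowMap Z s t Q).1 ≤
      (dist P.1 Q.1 + (|P.2.1 - Q.2.1| + 2 * (B * |(P.2.2 : ℝ) - Q.2.2|)))
        * exp ((2 * B + 1) * |t - s|) := by
  obtain ⟨θ, ω, x⟩ := P
  obtain ⟨θ', ω', x'⟩ := Q
  obtain ⟨b, hb, h⟩ := exists_lift_dist_eq θ θ' (circRep θ) (coe_circRep θ)
  have := abs_phaseFlow_sub_le hZ s t (circRep θ) b ω ω' x x'
  rw [h] at this
  refine le_trans ?_ this
  rw [← hb, flowMap_coe hZ]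
  exact dist_coe_le _ _

/-- The Lipschitz constant of the flow up to the time `T`, in a mean field of size `B`. -/
def flowConst (B T : ℝ) : ℝ := (2 * B + 1) * exp ((2 * B + 1) * T) + 1

lemma one_le_flowConst {B T : ℝ} (hB : 0 ≤ B) : 1 ≤ flowConst B T := by
  have : 0 ≤ (2 * B + 1) * exp ((2 * B + 1) * T) := by positivity
  unfold flowConst; linarith

lemma IsObservable.comp_flowMap {B T a : ℝ} {Z : ℝ → unitInterval → ℝ × ℝ} (hZ : IsMeanField B Z)
    {f : PhaseSpace → ℝ} (hf : IsObservable a f) {t : ℝ} (ht : t ∈ Icc 0 T) :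
    IsObservable (a * flowConst B T) fun P => f (flowMap Z 0 t P) := by
  have ha := hf.nonneg
  have hB := hZ.nonneg
  refine ⟨fun P => (hf.abs_le _).trans (le_mul_of_one_le_right ha (one_le_flowConst hB)),
    fun P Q => (hf.lipschitz _ _).trans ?_⟩
  rw [mul_assoc]
  refine mul_le_mul_of_nonneg_left ?_ ha
  have h := dist_flowMap_le hZ 0 t P Q
  rw [sub_zero, abs_of_nonneg ht.1] at h
  have h1 := dist_nonneg (x := P.1) (y := Q.1)
  have h2 := abs_nonneg (P.2.1 - Q.2.1)
  have h3 := abs_nonneg ((P.2.2 : ℝ) - Q.2.2)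
  have he : exp ((2 * B + 1) * t) ≤ exp ((2 * B + 1) * T) := by
    have := ht.2
    gcongr
  have h4 : (dist P.1 Q.1 + (|P.2.1 - Q.2.1| + 2 * (B * |(P.2.2 : ℝ) - Q.2.2|)))
      * exp ((2 * B + 1) * t) ≤
      ((2 * B + 1) * (dist P.1 Q.1 + |P.2.1 - Q.2.1| + |(P.2.2 : ℝ) - Q.2.2|))
      * exp ((2 * B + 1) * T) := by
    refine mul_le_mul ?_ he (exp_pos _).le (by positivity)
    nlinarith [mul_nonneg hB h1, mul_nonneg hB h2]
  -- The summand `1` of the constant accounts for frequency and site, which the flow does not move.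
  simp only [flowMap_snd, flowConst]
  nlinarith

/-- Both curves start from the same lift with the same frequency and site, so only the discrepancy
of the fields separates them. Its influence on the speed is at most twice its norm, hence `2 * m`.
-/
lemma dist_flowMap_flowMap_le {B T lam m : ℝ} {Z Z' : ℝ → unitInterval → ℝ × ℝ}
    (hZ : IsMeanField B Z) {B' : ℝ} (hZ' : IsMeanField B' Z') (hm : 0 ≤ m) (hl : 2 * B < lam)
    (h : ∀ t ∈ Icc 0 T, ∀ x, ‖Z t x - Z' t x‖ ≤ m * exp (lam * t)) {t : ℝ} (ht : t ∈ Icc 0 T)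
    (P : PhaseSpace) : dist (flowMap Z 0 t P).1 (flowMap Z' 0 t P).1
      ≤ 2 * m / (lam - 2 * B) * exp (lam * t) := by
  obtain ⟨θ, ω, x⟩ := P
  refine (dist_coe_le _ _).trans ?_
  have := abs_sub_le_of_hasDerivWithinAt (T := T) (lam := lam) (m := 2 * m) (B := B)
    (fun t _ => hZ.norm_le t x)
    (fun t _ => (isPhaseCurve_phaseFlow hZ 0 (circRep θ) ω x t).hasDerivWithinAt)
    (fun t _ => (isPhaseCurve_phaseFlow hZ' 0 (circRep θ) ω x t).hasDerivWithinAt)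
    (by positivity) (fun t ht => ?_) hl t ht
  · simpa [phaseFlow_self hZ, phaseFlow_self hZ'] using this
  · rw [sub_self, abs_zero, zero_add]
    linarith [h t ht x]

/-- Dobrushin's estimate for observables of measures transported by two mean fields. -/
lemma IsObservable.abs_integral_map_sub_le {B T lam m a : ℝ} {Z Z' : ℝ → unitInterval → ℝ × ℝ}
    (hZ : IsMeanField B Z) {B' : ℝ} (hZ' : IsMeanField B' Z') (hm : 0 ≤ m) (hl : 2 * B < lam)
    (h : ∀ t ∈ Icc 0 T, ∀ x, ‖Z t x - Z' t x‖ ≤ m * exp (lam * t)) {t : ℝ} (ht : t ∈ Icc 0 T)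
    {μ ν : Measure PhaseSpace} [IsProbabilityMeasure μ] [IsProbabilityMeasure ν]
    {f : PhaseSpace → ℝ} (hf : IsObservable a f) :
    |(∫ P, f P ∂(μ.map (flowMap Z 0 t))) - ∫ P, f P ∂(ν.map (flowMap Z' 0 t))| ≤
      3 * (a * flowConst B T) * dBL μ ν + a * (2 * m / (lam - 2 * B) * exp (lam * t)) := by
  have hΦ := continuous_flowMap_apply hZ 0 t
  have hΦ' := continuous_flowMap_apply hZ' 0 t
  rw [integral_map hΦ.aemeasurable hf.continuous.aestronglyMeasurable,
    integral_map hΦ'.aemeasurable hf.continuous.aestronglyMeasurable]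
  -- The intermediate term keeps the flow of `Z` but integrates against `ν`. The first difference
  -- changes the measure under a fixed flow, the second changes the flow under a fixed measure.
  refine (abs_sub_le _ (∫ P, f (flowMap Z 0 t P) ∂ν) _).trans (add_le_add
    (hf.comp_flowMap hZ ht).abs_integral_sub_le ?_)
  have hi : Integrable (fun P => f (flowMap Z 0 t P)) ν :=
    integrable_of_continuous_of_abs_le (hf.continuous.comp hΦ) fun P => hf.abs_le _
  have hi' : Integrable (fun P => f (flowMap Z' 0 t P)) ν :=
    integrable_of_continuous_of_abs_le (hf.continuous.comp hΦ') fun P => hf.abs_le _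
  rw [← integral_sub hi hi']
  refine abs_integral_le_of_abs_le fun P => (hf.lipschitz _ _).trans ?_
  simp only [flowMap_snd, sub_self, abs_zero, add_zero]
  exact mul_le_mul_of_nonneg_left (dist_flowMap_flowMap_le hZ hZ' hm hl h ht P) hf.nonneg

/-! ### The self-consistent mean field: stability and existence -/

/-- The mean field of the measure `μ` at the site `x`. -/
def meanField (W : unitInterval → unitInterval → ℝ) (K : ℝ) (μ : Measure PhaseSpace)
    (x : unitInterval) : ℝ × ℝ :=
  (K * ∫ Q, W x Q.2.2 * circCos Q.1 ∂μ, K * ∫ Q, W x Q.2.2 * circSin Q.1 ∂μ)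

lemma abs_mul_sub_mul_le {a b c d A u v : ℝ} (hb : |b| ≤ 1) (hc : |c| ≤ A) (h1 : |a - c| ≤ A * u)
    (h2 : |b - d| ≤ v) : |a * b - c * d| ≤ A * (v + u) := by
  have e : a * b - c * d = (a - c) * b + c * (b - d) := by ring
  rw [e]
  refine (abs_add_le _ _).trans ?_
  rw [abs_mul, abs_mul]
  have h0 : 0 ≤ A := (abs_nonneg _).trans hc
  have h3 : |a - c| * |b| ≤ A * u * 1 :=
    mul_le_mul h1 hb (abs_nonneg _) ((abs_nonneg _).trans h1)
  have h4 : |c| * |b - d| ≤ A * v := mul_le_mul hc h2 (abs_nonneg _) h0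
  linarith

/-- The mean field consists of integrals of such functions, up to the factor `K`; this makes the
estimates for observables applicable to it. -/
lemma isObservable_mul {W : unitInterval → unitInterval → ℝ} {A : ℝ} (hW : IsGraphonBound A W)
    {c : Circ → ℝ} (hc1 : ∀ θ, |c θ| ≤ 1) (hc2 : ∀ θ θ', |c θ - c θ'| ≤ dist θ θ')
    (x : unitInterval) : IsObservable A fun Q : PhaseSpace => W x Q.2.2 * c Q.1 := by
  have hA : 0 ≤ A := (abs_nonneg _).trans (hW.abs_le 0 0)
  refine ⟨fun Q => ?_, fun P Q => ?_⟩
  · rw [abs_mul]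
    exact (mul_le_mul (hW.abs_le _ _) (hc1 _) (abs_nonneg _) hA).trans (mul_one A).le
  · have h := hW.lipschitz x P.2.2 x Q.2.2
    rw [sub_self, abs_zero, zero_add] at h
    refine (abs_mul_sub_mul_le (hc1 _) (hW.abs_le _ _) h (hc2 _ _)).trans ?_
    gcongr
    linarith [abs_nonneg (P.2.1 - Q.2.1)]

lemma isObservable_cos {W : unitInterval → unitInterval → ℝ} {A : ℝ} (hW : IsGraphonBound A W)
    (x : unitInterval) : IsObservable A fun Q : PhaseSpace => W x Q.2.2 * circCos Q.1 :=
  isObservable_mul hW abs_circCos_le_one abs_circCos_sub_le x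

lemma isObservable_sin {W : unitInterval → unitInterval → ℝ} {A : ℝ} (hW : IsGraphonBound A W)
    (x : unitInterval) : IsObservable A fun Q : PhaseSpace => W x Q.2.2 * circSin Q.1 :=
  isObservable_mul hW abs_circSin_le_one abs_circSin_sub_le x

lemma norm_meanField_le {W : unitInterval → unitInterval → ℝ} {A : ℝ} (hW : IsGraphonBound A W)
    (K : ℝ) (μ : Measure PhaseSpace) [IsProbabilityMeasure μ] (x : unitInterval) :
    ‖meanField W K μ x‖ ≤ |K| * A := by
  refine norm_prod_le_iff.2 ⟨?_, ?_⟩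
  · rw [meanField, norm_eq_abs, abs_mul]
    exact mul_le_mul_of_nonneg_left (abs_integral_le_of_abs_le (isObservable_cos hW x).abs_le)
      (abs_nonneg K)
  · rw [meanField, norm_eq_abs, abs_mul]
    exact mul_le_mul_of_nonneg_left (abs_integral_le_of_abs_le (isObservable_sin hW x).abs_le)
      (abs_nonneg K)

lemma norm_meanField_sub_le {W : unitInterval → unitInterval → ℝ} {A : ℝ}
    (hW : IsGraphonBound A W) (K : ℝ) (μ : Measure PhaseSpace) [IsProbabilityMeasure μ]
    (x y : unitInterval) :
    ‖meanField W K μ x - meanField W K μ y‖ ≤ |K| * A * |(x : ℝ) - y| := by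
  have key : ∀ c : Circ → ℝ, (∀ θ, |c θ| ≤ 1) → (∀ x, IsObservable A fun Q : PhaseSpace =>
      W x Q.2.2 * c Q.1) → |K * (∫ Q, W x Q.2.2 * c Q.1 ∂μ) - K * ∫ Q, W y Q.2.2 * c Q.1 ∂μ| ≤
      |K| * A * |(x : ℝ) - y| := by
    intro c hc ho
    rw [← mul_sub, ← integral_sub ((ho x).integrable μ) ((ho y).integrable μ), abs_mul, mul_assoc]
    refine mul_le_mul_of_nonneg_left (abs_integral_le_of_abs_le fun Q => ?_) (abs_nonneg K)
    rw [← sub_mul, abs_mul]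
    have h := hW.lipschitz x Q.2.2 y Q.2.2
    rw [sub_self, abs_zero, add_zero] at h
    exact (mul_le_mul h (hc _) (abs_nonneg _) ((abs_nonneg _).trans h)).trans (mul_one _).le
  exact norm_prod_le_iff.2 ⟨key circCos abs_circCos_le_one (isObservable_cos hW),
    key circSin abs_circSin_le_one (isObservable_sin hW)⟩

lemma continuous_integral_map_flowMap {B : ℝ} {Z : ℝ → unitInterval → ℝ × ℝ}
    (hZ : IsMeanField B Z) (μ : Measure PhaseSpace) [IsFiniteMeasure μ] {f : PhaseSpace → ℝ}
    (hf : Continuous f) {a : ℝ} (ha : ∀ P, |f P| ≤ a) :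
    Continuous fun t => ∫ P, f P ∂(μ.map (flowMap Z 0 t)) := by
  have e : ∀ t, ∫ P, f P ∂(μ.map (flowMap Z 0 t)) = ∫ P, f (flowMap Z 0 t P) ∂μ := fun t =>
    integral_map (continuous_flowMap_apply hZ 0 t).aemeasurable hf.aestronglyMeasurable
  simp only [e]
  refine continuous_of_dominated (bound := fun _ => a)
    (fun t => (hf.comp (continuous_flowMap_apply hZ 0 t)).aestronglyMeasurable)
    (fun t => Eventually.of_forall fun P => ha _) (integrable_const a)
    (Eventually.of_forall fun P => hf.comp ((continuous_flowMap hZ).comp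
      (f := fun t : ℝ => ((0, t), P)) (by fun_prop)))

lemma isProbabilityMeasure_map_flowMap {B : ℝ} {Z : ℝ → unitInterval → ℝ × ℝ}
    (hZ : IsMeanField B Z) (μ : Measure PhaseSpace) [IsProbabilityMeasure μ] (s t : ℝ) :
    IsProbabilityMeasure (μ.map (flowMap Z s t)) :=
  Measure.isProbabilityMeasure_map (continuous_flowMap_apply hZ s t).aemeasurable

lemma continuous_meanField_map {W : unitInterval → unitInterval → ℝ} {A : ℝ}
    (hW : IsGraphonBound A W) (K : ℝ) {B : ℝ} {Z : ℝ → unitInterval → ℝ × ℝ}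
    (hZ : IsMeanField B Z) (μ : Measure PhaseSpace) [IsProbabilityMeasure μ] (x : unitInterval) :
    Continuous fun t => meanField W K (μ.map (flowMap Z 0 t)) x :=
  (continuous_const.mul (continuous_integral_map_flowMap hZ μ (isObservable_cos hW x).continuous
    (isObservable_cos hW x).abs_le)).prodMk
  (continuous_const.mul (continuous_integral_map_flowMap hZ μ (isObservable_sin hW x).continuous
    (isObservable_sin hW x).abs_le))

lemma norm_meanField_map_sub_le {W : unitInterval → unitInterval → ℝ} {A : ℝ}
    (hW : IsGraphonBound A W) (K : ℝ) {B T lam m : ℝ} {Z Z' : ℝ → unitInterval → ℝ × ℝ}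
    (hZ : IsMeanField B Z) {B' : ℝ} (hZ' : IsMeanField B' Z') (hm : 0 ≤ m) (hl : 2 * B < lam)
    (h : ∀ t ∈ Icc 0 T, ∀ x, ‖Z t x - Z' t x‖ ≤ m * exp (lam * t)) {t : ℝ} (ht : t ∈ Icc 0 T)
    (μ ν : Measure PhaseSpace) [IsProbabilityMeasure μ] [IsProbabilityMeasure ν]
    (x : unitInterval) :
    ‖meanField W K (μ.map (flowMap Z 0 t)) x - meanField W K (ν.map (flowMap Z' 0 t)) x‖ ≤
      |K| * (3 * (A * flowConst B T) * dBL μ ν + A * (2 * m / (lam - 2 * B) * exp (lam * t))) := by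
  refine norm_prod_le_iff.2 ⟨?_, ?_⟩
  · simp only [meanField, Prod.fst_sub]
    rw [← mul_sub, norm_eq_abs, abs_mul]
    exact mul_le_mul_of_nonneg_left
      ((isObservable_cos hW x).abs_integral_map_sub_le hZ hZ' hm hl h ht) (abs_nonneg K)
  · simp only [meanField, Prod.snd_sub]
    rw [← mul_sub, norm_eq_abs, abs_mul]
    exact mul_le_mul_of_nonneg_left
      ((isObservable_sin hW x).abs_integral_map_sub_le hZ hZ' hm hl h ht) (abs_nonneg K)

/-- The mean field `Z` is generated, on the time interval `[0, T]`, by the image of the measure `μ`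
under the flow of `Z` itself. -/
def IsSelfConsistent (W : unitInterval → unitInterval → ℝ) (K T : ℝ) (μ : Measure PhaseSpace)
    (Z : ℝ → unitInterval → ℝ × ℝ) : Prop :=
  ∀ t ∈ Icc 0 T, ∀ x, Z t x = meanField W K (μ.map (flowMap Z 0 t)) x

/-- The exponential rate in which the mean field operator is a contraction. -/
def fieldRate (B : ℝ) : ℝ := 6 * B + 1

/-- At the rate `fieldRate B = 6 * B + 1` the denominator `lam - 2 * B` is `4 * B + 1`, and `B * (2
* m / (4 * B + 1)) ≤ m / 2`. So the field operator halves distances in the weighted norm, whatever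
the length of the time interval; the distance of the initial measures enters additively. -/
lemma norm_meanField_map_sub_le_half {W : unitInterval → unitInterval → ℝ} {A : ℝ}
    (hW : IsGraphonBound A W) {K T m : ℝ} {Z Z' : ℝ → unitInterval → ℝ × ℝ}
    (hZ : IsMeanField (|K| * A) Z) {B' : ℝ} (hZ' : IsMeanField B' Z') (hm : 0 ≤ m)
    (h : ∀ t ∈ Icc 0 T, ∀ x, ‖Z t x - Z' t x‖ ≤ m * exp (fieldRate (|K| * A) * t))
    (μ ν : Measure PhaseSpace) [IsProbabilityMeasure μ] [IsProbabilityMeasure ν] :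
    ∀ t ∈ Icc 0 T, ∀ x,
    ‖meanField W K (μ.map (flowMap Z 0 t)) x - meanField W K (ν.map (flowMap Z' 0 t)) x‖ ≤
      (3 * (|K| * A) * flowConst (|K| * A) T * dBL μ ν + m / 2)
        * exp (fieldRate (|K| * A) * t) := by
  intro t ht x
  set B := |K| * A with hB
  have hB0 : 0 ≤ B := hZ.nonneg
  refine (norm_meanField_map_sub_le hW K hZ hZ' hm (by unfold fieldRate; linarith) h ht
    μ ν x).trans ?_
  set E := exp (fieldRate B * t) with hE
  have hE1 : 1 ≤ E := one_le_exp (mul_nonneg (by unfold fieldRate; linarith) ht.1)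
  have h1 : |K| * (3 * (A * flowConst B T) * dBL μ ν + A * (2 * m / (fieldRate B - 2 * B) * E))
      = 3 * B * flowConst B T * dBL μ ν + B * (2 * m / (4 * B + 1)) * E := by
    rw [hB, fieldRate]; ring_nf
  have h2 : B * (2 * m / (4 * B + 1)) ≤ m / 2 := by
    rw [← mul_div_assoc, div_le_iff₀ (by linarith)]
    nlinarith
  have h3 : 0 ≤ 3 * B * flowConst B T * dBL μ ν := by
    have := one_le_flowConst (T := T) hB0
    have := dBL_nonneg μ ν
    positivity
  rw [h1, add_mul]
  exact add_le_add (le_mul_of_one_le_right h3 hE1) (mul_le_mul_of_nonneg_right h2 (exp_pos _).le)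

/-- The mean field depends on the initial measure in a Lipschitz way. -/
lemma IsSelfConsistent.norm_sub_le {W : unitInterval → unitInterval → ℝ} {A : ℝ}
    (hW : IsGraphonBound A W) {K T : ℝ} {Z Z' : ℝ → unitInterval → ℝ × ℝ}
    {μ ν : Measure PhaseSpace} [IsProbabilityMeasure μ] [IsProbabilityMeasure ν]
    (hZ : IsMeanField (|K| * A) Z) {B' : ℝ} (hZ' : IsMeanField B' Z')
    (h : IsSelfConsistent W K T μ Z) (h' : IsSelfConsistent W K T ν Z') :
    ∀ t ∈ Icc 0 T, ∀ x, ‖Z t x - Z' t x‖ ≤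
      6 * (|K| * A) * flowConst (|K| * A) T * dBL μ ν * exp (fieldRate (|K| * A) * t) := by
  set B := |K| * A with hB
  have hB0 : 0 ≤ B := hZ.nonneg
  set D := 6 * B * flowConst B T * dBL μ ν with hD
  have hD0 : 0 ≤ D := by
    have := one_le_flowConst (T := T) hB0
    have := dBL_nonneg μ ν
    positivity
  have hc0 : 0 ≤ B + B' := add_nonneg hB0 hZ'.nonneg
  -- The a priori bound `B + B'` starts the induction. Each use of self-consistency halves the
  -- current bound and adds `D / 2`, so `D` is reproduced and the remainder is halved.
  have key : ∀ n : ℕ, ∀ t ∈ Icc 0 T, ∀ x,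
      ‖Z t x - Z' t x‖ ≤ (D + (B + B') / 2 ^ n) * exp (fieldRate B * t) := by
    intro n
    induction n with
    | zero =>
      intro t ht x
      have h1 : ‖Z t x - Z' t x‖ ≤ B + B' :=
        (_root_.norm_sub_le _ _).trans (add_le_add (hZ.norm_le t x) (hZ'.norm_le t x))
      have hE1 : 1 ≤ exp (fieldRate B * t) :=
        one_le_exp (mul_nonneg (by unfold fieldRate; linarith) ht.1)
      rw [pow_zero, div_one]
      nlinarith
    | succ n ih =>
      intro t ht x
      rw [h t ht x, h' t ht x]
      refine (norm_meanField_map_sub_le_half hW hZ hZ' (by positivity) ih μ ν t ht x).trans_eq ?_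
      rw [hD, pow_succ]
      ring
  intro t ht x
  have hlim : Tendsto (fun n : ℕ => (D + (B + B') / 2 ^ n) * exp (fieldRate B * t)) atTop
      (𝓝 ((D + 0) * exp (fieldRate B * t))) := by
    refine (tendsto_const_nhds.add ?_).mul_const _
    exact tendsto_const_nhds.div_atTop (tendsto_pow_atTop_atTop_of_one_lt one_lt_two)
  rw [add_zero] at hlim
  exact ge_of_tendsto' hlim fun n => key n t ht x

/-- The second field may have any constant `B'`. This matters because the field of an arbitrary weak
solution is controlled at first only by the norms of that solution, not by `|K| * A`. -/
lemma IsSelfConsistent.eq {W : unitInterval → unitInterval → ℝ} {A : ℝ}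
    (hW : IsGraphonBound A W) {K T : ℝ} {Z Z' : ℝ → unitInterval → ℝ × ℝ}
    {μ : Measure PhaseSpace} [IsProbabilityMeasure μ]
    (hZ : IsMeanField (|K| * A) Z) {B' : ℝ} (hZ' : IsMeanField B' Z')
    (h : IsSelfConsistent W K T μ Z) (h' : IsSelfConsistent W K T μ Z') :
    ∀ t ∈ Icc 0 T, ∀ x, Z t x = Z' t x := by
  intro t ht x
  have := h.norm_sub_le hW hZ hZ' h' t ht x
  rw [dBL_self, mul_zero, zero_mul] at this
  exact sub_eq_zero.1 (norm_le_zero_iff.1 this)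

/-- The stability constant of the mean field dynamics on `[0, T]`. -/
def stabilityConst (B T : ℝ) : ℝ :=
  3 * flowConst B T + 2 * (6 * B * flowConst B T) / (4 * B + 1) * exp (fieldRate B * T)

lemma stabilityConst_nonneg {B T : ℝ} (hB : 0 ≤ B) : 0 ≤ stabilityConst B T := by
  have := one_le_flowConst (T := T) hB
  unfold stabilityConst
  positivity

/-- Dobrushin's stability estimate. -/
lemma IsSelfConsistent.dBL_map_le {W : unitInterval → unitInterval → ℝ} {A : ℝ}
    (hW : IsGraphonBound A W) {K T : ℝ} {Z Z' : ℝ → unitInterval → ℝ × ℝ}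
    {μ ν : Measure PhaseSpace} [IsProbabilityMeasure μ] [IsProbabilityMeasure ν]
    (hZ : IsMeanField (|K| * A) Z) {B' : ℝ} (hZ' : IsMeanField B' Z')
    (h : IsSelfConsistent W K T μ Z) (h' : IsSelfConsistent W K T ν Z') {t : ℝ}
    (ht : t ∈ Icc 0 T) :
    dBL (μ.map (flowMap Z 0 t)) (ν.map (flowMap Z' 0 t)) ≤
      stabilityConst (|K| * A) T * dBL μ ν := by
  set B := |K| * A with hB
  have hB0 : 0 ≤ B := hZ.nonneg
  have hd := dBL_nonneg μ ν
  have hF := one_le_flowConst (T := T) hB0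
  refine dBL_le (mul_nonneg (stabilityConst_nonneg hB0) hd) fun f hf => ?_
  refine ((isObservable_of_mem_lipClass hf).abs_integral_map_sub_le hZ hZ' (lam := fieldRate B)
    (m := 6 * B * flowConst B T * dBL μ ν) (T := T) (by positivity)
    (by unfold fieldRate; linarith) (h.norm_sub_le hW hZ hZ' h') ht).trans ?_
  have he : exp (fieldRate B * t) ≤ exp (fieldRate B * T) := by
    have := ht.2
    have : 0 ≤ fieldRate B := by unfold fieldRate; linarith
    gcongr
  have hr : fieldRate B - 2 * B = 4 * B + 1 := by unfold fieldRate; ring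
  rw [hr, one_mul, one_mul, stabilityConst, add_mul]
  refine add_le_add le_rfl ?_
  calc _ ≤ 2 * (6 * B * flowConst B T * dBL μ ν) / (4 * B + 1) * exp (fieldRate B * T) := by
        gcongr
    _ = _ := by ring

/-- The mean field operator, with the time stopped outside of `[0, T]`. -/
def fieldOp (W : unitInterval → unitInterval → ℝ) (K T : ℝ) (μ : Measure PhaseSpace)
    (Z : ℝ → unitInterval → ℝ × ℝ) (t : ℝ) (x : unitInterval) : ℝ × ℝ :=
  meanField W K (μ.map (flowMap Z 0 (max 0 (min t T)))) x

lemma isMeanField_fieldOp {W : unitInterval → unitInterval → ℝ} {A : ℝ}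
    (hW : IsGraphonBound A W) (K T : ℝ) (μ : Measure PhaseSpace) [IsProbabilityMeasure μ] {B : ℝ}
    {Z : ℝ → unitInterval → ℝ × ℝ} (hZ : IsMeanField B Z) :
    IsMeanField (|K| * A) (fieldOp W K T μ Z) := by
  have hpr := fun t => isProbabilityMeasure_map_flowMap hZ μ 0 t
  exact ⟨fun x => (continuous_meanField_map hW K hZ μ x).comp (by fun_prop),
    fun t x => norm_meanField_le hW K _ x, fun t x y => norm_meanField_sub_le hW K _ x y⟩

lemma clamp_mem_Icc {T : ℝ} (hT : 0 ≤ T) (t : ℝ) : max 0 (min t T) ∈ Icc 0 T :=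
  ⟨le_max_left _ _, max_le hT (min_le_right _ _)⟩

lemma clamp_of_mem_Icc {T t : ℝ} (ht : t ∈ Icc 0 T) : max 0 (min t T) = t := by
  rw [min_eq_left ht.2, max_eq_right ht.1]

lemma norm_fieldOp_sub_le {W : unitInterval → unitInterval → ℝ} {A : ℝ}
    (hW : IsGraphonBound A W) {K T m : ℝ} (hT : 0 ≤ T) {Z Z' : ℝ → unitInterval → ℝ × ℝ}
    (hZ : IsMeanField (|K| * A) Z) (hZ' : IsMeanField (|K| * A) Z') (hm : 0 ≤ m)
    (h : ∀ t ∈ Icc 0 T, ∀ x, ‖Z t x - Z' t x‖ ≤ m * exp (fieldRate (|K| * A) * t))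
    (μ : Measure PhaseSpace) [IsProbabilityMeasure μ] (t : ℝ) (x : unitInterval) :
    ‖fieldOp W K T μ Z t x - fieldOp W K T μ Z' t x‖ ≤
      m / 2 * exp (fieldRate (|K| * A) * max 0 (min t T)) := by
  have := norm_meanField_map_sub_le_half hW hZ hZ' hm h μ μ _ (clamp_mem_Icc hT t) x
  rwa [dBL_self, mul_zero, zero_add] at this

/-- The mean field equation has a solution. -/
lemma exists_isSelfConsistent {W : unitInterval → unitInterval → ℝ} {A : ℝ}
    (hW : IsGraphonBound A W) (K : ℝ) {T : ℝ} (hT : 0 ≤ T) (μ : Measure PhaseSpace)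
    [IsProbabilityMeasure μ] :
    ∃ Z, IsMeanField (|K| * A) Z ∧ IsSelfConsistent W K T μ Z := by
  set B := |K| * A with hB
  have hB0 : 0 ≤ B := mul_nonneg (abs_nonneg K) ((abs_nonneg _).trans (hW.abs_le 0 0))
  set R := fieldRate B with hR
  have hR0 : 0 ≤ R := by rw [hR, fieldRate]; linarith
  -- Picard iteration from the zero field. All iterates satisfy the same bound and Lipschitz
  -- condition, which therefore survive in the limit.
  set Zs : ℕ → ℝ → unitInterval → ℝ × ℝ := fun n => (fieldOp W K T μ)^[n] fun _ _ => 0 with hZs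
  have hsucc : ∀ n, Zs (n + 1) = fieldOp W K T μ (Zs n) := fun n =>
    Function.iterate_succ_apply' _ _ _
  have hmf : ∀ n, IsMeanField B (Zs n) := by
    intro n
    induction n with
    | zero => exact ⟨fun x => continuous_const, fun t x => by simpa [hZs] using hB0,
        fun t x y => by simpa [hZs] using mul_nonneg hB0 (abs_nonneg _)⟩
    | succ n ih => rw [hsucc]; exact isMeanField_fieldOp hW K T μ ih
  have hstep : ∀ n t x, ‖Zs (n + 1) t x - Zs n t x‖ ≤
      2 * B / 2 ^ n * exp (R * max 0 (min t T)) := by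
    intro n
    induction n with
    | zero =>
      intro t x
      rw [pow_zero, div_one]
      refine (norm_sub_le _ _).trans ?_
      have h1 := (hmf 1).norm_le t x
      have h2 := (hmf 0).norm_le t x
      have hE1 : 1 ≤ exp (R * max 0 (min t T)) :=
        one_le_exp (mul_nonneg hR0 (le_max_left _ _))
      rw [zero_add]
      nlinarith
    | succ n ih =>
      intro t x
      rw [hsucc (n + 1)]
      nth_rewrite 2 [hsucc n]
      refine (norm_fieldOp_sub_le hW hT (hmf (n + 1)) (hmf n) (m := 2 * B / 2 ^ n)
        (by positivity) (fun t ht x => ?_) μ t x).trans_eq ?_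
      · have := ih t x
        rwa [clamp_of_mem_Icc ht] at this
      · rw [pow_succ]; ring
  -- The factor `2` matches the form `C / 2 / 2 ^ n` used for geometric Cauchy sequences, whose
  -- distance to the limit is then at most `C / 2 ^ n`.
  set C := 2 * (2 * B * exp (R * T)) with hC
  have hdist : ∀ t x n, dist (Zs n t x) (Zs (n + 1) t x) ≤ C / 2 / 2 ^ n := by
    intro t x n
    rw [dist_comm, dist_eq_norm]
    refine (hstep n t x).trans ?_
    have he : exp (R * max 0 (min t T)) ≤ exp (R * T) := by
      have := (clamp_mem_Icc hT t).2
      gcongr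
    calc _ ≤ 2 * B / 2 ^ n * exp (R * T) := by gcongr
      _ = _ := by rw [hC]; ring
  have hlim : ∀ t x, ∃ z, Tendsto (fun n => Zs n t x) atTop (𝓝 z) := fun t x =>
    cauchySeq_tendsto_of_complete (cauchySeq_of_le_geometric_two (hdist t x))
  choose Z hZ using hlim
  have hclose : ∀ t x n, ‖Zs n t x - Z t x‖ ≤ C / 2 ^ n := fun t x n => by
    rw [← dist_eq_norm]
    exact dist_le_of_le_geometric_two_of_tendsto (hdist t x) (hZ t x) n
  have hpow : Tendsto (fun n : ℕ => C / 2 ^ n) atTop (𝓝 0) :=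
    tendsto_const_nhds.div_atTop (tendsto_pow_atTop_atTop_of_one_lt one_lt_two)
  have hZmf : IsMeanField B Z := by
    refine ⟨fun x => ?_, fun t x => ?_, fun t x y => ?_⟩
    · have hu : TendstoUniformly (fun n t => Zs n t x) (fun t => Z t x) atTop := by
        rw [Metric.tendstoUniformly_iff]
        intro ε hε
        filter_upwards [hpow.eventually_lt_const hε] with n hn t
        rw [dist_comm, dist_eq_norm]
        exact (hclose t x n).trans_lt hn
      exact hu.continuous (Frequently.of_forall fun n => (hmf n).continuous x)
    · exact le_of_tendsto' (hZ t x).norm fun n => (hmf n).norm_le t x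
    · exact le_of_tendsto' ((hZ t x).sub (hZ t y)).norm fun n => (hmf n).lipschitz t x y
  refine ⟨Z, hZmf, fun t ht x => ?_⟩
  have hC0 : 0 ≤ C := by positivity
  -- The contraction estimate between `Zs n` and its limit `Z` sends the iterates to `fieldOp W K T
  -- μ Z` as well; equality of the two limits is self-consistency.
  have h1 : Tendsto (fun n => Zs (n + 1) t x) atTop (𝓝 (fieldOp W K T μ Z t x)) := by
    rw [tendsto_iff_norm_sub_tendsto_zero]
    refine squeeze_zero (fun _ => norm_nonneg _) (fun n => ?_)
      (by simpa using (hpow.div_const 2).mul_const (exp (R * max 0 (min t T))))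
    rw [hsucc]
    refine norm_fieldOp_sub_le hW hT (hmf n) hZmf (m := C / 2 ^ n) (by positivity)
      (fun t ht x => (hclose t x n).trans ?_) μ t x
    exact le_mul_of_one_le_right (by positivity) (one_le_exp (mul_nonneg hR0 ht.1))
  have h2 := tendsto_nhds_unique ((hZ t x).comp (tendsto_add_atTop_nat 1)) h1
  rw [h2, fieldOp, clamp_of_mem_Icc ht]

/-! ### The transported density is a weak solution -/

lemma continuous_circSin : Continuous circSin := by
  refine (QuotientAddGroup.isOpenQuotientMap_mk
    (N := AddSubgroup.zmultiples (2 * π))).isQuotientMap.continuous_iff.2 ?_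
  exact continuous_sin

lemma continuous_circCos : Continuous circCos := by
  refine (QuotientAddGroup.isOpenQuotientMap_mk
    (N := AddSubgroup.zmultiples (2 * π))).isQuotientMap.continuous_iff.2 ?_
  exact continuous_cos

/-- The speed in the mean field `z` at a point of the phase space. -/
def fieldSpeed (z : ℝ × ℝ) (P : PhaseSpace) : ℝ :=
  P.2.1 + z.2 * circCos P.1 - z.1 * circSin P.1

lemma fieldSpeed_coe (z : ℝ × ℝ) (θ ω : ℝ) (x : unitInterval) :
    fieldSpeed z ((θ : Circ), ω, x) = phaseSpeed z ω θ := by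
  simp [fieldSpeed, phaseSpeed]

lemma continuous_fieldSpeed {B : ℝ} {Z : ℝ → unitInterval → ℝ × ℝ} (hZ : IsMeanField B Z) :
    Continuous fun q : ℝ × PhaseSpace => fieldSpeed (Z q.1 q.2.2.2) q.2 := by
  have h1 : Continuous fun q : ℝ × PhaseSpace => Z q.1 q.2.2.2 :=
    hZ.continuous_uncurry.comp (f := fun q : ℝ × PhaseSpace => (q.1, q.2.2.2)) (by fun_prop)
  have h2 := continuous_circSin
  have h3 := continuous_circCos
  have h4 : Continuous fun q : ℝ × PhaseSpace => q.2.1 := by fun_prop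
  have h5 : Continuous fun q : ℝ × PhaseSpace => q.2.2.1 := by fun_prop
  exact (h5.add (h1.snd.mul (h3.comp h4))).sub (h1.fst.mul (h2.comp h4))

/-- By the chain rule, the derivative along a characteristic is the operator `∂_t + V ∂_θ` of the
weak formulation. -/
lemma hasDerivAt_comp_flowMap {B : ℝ} {Z : ℝ → unitInterval → ℝ × ℝ} (hZ : IsMeanField B Z)
    {F : ℝ × ℝ × ℝ × ℝ → ℝ} (hF : ContDiff ℝ (⊤ : ℕ∞) F) (θ ω : ℝ) (x : unitInterval) (t : ℝ) :
    HasDerivAt (fun t => F (t, phaseFlow Z 0 t θ ω x, ω, x))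
      (fderiv ℝ F (t, phaseFlow Z 0 t θ ω x, ω, x) (1, 0, 0, 0)
        + phaseSpeed (Z t x) ω (phaseFlow Z 0 t θ ω x)
          * fderiv ℝ F (t, phaseFlow Z 0 t θ ω x, ω, x) (0, 1, 0, 0)) t := by
  have hd : HasFDerivAt F (fderiv ℝ F (t, phaseFlow Z 0 t θ ω x, ω, x))
      (t, phaseFlow Z 0 t θ ω x, ω, x) := (hF.differentiable (by simp) _).hasFDerivAt
  have hc : HasDerivAt (fun t => ((t, phaseFlow Z 0 t θ ω x, ω, (x : ℝ)) : ℝ × ℝ × ℝ × ℝ))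
      (1, phaseSpeed (Z t x) ω (phaseFlow Z 0 t θ ω x), 0, 0) t :=
    (hasDerivAt_id t).prodMk ((isPhaseCurve_phaseFlow hZ 0 θ ω x t).prodMk
      ((hasDerivAt_const t ω).prodMk (hasDerivAt_const t (x : ℝ))))
  refine (hd.comp_hasDerivAt t hc).congr_deriv ?_
  have e : ((1, phaseSpeed (Z t x) ω (phaseFlow Z 0 t θ ω x), 0, 0) : ℝ × ℝ × ℝ × ℝ)
      = (1, 0, 0, 0) + phaseSpeed (Z t x) ω (phaseFlow Z 0 t θ ω x) • (0, 1, 0, 0) := by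
    simp
  rw [e, map_add, map_smul, smul_eq_mul]

section TestFunction

variable {w : ℝ → PhaseSpace → ℝ} {F : ℝ × ℝ × ℝ × ℝ → ℝ}

lemma deriv_time_eq (hF : ContDiff ℝ (⊤ : ℕ∞) F)
    (hw : ∀ (t θ ω : ℝ) (x : unitInterval), w t ((θ : Circ), ω, x) = F (t, θ, ω, (x : ℝ)))
    (t θ ω : ℝ) (x : unitInterval) :
    deriv (fun s => w s ((θ : Circ), ω, x)) t = fderiv ℝ F (t, θ, ω, x) (1, 0, 0, 0) := by
  simp only [hw]
  have hd : HasFDerivAt F (fderiv ℝ F (t, θ, ω, x)) (t, θ, ω, (x : ℝ)) :=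
    (hF.differentiable (by simp) _).hasFDerivAt
  have hc : HasDerivAt (fun t => ((t, θ, ω, (x : ℝ)) : ℝ × ℝ × ℝ × ℝ)) (1, 0, 0, 0) t :=
    (hasDerivAt_id t).prodMk (hasDerivAt_const t _)
  exact (hd.comp_hasDerivAt t hc).deriv

lemma derivTheta_eq (hF : ContDiff ℝ (⊤ : ℕ∞) F)
    (hw : ∀ (t θ ω : ℝ) (x : unitInterval), w t ((θ : Circ), ω, x) = F (t, θ, ω, (x : ℝ)))
    (t θ ω : ℝ) (x : unitInterval) :
    derivTheta (w t) ((θ : Circ), ω, x) = fderiv ℝ F (t, θ, ω, x) (0, 1, 0, 0) := by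
  simp only [derivTheta, ← AddCircle.coe_add, hw]
  have hd : HasFDerivAt F (fderiv ℝ F (t, θ, ω, x)) (t, θ + 0, ω, (x : ℝ)) := by
    rw [add_zero]; exact (hF.differentiable (by simp) _).hasFDerivAt
  have hc : HasDerivAt (fun s => ((t, θ + s, ω, (x : ℝ)) : ℝ × ℝ × ℝ × ℝ)) (0, 1, 0, 0) 0 :=
    (hasDerivAt_const _ _).prodMk (((hasDerivAt_id (0 : ℝ)).const_add θ).prodMk
      (hasDerivAt_const _ _))
  exact (hd.comp_hasDerivAt (0 : ℝ) hc).deriv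

lemma continuous_transport_derivative {B : ℝ} {Z : ℝ → unitInterval → ℝ × ℝ}
    (hZ : IsMeanField B Z) (hF : ContDiff ℝ (⊤ : ℕ∞) F)
    (hw : ∀ (t θ ω : ℝ) (x : unitInterval), w t ((θ : Circ), ω, x) = F (t, θ, ω, (x : ℝ))) :
    Continuous fun q : ℝ × PhaseSpace => deriv (fun s => w s q.2) q.1
      + fieldSpeed (Z q.1 q.2.2.2) q.2 * derivTheta (w q.1) q.2 := by
  have hdF : Continuous (fderiv ℝ F) := hF.continuous_fderiv (by simp)
  have hpt : Continuous fun q : ℝ × ℝ × ℝ × unitInterval =>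
      ((q.1, q.2.1, q.2.2.1, (q.2.2.2 : ℝ)) : ℝ × ℝ × ℝ × ℝ) := by fun_prop
  refine Continuous.add ?_ ((continuous_fieldSpeed hZ).mul ?_)
  · apply continuous_of_continuous_lift
    simp only [deriv_time_eq hF hw]
    exact (hdF.comp hpt).clm_apply continuous_const
  · apply continuous_of_continuous_lift
    simp only [derivTheta_eq hF hw]
    exact (hdF.comp hpt).clm_apply continuous_const

end TestFunction

/-- Differentiation of the integrals of a curve of functions. -/
lemma integral_sub_integral_eq {X : Type*} [TopologicalSpace X] [MeasurableSpace X]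
    [OpensMeasurableSpace (ℝ × X)] {μ : Measure X}
    [IsFiniteMeasure μ] {u h : ℝ → X → ℝ} (hd : ∀ t P, HasDerivAt (fun t => u t P) (h t P) t)
    (hc : Continuous fun q : ℝ × X => h q.1 q.2) {T C : ℝ} (hT : 0 ≤ T)
    (hC : ∀ t ∈ Icc 0 T, ∀ P, |h t P| ≤ C) (h0 : Integrable (u 0) μ) (h1 : Integrable (u T) μ) :
    (∫ P, u T P ∂μ) - ∫ P, u 0 P ∂μ = ∫ t in (0 : ℝ)..T, ∫ P, h t P ∂μ := by
  have hint : Integrable (fun q : ℝ × X => h q.1 q.2)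
      (((volume : Measure ℝ).restrict (Ioc 0 T)).prod μ) := by
    refine Integrable.of_bound hc.aestronglyMeasurable C ?_
    have : ∀ᵐ q : ℝ × X ∂(((volume : Measure ℝ).restrict (Ioc 0 T)).prod μ), q.1 ∈ Ioc 0 T :=
      Measure.quasiMeasurePreserving_fst.ae (ae_restrict_mem measurableSet_Ioc)
    filter_upwards [this] with q hq
    exact hC _ (Ioc_subset_Icc_self hq) _
  rw [← integral_sub h1 h0, intervalIntegral.integral_of_le hT, integral_integral_swap hint]
  refine integral_congr_ae (Eventually.of_forall fun P => ?_)
  simp only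
  rw [← intervalIntegral.integral_of_le hT]
  refine (intervalIntegral.integral_eq_sub_of_hasDerivAt (fun t _ => hd t P) ?_).symm
  exact (hc.comp (f := fun t : ℝ => (t, P)) (by fun_prop)).intervalIntegrable 0 T

/-- The mean field of a density, of no prescribed sign. -/
def densityField (W : unitInterval → unitInterval → ℝ) (K : ℝ) (ρ : PhaseSpace → ℝ)
    (x : unitInterval) : ℝ × ℝ :=
  (K * ∫ Q : PhaseSpace, W x Q.2.2 * circCos Q.1 * ρ Q,
    K * ∫ Q : PhaseSpace, W x Q.2.2 * circSin Q.1 * ρ Q)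

lemma Integrable.continuous_mul_of_abs_le {ρ : PhaseSpace → ℝ} (hρ : Integrable ρ)
    {f : PhaseSpace → ℝ} (hf : Continuous f) {a : ℝ} (ha : ∀ P, |f P| ≤ a) :
    Integrable fun P => f P * ρ P :=
  hρ.bdd_mul hf.aestronglyMeasurable (Eventually.of_forall ha)

/-- The addition formula separates the oscillator's own phase from the phases of the others.
Integrability of `ρ` alone justifies splitting the integral, so the identity also covers densities
of variable sign. -/
lemma velocity_eq_fieldSpeed {W : unitInterval → unitInterval → ℝ} {A : ℝ}
    (hW : IsGraphonBound A W) (K : ℝ) {ρ : PhaseSpace → ℝ} (hρ : Integrable ρ) (P : PhaseSpace) :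
    velocity W K ρ P = fieldSpeed (densityField W K ρ P.2.2) P := by
  have hs := Integrable.continuous_mul_of_abs_le hρ (isObservable_sin hW P.2.2).continuous
    (isObservable_sin hW P.2.2).abs_le
  have hc := Integrable.continuous_mul_of_abs_le hρ (isObservable_cos hW P.2.2).continuous
    (isObservable_cos hW P.2.2).abs_le
  have e : ∀ Q : PhaseSpace, W P.2.2 Q.2.2 * circSin (Q.1 - P.1) * ρ Q
      = circCos P.1 * (W P.2.2 Q.2.2 * circSin Q.1 * ρ Q)
        - circSin P.1 * (W P.2.2 Q.2.2 * circCos Q.1 * ρ Q) := fun Q => by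
    rw [circSin_sub]; ring
  simp only [velocity, e]
  rw [integral_sub (hs.const_mul _) (hc.const_mul _), integral_const_mul, integral_const_mul]
  simp only [fieldSpeed, densityField]
  ring

lemma densityField_eq_meanField (W : unitInterval → unitInterval → ℝ) (K : ℝ) {ρ : PhaseSpace → ℝ}
    (hρ : Measurable ρ) (hρ0 : ∀ P, 0 ≤ ρ P) (x : unitInterval) :
    densityField W K ρ x = meanField W K (densityMeasure ρ) x := by
  simp only [densityField, meanField, integral_densityMeasure hρ hρ0, mul_comm (ρ _)]

/-- The image of the initial density under the flow of a self-consistent mean field is a weak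
solution. -/
lemma isWeakSolution_flowDensity {W : unitInterval → unitInterval → ℝ} {A : ℝ}
    (hW : IsGraphonBound A W) {K T B : ℝ} (hT : 0 < T) {Z : ℝ → unitInterval → ℝ × ℝ}
    (hZ : IsMeanField B Z) {r : PhaseSpace → ℝ} (hr : Continuous r) (hr0 : ∀ P, 0 ≤ r P)
    [IsProbabilityMeasure (densityMeasure r)] (hsc : IsSelfConsistent W K T (densityMeasure r) Z) :
    IsWeakSolution W K T r (flowDensity Z r) := by
  have hcont := continuous_flowDensity hZ hr
  have hmeas := measurable_flowDensity hZ hr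
  have hnn := flowDensity_nonneg Z hr0
  have hmap := densityMeasure_flowDensity hZ hr hr0
  have hprob : ∀ t, IsProbabilityMeasure (densityMeasure (flowDensity Z r t)) := fun t => by
    rw [hmap]; exact isProbabilityMeasure_map_flowMap hZ _ _ _
  have hint : ∀ t, Integrable (flowDensity Z r t) := fun t =>
    integrable_of_isFiniteMeasure_densityMeasure (hmeas t) (hnn t)
  have hI : ∀ (f : PhaseSpace → ℝ) (t : ℝ), ∫ P, flowDensity Z r t P * f P
      = ∫ P, f P ∂((densityMeasure r).map (flowMap Z 0 t)) := fun f t => by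
    rw [← hmap, integral_densityMeasure (hmeas t) (hnn t)]
  refine ⟨hcont.aestronglyMeasurable, fun t _ => hint t, fun f => ?_, fun w hw => ?_⟩
  · simp only [mul_comm (f _), hI]
    exact (continuous_integral_map_flowMap hZ _ f.continuous
      (fun P => f.norm_coe_le_norm P)).continuousOn
  · obtain ⟨F, hF, hwF⟩ := hw.smooth
    obtain ⟨τ, hτ, R, hsupp⟩ := hw.support
    set h : ℝ → PhaseSpace → ℝ := fun t P => deriv (fun s => w s P) t
      + fieldSpeed (Z t P.2.2) P * derivTheta (w t) P with hh
    have hhc : Continuous fun q : ℝ × PhaseSpace => h q.1 q.2 :=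
      continuous_transport_derivative hZ hF hwF
    have hzero : ∀ t (P : PhaseSpace), R < |P.2.1| → h t P = 0 := by
      intro t P hP
      have h1 : (fun s => w s P) = fun _ => 0 := funext fun s => hsupp s _ _ _ (Or.inr hP.le)
      have h2 : (fun s : ℝ => w t (P.1 + (s : Circ), P.2)) = fun _ => 0 :=
        funext fun s => hsupp t _ _ _ (Or.inr hP.le)
      simp only [hh, derivTheta, h1, h2, deriv_const, mul_zero, add_zero]
    -- The speed is unbounded in the frequency, but the test function vanishes for large `|ω|`; on
    -- the remaining set compactness of the circle and of `I` gives the bound.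
    have hbound : ∃ C, ∀ t ∈ Icc 0 T, ∀ P, |h t P| ≤ C := by
      have hcomp : IsCompact ((Icc 0 T) ×ˢ ((univ : Set Circ) ×ˢ (Icc (-R) R) ×ˢ
          (univ : Set unitInterval))) :=
        isCompact_Icc.prod (isCompact_univ.prod (isCompact_Icc.prod isCompact_univ))
      obtain ⟨C, hC⟩ := hcomp.exists_bound_of_continuousOn hhc.continuousOn
      refine ⟨max C 0, fun t ht P => ?_⟩
      by_cases hP : R < |P.2.1|
      · rw [hzero t P hP, abs_zero]; exact le_max_right _ _
      · refine (hC (t, P) ⟨ht, mem_univ _, abs_le.1 (not_lt.1 hP), mem_univ _⟩).trans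
          (le_max_left _ _)
    obtain ⟨C, hC⟩ := hbound
    have hderiv : ∀ t P, HasDerivAt (fun t => w t (flowMap Z 0 t P)) (h t (flowMap Z 0 t P)) t := by
      rintro t ⟨θ, ω, x⟩
      rw [← coe_circRep θ]
      have := hasDerivAt_comp_flowMap hZ hF (circRep θ) ω x t
      simp only [flowMap_coe hZ, hh, deriv_time_eq hF hwF, derivTheta_eq hF hwF, fieldSpeed_coe]
      simp only [hwF]
      exact this
    have hwT : ∀ P, w T P = 0 := fun P => hsupp T _ _ _ (Or.inl hτ.le)
    have hw0c : Continuous (w 0) := by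
      have h1 : Continuous fun q : ℝ × PhaseSpace => w q.1 q.2 := by
        apply continuous_of_continuous_lift
        simp only [hwF]
        exact hF.continuous.comp (by fun_prop)
      exact h1.comp (f := fun P : PhaseSpace => (0, P)) (by fun_prop)
    have hw0b : ∃ C, ∀ P, |w 0 P| ≤ C := by
      have hcomp : IsCompact ((univ : Set Circ) ×ˢ (Icc (-R) R) ×ˢ (univ : Set unitInterval)) :=
        isCompact_univ.prod (isCompact_Icc.prod isCompact_univ)
      obtain ⟨C, hC⟩ := hcomp.exists_bound_of_continuousOn hw0c.continuousOn
      refine ⟨max C 0, fun P => ?_⟩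
      by_cases hP : R < |P.2.1|
      · have : w 0 P = 0 := hsupp 0 _ _ _ (Or.inr hP.le)
        rw [this, abs_zero]; exact le_max_right _ _
      · exact (hC P ⟨mem_univ _, abs_le.1 (not_lt.1 hP), mem_univ _⟩).trans (le_max_left _ _)
    obtain ⟨C₀, hC₀⟩ := hw0b
    -- The derivative along characteristics is integrated against the initial measure. The term at
    -- `T` vanishes and the term at `0` is the initial condition.
    have key := integral_sub_integral_eq (μ := densityMeasure r)
      (u := fun t P => w t (flowMap Z 0 t P)) (h := fun t P => h t (flowMap Z 0 t P)) hderiv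
      (hhc.comp (f := fun q : ℝ × PhaseSpace => (q.1, flowMap Z 0 q.1 q.2))
        (continuous_fst.prodMk ((continuous_flowMap hZ).comp
          (f := fun q : ℝ × PhaseSpace => ((0, q.1), q.2)) (by fun_prop)))) hT.le
      (fun t ht P => hC t ht _)
      (by simp only [flowMap_self hZ]; exact integrable_of_continuous_of_abs_le hw0c hC₀)
      (by simp only [hwT]; exact integrable_zero _ _ _)
    simp only [hwT, integral_zero, flowMap_self hZ, zero_sub] at key
    rw [integral_densityMeasure hr.measurable hr0] at key
    -- Self-consistency enters here: the velocity of the transported density is the speed in the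
    -- field `Z` that transports it.
    have e : ∫ t in (0 : ℝ)..T, ∫ P, flowDensity Z r t P * (deriv (fun s => w s P) t
        + velocity W K (flowDensity Z r t) P * derivTheta (w t) P)
        = ∫ t in (0 : ℝ)..T, ∫ P, h t (flowMap Z 0 t P) ∂(densityMeasure r) := by
      refine intervalIntegral.integral_congr fun t ht => ?_
      rw [uIcc_of_le hT.le] at ht
      have hv : ∀ P, velocity W K (flowDensity Z r t) P = fieldSpeed (Z t P.2.2) P := fun P => by
        rw [velocity_eq_fieldSpeed hW K (hint t), densityField_eq_meanField W K (hmeas t) (hnn t),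
          hmap, hsc t ht]
      have hht : Continuous (h t) := hhc.comp (f := fun P : PhaseSpace => (t, P)) (by fun_prop)
      simp only [hv]
      rw [hI, integral_map (continuous_flowMap_apply hZ 0 t).aemeasurable
        hht.aestronglyMeasurable]
    rw [e, ← key, neg_add_cancel]

/-! ### From the weak formulation to an integrated equation in time -/

lemma exists_lt_forall_eq_zero_of_tsupport_subset {ψ : ℝ → ℝ} {a T : ℝ} (haT : a < T)
    (hc : HasCompactSupport ψ) (hs : tsupport ψ ⊆ Iio T) : ∃ τ < T, ∀ t, τ ≤ t → ψ t = 0 := by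
  rcases (tsupport ψ).eq_empty_or_nonempty with he | hne
  · exact ⟨a, haT, fun t _ => image_eq_zero_of_notMem_tsupport (by simp [he])⟩
  · obtain ⟨σ, hσ, hmax⟩ := hc.isCompact.exists_isGreatest hne
    have hσT : σ < T := hs hσ
    refine ⟨(σ + T) / 2, by linarith, fun t ht => image_eq_zero_of_notMem_tsupport fun h => ?_⟩
    have := hmax h
    linarith

/-- A continuous function with a continuous weak derivative is its primitive. -/
lemma eq_add_integral_of_weak_derivative {T : ℝ} (hT : 0 < T) {u v : ℝ → ℝ} (hu : Continuous u)
    (hv : Continuous v) {u₀ : ℝ}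
    (h : ∀ χ : ℝ → ℝ, ContDiff ℝ (⊤ : ℕ∞) χ → (∃ τ < T, ∀ t, τ ≤ t → χ t = 0) →
      (∫ t in (0 : ℝ)..T, (u t * deriv χ t + v t * χ t)) + u₀ * χ 0 = 0) :
    ∀ t ∈ Icc 0 T, u t = u₀ + ∫ s in (0 : ℝ)..t, v s := by
  set V : ℝ → ℝ := fun t => ∫ s in (0 : ℝ)..t, v s with hV
  have hVd : ∀ t, HasDerivAt V (v t) t := fun t => (hv.integral_hasStrictDerivAt 0 t).hasDerivAt
  have hVc : Continuous V := continuous_iff_continuousAt.2 fun t => (hVd t).continuousAt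
  set y : ℝ → ℝ := fun t => u t - u₀ - V t with hy
  have hyc : Continuous y := (hu.sub continuous_const).sub hVc
  have hae : ∀ᵐ t : ℝ, t ∈ Ioo 0 T → y t = 0 := by
    refine isOpen_Ioo.ae_eq_zero_of_integral_contDiff_smul_eq_zero
      (hyc.locallyIntegrable.locallyIntegrableOn _) fun ψ hψ hψc hψs => ?_
    obtain ⟨τ, hτ, hψτ⟩ := exists_lt_forall_eq_zero_of_tsupport_subset hT hψc
      (hψs.trans Ioo_subset_Iio_self)
    -- The primitive of `ψ` normalised at `T` vanishes from `τ` on, so it is admissible. It need not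
    -- vanish at `0`, where its value `-∫ ψ` brings in the initial value `u₀`.
    set χ : ℝ → ℝ := fun t => ∫ s in T..t, ψ s with hχ
    have hχd : ∀ t, HasDerivAt χ (ψ t) t := fun t =>
      (hψ.continuous.integral_hasStrictDerivAt T t).hasDerivAt
    have hχ' : deriv χ = ψ := funext fun t => (hχd t).deriv
    have hχs : ContDiff ℝ (⊤ : ℕ∞) χ :=
      contDiff_infty_iff_deriv.2 ⟨fun t => (hχd t).differentiableAt, hχ' ▸ hψ⟩
    have hχτ : ∀ t, τ ≤ t → χ t = 0 := fun t ht => by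
      refine intervalIntegral.integral_zero_ae (Eventually.of_forall fun s hs => hψτ s ?_)
      exact (le_min hτ.le ht).trans hs.1.le
    have hmain := h χ hχs ⟨τ, hτ, hχτ⟩
    have hχc : Continuous χ := hχs.continuous
    have hparts := intervalIntegral.integral_mul_deriv_eq_deriv_mul (a := 0) (b := T) (u := V)
      (v := χ) (fun t _ => hVd t) (fun t _ => hχd t) (hv.intervalIntegrable _ _)
      (hψ.continuous.intervalIntegrable _ _)
    have hV0 : V 0 = 0 := intervalIntegral.integral_same
    have hχT : χ T = 0 := hχτ T hτ.le
    have hχ0 : χ 0 = -∫ s in (0 : ℝ)..T, ψ s := intervalIntegral.integral_symm _ _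
    rw [hV0, hχT, mul_zero, zero_mul, sub_zero, zero_sub] at hparts
    have hi1 : IntervalIntegrable (fun t => u t * ψ t) volume 0 T :=
      (hu.mul hψ.continuous).intervalIntegrable _ _
    have hi2 : IntervalIntegrable (fun t => v t * χ t) volume 0 T :=
      (hv.mul hχc).intervalIntegrable _ _
    have hi3 : IntervalIntegrable (fun t => u₀ * ψ t) volume 0 T :=
      (continuous_const.mul hψ.continuous).intervalIntegrable _ _
    have hi4 : IntervalIntegrable (fun t => V t * ψ t) volume 0 T :=
      (hVc.mul hψ.continuous).intervalIntegrable _ _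
    rw [hχ', intervalIntegral.integral_add hi1 hi2, hχ0] at hmain
    have hsupp : ∫ t, ψ t • y t = ∫ t in (0 : ℝ)..T, ψ t * y t := by
      rw [intervalIntegral.integral_of_le hT.le]
      simp only [smul_eq_mul]
      rw [setIntegral_eq_integral_of_forall_compl_eq_zero]
      intro t ht
      have : t ∉ tsupport ψ := fun h' => ht (Ioo_subset_Ioc_self (hψs h'))
      rw [image_eq_zero_of_notMem_tsupport this, zero_mul]
    have hsplit : ∫ t in (0 : ℝ)..T, ψ t * y t = (∫ t in (0 : ℝ)..T, u t * ψ t)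
        - u₀ * (∫ t in (0 : ℝ)..T, ψ t) - ∫ t in (0 : ℝ)..T, V t * ψ t := by
      rw [← intervalIntegral.integral_const_mul, ← intervalIntegral.integral_sub hi1 hi3,
        ← intervalIntegral.integral_sub (hi1.sub hi3) hi4]
      refine intervalIntegral.integral_congr fun t _ => ?_
      simp only [hy]
      ring
    rw [hsupp, hsplit, hparts]
    linarith
  have hon : EqOn y (fun _ => 0) (Icc 0 T) := by
    refine Measure.eqOn_Icc_of_ae_eq volume hT.ne ?_ hyc.continuousOn continuousOn_const
    rw [← restrict_Ioo_eq_restrict_Icc]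
    exact (ae_restrict_iff' measurableSet_Ioo).2 hae
  intro t ht
  have : y t = 0 := hon ht
  simp only [hy] at this
  linarith

/-! ### Fourier modes in the phase -/

/-- The function `cos (k θ + α)` on the circle. -/
def circMode (k : ℤ) (α : ℝ) (θ : Circ) : ℝ := cos (k * circRep θ + α)

@[simp] lemma circMode_coe (k : ℤ) (α θ : ℝ) : circMode k α (θ : Circ) = cos (k * θ + α) := by
  refine Function.Periodic.apply_circRep (f := fun θ => cos (k * θ + α)) (fun θ => ?_) θ
  have : (k : ℝ) * (θ + 2 * π) + α = k * θ + α + k * (2 * π) := by ring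
  simp only [this, cos_add_int_mul_two_pi]

lemma abs_circMode_le_one (k : ℤ) (α : ℝ) (θ : Circ) : |circMode k α θ| ≤ 1 := abs_cos_le_one _

lemma continuous_circMode (k : ℤ) (α : ℝ) : Continuous (circMode k α) := by
  refine (QuotientAddGroup.isOpenQuotientMap_mk
    (N := AddSubgroup.zmultiples (2 * π))).isQuotientMap.continuous_iff.2 ?_
  have : circMode k α ∘ QuotientAddGroup.mk = fun θ : ℝ => cos (k * θ + α) :=
    funext fun θ => circMode_coe k α θ
  rw [this]
  fun_prop

/-- The observable `cos (k θ + α) h (ω, x)`. -/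
def modeFun (k : ℤ) (α : ℝ) (h : BoundedContinuousFunction (ℝ × unitInterval) ℝ) :
    BoundedContinuousFunction PhaseSpace ℝ :=
  BoundedContinuousFunction.ofNormedAddCommGroup (fun P => circMode k α P.1 * h P.2)
    (((continuous_circMode k α).comp continuous_fst).mul (h.continuous.comp continuous_snd)) ‖h‖
    fun P => by
      rw [norm_mul]
      exact (mul_le_mul (abs_circMode_le_one k α P.1) (h.norm_coe_le_norm P.2) (norm_nonneg _)
        zero_le_one).trans (one_mul _).le

lemma modeFun_apply (k : ℤ) (α : ℝ) (h : BoundedContinuousFunction (ℝ × unitInterval) ℝ)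
    (P : PhaseSpace) : modeFun k α h P = circMode k α P.1 * h P.2 := rfl

lemma norm_modeFun_le (k : ℤ) (α : ℝ) (h : BoundedContinuousFunction (ℝ × unitInterval) ℝ) :
    ‖modeFun k α h‖ ≤ ‖h‖ :=
  BoundedContinuousFunction.norm_ofNormedAddCommGroup_le _ (norm_nonneg _) _

lemma modeFun_sub (k : ℤ) (α : ℝ) (h h' : BoundedContinuousFunction (ℝ × unitInterval) ℝ) :
    modeFun k α (h - h') = modeFun k α h - modeFun k α h' := by
  ext P
  simp only [modeFun_apply, BoundedContinuousFunction.sub_apply, mul_sub]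

/-- The functions on `ℝ × I` that vanish outside of `[-R, R] × I`. -/
def VanishesBeyond (R : ℝ) (h : BoundedContinuousFunction (ℝ × unitInterval) ℝ) : Prop :=
  ∀ y : ℝ × unitInterval, R < |y.1| → h y = 0

lemma VanishesBeyond.mul_left {R : ℝ} {h : BoundedContinuousFunction (ℝ × unitInterval) ℝ}
    (hh : VanishesBeyond R h) (f : BoundedContinuousFunction (ℝ × unitInterval) ℝ) :
    VanishesBeyond R (f * h) := fun y hy => by
  rw [BoundedContinuousFunction.mul_apply, hh y hy, mul_zero]

/-- The real and imaginary parts of the Fourier monomials are modes. -/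
lemma fourier_re_im (n : ℤ) (θ : Circ) :
    (fourier n θ).re = circMode n 0 θ ∧ (fourier n θ).im = circMode n (-(π / 2)) θ := by
  rw [← coe_circRep θ, fourier_coe_apply, circMode_coe, circMode_coe]
  have e : 2 * (π : ℂ) * Complex.I * n * (circRep θ : ℂ) / ((2 * π : ℝ) : ℂ)
      = ((n * circRep θ : ℝ) : ℂ) * Complex.I := by
    have : (π : ℂ) ≠ 0 := by exact_mod_cast pi_ne_zero
    push_cast
    field_simp
  rw [e, Complex.exp_ofReal_mul_I_re, Complex.exp_ofReal_mul_I_im, add_zero, ← sub_eq_add_neg,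
    cos_sub_pi_div_two]
  exact ⟨rfl, rfl⟩

lemma Integrable.bddCont_mul {σ : PhaseSpace → ℝ} (hσ : Integrable σ)
    (f : BoundedContinuousFunction PhaseSpace ℝ) : Integrable fun P => f P * σ P :=
  Integrable.continuous_mul_of_abs_le hσ f.continuous fun P => f.norm_coe_le_norm P

/-- An integrable function that is orthogonal to all the modes vanishes. -/
lemma ae_eq_zero_of_integral_modeFun {σ : PhaseSpace → ℝ} (hσ : Integrable σ)
    (h : ∀ R h, VanishesBeyond R h → ∀ k α, ∫ P, modeFun k α h P * σ P = 0) :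
    σ =ᵐ[volume] 0 := by
  have hint : ∀ (a : Circ → ℝ) (ha : Continuous a) (f : BoundedContinuousFunction _ ℝ),
      Integrable fun P : PhaseSpace => a P.1 * f P.2 * σ P := by
    intro a ha f
    obtain ⟨C, hC⟩ := isCompact_univ.exists_bound_of_continuousOn ha.continuousOn
    have hC0 : 0 ≤ C := (norm_nonneg _).trans (hC 0 (mem_univ _))
    refine Integrable.continuous_mul_of_abs_le hσ
      ((ha.comp continuous_fst).mul (f.continuous.comp continuous_snd)) (a := C * ‖f‖) fun P => ?_
    rw [abs_mul]
    exact mul_le_mul (hC _ (mem_univ _)) (f.norm_coe_le_norm _) (abs_nonneg _) hC0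
  -- The class of admissible functions of the phase grows from modes to trigonometric polynomials,
  -- then to continuous functions by uniform approximation. The restriction on the frequency is
  -- removed afterwards by cutoffs.
  have htrig : ∀ R f, VanishesBeyond R f → ∀ q ∈ Submodule.span ℂ (range (@fourier (2 * π))),
      (∫ P : PhaseSpace, (q P.1).re * f P.2 * σ P) = 0
        ∧ (∫ P : PhaseSpace, (q P.1).im * f P.2 * σ P) = 0 := by
    intro R f hf q hq
    induction hq using Submodule.span_induction with
    | mem q hq =>
      obtain ⟨n, rfl⟩ := hq
      simp only [(fourier_re_im n _).1, (fourier_re_im n _).2]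
      exact ⟨h R f hf n 0, h R f hf n _⟩
    | zero => simp
    | add q q' _ _ hq hq' =>
      simp only [ContinuousMap.add_apply, Complex.add_re, Complex.add_im, add_mul]
      rw [integral_add (hint (fun θ => (q θ).re) (by fun_prop) f)
          (hint (fun θ => (q' θ).re) (by fun_prop) f),
        integral_add (hint (fun θ => (q θ).im) (by fun_prop) f)
          (hint (fun θ => (q' θ).im) (by fun_prop) f), hq.1, hq.2, hq'.1, hq'.2]
      simp
    | smul c q _ hq =>
      have e1 : ∀ P : PhaseSpace, ((c • q) P.1).re * f P.2 * σ P
          = c.re * ((q P.1).re * f P.2 * σ P) - c.im * ((q P.1).im * f P.2 * σ P) := fun P => by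
        simp only [ContinuousMap.smul_apply, smul_eq_mul, Complex.mul_re]; ring
      have e2 : ∀ P : PhaseSpace, ((c • q) P.1).im * f P.2 * σ P
          = c.re * ((q P.1).im * f P.2 * σ P) + c.im * ((q P.1).re * f P.2 * σ P) := fun P => by
        simp only [ContinuousMap.smul_apply, smul_eq_mul, Complex.mul_im]; ring
      have i1 := hint (fun θ => (q θ).re) (by fun_prop) f
      have i2 := hint (fun θ => (q θ).im) (by fun_prop) f
      simp only [e1, e2]
      rw [integral_sub (i1.const_mul _) (i2.const_mul _),
        integral_add (i2.const_mul _) (i1.const_mul _)]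
      simp only [integral_const_mul, hq.1, hq.2, mul_zero, sub_zero, add_zero, and_self]
  have hcirc : ∀ R f, VanishesBeyond R f → ∀ a : C(Circ, ℝ),
      ∫ P : PhaseSpace, a P.1 * f P.2 * σ P = 0 := by
    intro R f hf a
    set I₀ := ∫ P, |σ P|
    have key : ∀ ε > 0, |∫ P : PhaseSpace, a P.1 * f P.2 * σ P| ≤ ε * (‖f‖ * I₀) := by
      intro ε hε
      set b : C(Circ, ℂ) := ⟨fun θ => (a θ : ℂ), by fun_prop⟩ with hb
      have hbm : b ∈ (Submodule.span ℂ (range (@fourier (2 * π)))).topologicalClosure := by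
        rw [span_fourier_closure_eq_top]; trivial
      obtain ⟨q, hq, hdist⟩ := Metric.mem_closure_iff.1 hbm ε hε
      have hz := (htrig R f hf q hq).1
      rw [← sub_zero (∫ P : PhaseSpace, a P.1 * f P.2 * σ P), ← hz,
        ← integral_sub (hint a a.continuous f) (hint (fun θ => (q θ).re) (by fun_prop) f)]
      have hbd : ∀ P : PhaseSpace, ‖a P.1 * f P.2 * σ P - (q P.1).re * f P.2 * σ P‖
          ≤ ε * ‖f‖ * |σ P| := by
        intro P
        rw [← sub_mul, ← sub_mul, norm_mul, norm_mul]
        have h1 : ‖a P.1 - (q P.1).re‖ ≤ ε := by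
          have h2 : a P.1 - (q P.1).re = (b P.1 - q P.1).re := by simp [hb]
          rw [h2]
          refine (Complex.abs_re_le_norm _).trans ?_
          rw [← dist_eq_norm]
          exact (ContinuousMap.dist_apply_le_dist P.1).trans hdist.le
        exact mul_le_mul_of_nonneg_right
          (mul_le_mul h1 (f.norm_coe_le_norm _) (norm_nonneg _) hε.le) (norm_nonneg _)
      refine (norm_integral_le_of_norm_le (hσ.abs.const_mul _) (Eventually.of_forall hbd)).trans ?_
      rw [integral_const_mul, mul_assoc]
    have hlim : Tendsto (fun ε : ℝ => ε * (‖f‖ * I₀)) (𝓝[>] 0) (𝓝 (0 * (‖f‖ * I₀))) :=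
      ((continuous_id.mul continuous_const).tendsto (0 : ℝ)).mono_left nhdsWithin_le_nhds
    rw [zero_mul] at hlim
    exact abs_nonpos_iff.1 (ge_of_tendsto hlim (eventually_mem_nhdsWithin.mono key))
  have hall : ∀ (a : BoundedContinuousFunction Circ ℝ)
      (f : BoundedContinuousFunction (ℝ × unitInterval) ℝ),
      ∫ P : PhaseSpace, a P.1 * f P.2 * σ P = 0 := by
    intro a f
    -- The cutoff is `1` for `|ω| ≤ n` and `0` for `|ω| ≥ n + 1`; dominated convergence removes it.
    set cut : ℕ → BoundedContinuousFunction (ℝ × unitInterval) ℝ := fun n =>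
      BoundedContinuousFunction.ofNormedAddCommGroup
        (fun y => max 0 (min 1 ((n : ℝ) + 1 - |y.1|))) (by fun_prop) 1 (fun y => by
          rw [norm_eq_abs, abs_of_nonneg (le_max_left _ _)]
          exact max_le zero_le_one (min_le_left _ _)) with hcut
    have hcv : ∀ n : ℕ, VanishesBeyond (n + 1) (cut n * f) := fun n y hy => by
      have : cut n y = 0 := by
        simp only [hcut, BoundedContinuousFunction.coe_ofNormedAddCommGroup]
        exact max_eq_left ((min_le_right _ _).trans (by linarith))
      rw [BoundedContinuousFunction.mul_apply, this, zero_mul]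
    have hzero : ∀ n, ∫ P : PhaseSpace, a P.1 * (cut n * f) P.2 * σ P = 0 := fun n =>
      hcirc _ _ (hcv n) a.toContinuousMap
    have hcut1 : ∀ n y, |cut n y| ≤ 1 := fun n y => by
      simp only [hcut, BoundedContinuousFunction.coe_ofNormedAddCommGroup]
      rw [abs_of_nonneg (le_max_left _ _)]
      exact max_le zero_le_one (min_le_left _ _)
    have hlim := tendsto_integral_of_dominated_convergence
      (F := fun n (P : PhaseSpace) => a P.1 * (cut n * f) P.2 * σ P)
      (f := fun P => a P.1 * f P.2 * σ P) (μ := volume) (fun P => |a P.1 * f P.2 * σ P|)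
      (fun n => (hint a a.continuous (cut n * f)).aestronglyMeasurable)
      (hint a a.continuous f).abs
      (fun n => Eventually.of_forall fun P => by
        have e : a P.1 * (cut n * f) P.2 * σ P = cut n P.2 * (a P.1 * f P.2 * σ P) := by
          rw [BoundedContinuousFunction.mul_apply]; ring
        rw [e, norm_mul]
        exact mul_le_of_le_one_left (abs_nonneg _) (hcut1 n _))
      (Eventually.of_forall fun P => by
        obtain ⟨N, hN⟩ := exists_nat_ge |P.2.1|
        refine tendsto_const_nhds.congr' ?_
        filter_upwards [eventually_ge_atTop N] with n hn
        have hn' : (N : ℝ) ≤ n := by exact_mod_cast hn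
        have : cut n P.2 = 1 := by
          simp only [hcut, BoundedContinuousFunction.coe_ofNormedAddCommGroup]
          rw [min_eq_left (by linarith), max_eq_right zero_le_one]
        rw [BoundedContinuousFunction.mul_apply, this, one_mul])
    simp only [hzero] at hlim
    exact (tendsto_nhds_unique hlim tendsto_const_nhds)
  have hfin : ∀ {ρ : PhaseSpace → ℝ}, Integrable ρ →
      IsFiniteMeasure ((volume : Measure PhaseSpace).withDensity fun P => ENNReal.ofReal (ρ P)) :=
    fun hρ => isFiniteMeasure_withDensity_ofReal hρ.2
  have hf1 := hfin hσ
  have hf2 := hfin hσ.neg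
  -- The positive and negative parts of `σ` are densities of finite measures that agree on products
  -- `a (θ) f (ω, x)`, which determine the measure. So both parts coincide almost everywhere, and
  -- since one of them always vanishes, so does `σ`.
  have heq : (volume : Measure PhaseSpace).withDensity (fun P => ENNReal.ofReal (σ P))
      = (volume : Measure PhaseSpace).withDensity fun P => ENNReal.ofReal ((-σ) P) := by
    refine Measure.ext_of_integral_mul_boundedContinuousFunction fun a f => ?_
    have hw : ∀ {ρ : PhaseSpace → ℝ}, Integrable ρ → ∀ F : PhaseSpace → ℝ,
        ∫ P, F P ∂((volume : Measure PhaseSpace).withDensity fun P => ENNReal.ofReal (ρ P))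
          = ∫ P, max (ρ P) 0 * F P := by
      intro ρ hρ F
      rw [integral_withDensity_eq_integral_toReal_smul₀ hρ.aemeasurable.ennreal_ofReal
        (Eventually.of_forall fun _ => ENNReal.ofReal_lt_top)]
      simp only [ENNReal.toReal_ofReal', smul_eq_mul]
    rw [hw hσ, hw hσ.neg]
    obtain ⟨C, hC⟩ : ∃ C, ∀ P : PhaseSpace, |a P.1 * f P.2| ≤ C := ⟨‖a‖ * ‖f‖, fun P => by
      rw [abs_mul]
      exact mul_le_mul (a.norm_coe_le_norm _) (f.norm_coe_le_norm _) (abs_nonneg _)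
        (norm_nonneg _)⟩
    have hc : Continuous fun P : PhaseSpace => a P.1 * f P.2 := by fun_prop
    have i1 : Integrable fun P : PhaseSpace => max (σ P) 0 * (a P.1 * f P.2) := by
      simp only [mul_comm (max _ _)]
      exact Integrable.continuous_mul_of_abs_le hσ.pos_part hc hC
    have i2 : Integrable fun P : PhaseSpace => max ((-σ) P) 0 * (a P.1 * f P.2) := by
      simp only [mul_comm (max _ _)]
      exact Integrable.continuous_mul_of_abs_le hσ.neg.pos_part hc hC
    refine sub_eq_zero.1 ((integral_sub i1 i2).symm.trans ((integral_congr_ae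
      (Eventually.of_forall fun P => ?_)).trans (hall a f)))
    simp only [Pi.neg_apply]
    rw [← sub_mul, mul_comm]
    congr 1
    rcases le_total (σ P) 0 with h0 | h0
    · rw [max_eq_right h0, max_eq_left (neg_nonneg.2 h0)]; ring
    · rw [max_eq_left h0, max_eq_right (neg_nonpos.2 h0)]; ring
  rw [withDensity_eq_iff hσ.aemeasurable.ennreal_ofReal hσ.neg.aemeasurable.ennreal_ofReal] at heq
  · filter_upwards [heq] with P hP
    simp only [Pi.neg_apply] at hP
    rcases le_total (σ P) 0 with h0 | h0
    · rw [ENNReal.ofReal_of_nonpos h0, eq_comm, ENNReal.ofReal_eq_zero] at hP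
      simp only [Pi.zero_apply]; linarith
    · rw [ENNReal.ofReal_of_nonpos (neg_nonpos.2 h0), ENNReal.ofReal_eq_zero] at hP
      simp only [Pi.zero_apply]; linarith
  · have := measure_lt_top ((volume : Measure PhaseSpace).withDensity
      fun P => ENNReal.ofReal (σ P)) univ
    rw [withDensity_apply _ MeasurableSet.univ, Measure.restrict_univ] at this
    exact this.ne

/-! ### Transport of modes and the Cauchy–Kovalevskaya argument -/

/-- The frequency `ω`, stopped outside of `[-R, R]`. -/
def clipFun (R : ℝ) : BoundedContinuousFunction (ℝ × unitInterval) ℝ :=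
  BoundedContinuousFunction.ofNormedAddCommGroup (fun y => max (-R) (min y.1 R)) (by fun_prop) |R|
    fun y => by
      rw [norm_eq_abs]
      refine abs_le.2 ⟨(neg_le_neg (le_abs_self R)).trans (le_max_left _ _), max_le ?_ ?_⟩
      · exact neg_le_abs R
      · exact (min_le_right _ _).trans (le_abs_self R)

lemma clipFun_apply {R : ℝ} {y : ℝ × unitInterval} (hy : |y.1| ≤ R) : clipFun R y = y.1 := by
  obtain ⟨h1, h2⟩ := abs_le.1 hy
  change max (-R) (min y.1 R) = y.1
  rw [min_eq_left h2, max_eq_right h1]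

lemma norm_clipFun_le (R : ℝ) : ‖clipFun R‖ ≤ |R| :=
  BoundedContinuousFunction.norm_ofNormedAddCommGroup_le _ (abs_nonneg _) _

/-- The components of the mean field at the time `s`, as functions of `(ω, x)`. -/
def fieldFun {B : ℝ} {Z : ℝ → unitInterval → ℝ × ℝ} (hZ : IsMeanField B Z)
    (c : (ℝ × ℝ) →L[ℝ] ℝ) (s : ℝ) : BoundedContinuousFunction (ℝ × unitInterval) ℝ :=
  BoundedContinuousFunction.ofNormedAddCommGroup (fun y => c (Z s y.2))
    (c.continuous.comp (hZ.continuous_uncurry.comp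
      (f := fun y : ℝ × unitInterval => (s, y.2)) (by fun_prop))) (‖c‖ * B)
    fun y => (c.le_opNorm _).trans
      (mul_le_mul_of_nonneg_left (hZ.norm_le s y.2) (norm_nonneg _))

lemma norm_fieldFun_le {B : ℝ} {Z : ℝ → unitInterval → ℝ × ℝ} (hZ : IsMeanField B Z)
    (c : (ℝ × ℝ) →L[ℝ] ℝ) (hc : ‖c‖ ≤ 1) (s : ℝ) : ‖fieldFun hZ c s‖ ≤ B := by
  refine (BoundedContinuousFunction.norm_ofNormedAddCommGroup_le _
    (mul_nonneg (norm_nonneg _) hZ.nonneg) _).trans ?_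
  have := hZ.nonneg
  nlinarith

/-- Continuity holds in the uniform norm over sites, not just at each site: `I` is compact, so a
jointly continuous field is a continuous curve in `C(I, ℝ × ℝ)`. -/
lemma continuous_fieldFun {B : ℝ} {Z : ℝ → unitInterval → ℝ × ℝ} (hZ : IsMeanField B Z)
    (c : (ℝ × ℝ) →L[ℝ] ℝ) : Continuous (fieldFun hZ c) := by
  set z : ℝ → C(unitInterval, ℝ × ℝ) :=
    fun s => ⟨fun x => Z s x, hZ.continuous_uncurry.comp
      (f := fun x : unitInterval => (s, x)) (by fun_prop)⟩ with hz
  have hzc : Continuous z :=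
    ContinuousMap.continuous_of_continuous_uncurry z hZ.continuous_uncurry
  refine continuous_iff_continuousAt.2 fun s₀ => ?_
  rw [ContinuousAt, tendsto_iff_dist_tendsto_zero]
  have hlim : Tendsto (fun s => ‖c‖ * dist (z s) (z s₀)) (𝓝 s₀) (𝓝 (‖c‖ * dist (z s₀) (z s₀))) :=
    Continuous.tendsto (f := fun s => ‖c‖ * dist (z s) (z s₀)) (by fun_prop) s₀
  rw [dist_self, mul_zero] at hlim
  refine squeeze_zero (fun _ => dist_nonneg) (fun s => ?_) hlim
  refine (BoundedContinuousFunction.dist_le (by positivity)).2 fun y => ?_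
  change dist (c (Z s y.2)) (c (Z s₀ y.2)) ≤ _
  rw [dist_eq_norm, ← map_sub]
  refine (c.le_opNorm _).trans (mul_le_mul_of_nonneg_left ?_ (norm_nonneg _))
  rw [← dist_eq_norm]
  exact ContinuousMap.dist_apply_le_dist (f := z s) (g := z s₀) y.2

/-- The derivative of a mode along the flow of the mean field `Z`: a combination of the
neighbouring modes. -/
def modeTransport {B : ℝ} {Z : ℝ → unitInterval → ℝ × ℝ} (hZ : IsMeanField B Z) (R s : ℝ) (k : ℤ)
    (α : ℝ) (h : BoundedContinuousFunction (ℝ × unitInterval) ℝ) :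
    BoundedContinuousFunction PhaseSpace ℝ :=
  (k : ℝ) • (modeFun k (α + π / 2) (clipFun R * h) + (1 / 2 : ℝ) •
    (modeFun (k + 1) (α + π / 2) (fieldFun hZ (ContinuousLinearMap.snd ℝ ℝ ℝ) s * h)
      + modeFun (k - 1) (α + π / 2) (fieldFun hZ (ContinuousLinearMap.snd ℝ ℝ ℝ) s * h)
      + modeFun (k + 1) (α + π / 2 + π / 2) (fieldFun hZ (ContinuousLinearMap.fst ℝ ℝ ℝ) s * h)
      + modeFun (k - 1) (α + π / 2 - π / 2) (fieldFun hZ (ContinuousLinearMap.fst ℝ ℝ ℝ) s * h)))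

/-- The speed has degree one in the phase, so the product formulas turn its product with mode `k`
into the modes `k - 1`, `k`, `k + 1`. Clipping the frequency, which keeps the multiplier bounded,
changes nothing where `h` is nonzero. -/
lemma modeTransport_apply {B : ℝ} {Z : ℝ → unitInterval → ℝ × ℝ} (hZ : IsMeanField B Z) {R : ℝ}
    (s : ℝ) (k : ℤ) (α : ℝ) {h : BoundedContinuousFunction (ℝ × unitInterval) ℝ}
    (hh : VanishesBeyond R h) (P : PhaseSpace) :
    modeTransport hZ R s k α h P
      = k * circMode k (α + π / 2) P.1 * h P.2 * fieldSpeed (Z s P.2.2) P := by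
  obtain ⟨θ, y⟩ := P
  rw [← coe_circRep θ]
  set t := circRep θ
  have hclip : clipFun R y * h y = y.1 * h y := by
    rcases le_or_gt |y.1| R with hy | hy
    · rw [clipFun_apply hy]
    · rw [hh y hy, mul_zero, mul_zero]
  have e : modeTransport hZ R s k α h ((t : Circ), y)
      = k * (cos (k * t + (α + π / 2)) * (clipFun R y * h y) + 1 / 2 *
        (cos ((k + 1 : ℤ) * t + (α + π / 2)) * ((Z s y.2).2 * h y)
        + cos ((k - 1 : ℤ) * t + (α + π / 2)) * ((Z s y.2).2 * h y)
        + cos ((k + 1 : ℤ) * t + (α + π / 2 + π / 2)) * ((Z s y.2).1 * h y)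
        + cos ((k - 1 : ℤ) * t + (α + π / 2 - π / 2)) * ((Z s y.2).1 * h y))) := by
    simp only [← circMode_coe]
    rfl
  rw [e, hclip]
  simp only [fieldSpeed, circMode_coe, circSin_coe, circCos_coe]
  push_cast
  have h1 : ((k : ℝ) + 1) * t + (α + π / 2) = (k * t + (α + π / 2)) + t := by ring
  have h2 : ((k : ℝ) - 1) * t + (α + π / 2) = (k * t + (α + π / 2)) - t := by ring
  have h3 : ((k : ℝ) + 1) * t + (α + π / 2 + π / 2)
      = (k * t + (α + π / 2)) + (t + π / 2) := by ring
  have h4 : ((k : ℝ) - 1) * t + (α + π / 2 - π / 2)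
      = (k * t + (α + π / 2)) - (t + π / 2) := by ring
  rw [h1, h2, h3, h4, cos_add _ t, cos_sub _ t, cos_add _ (t + π / 2), cos_sub _ (t + π / 2),
    cos_add_pi_div_two t]
  ring

lemma modeTransport_sub {B : ℝ} {Z : ℝ → unitInterval → ℝ × ℝ} (hZ : IsMeanField B Z) (R s : ℝ)
    (k : ℤ) (α : ℝ) (h h' : BoundedContinuousFunction (ℝ × unitInterval) ℝ) :
    modeTransport hZ R s k α (h - h')
      = modeTransport hZ R s k α h - modeTransport hZ R s k α h' := by
  simp only [modeTransport, mul_sub, modeFun_sub]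
  module

lemma continuous_modeFun (k : ℤ) (α : ℝ) : Continuous (modeFun k α) := by
  refine LipschitzWith.continuous (K := 1) (LipschitzWith.of_dist_le_mul fun h h' => ?_)
  rw [dist_eq_norm, dist_eq_norm, ← modeFun_sub, NNReal.coe_one, one_mul]
  exact norm_modeFun_le _ _ _

lemma continuous_modeTransport {B : ℝ} {Z : ℝ → unitInterval → ℝ × ℝ} (hZ : IsMeanField B Z)
    (R : ℝ) (k : ℤ) (α : ℝ) (h : BoundedContinuousFunction (ℝ × unitInterval) ℝ) :
    Continuous fun s => modeTransport hZ R s k α h := by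
  have h1 := continuous_fieldFun hZ (ContinuousLinearMap.fst ℝ ℝ ℝ)
  have h2 := continuous_fieldFun hZ (ContinuousLinearMap.snd ℝ ℝ ℝ)
  have hm := fun k α => continuous_modeFun k α
  unfold modeTransport
  fun_prop

/-- If a functional is small at the modes next to `k`, it is small at the derivative of the mode
`k` along the flow. -/
lemma abs_modeTransport_le {B : ℝ} {Z : ℝ → unitInterval → ℝ × ℝ} (hZ : IsMeanField B Z) {R : ℝ}
    (s : ℝ) {k : ℤ} {m : ℕ} (hk : |k| ≤ m) (α : ℝ)
    {h : BoundedContinuousFunction (ℝ × unitInterval) ℝ} (hh : VanishesBeyond R h)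
    {Λ : BoundedContinuousFunction PhaseSpace ℝ →L[ℝ] ℝ} {b : ℝ} (hb : 0 ≤ b)
    (hΛ : ∀ k' : ℤ, |k'| ≤ (m + 1 : ℕ) → ∀ α' h', VanishesBeyond R h' →
      |Λ (modeFun k' α' h')| ≤ b * ‖h'‖) :
    |Λ (modeTransport hZ R s k α h)| ≤ m * (b * ((|R| + 2 * B) * ‖h‖)) := by
  have hB := hZ.nonneg
  have hk1 : |k| ≤ (m + 1 : ℕ) := hk.trans (by push_cast; linarith)
  have hk2 : |k + 1| ≤ (m + 1 : ℕ) := (abs_add_le _ _).trans (by push_cast; rw [abs_one]; linarith)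
  have hk3 : |k - 1| ≤ (m + 1 : ℕ) := (abs_sub _ _).trans (by push_cast; rw [abs_one]; linarith)
  have hprod : ∀ (k' : ℤ), |k'| ≤ (m + 1 : ℕ) → ∀ α' f C, ‖f‖ ≤ C →
      |Λ (modeFun k' α' (f * h))| ≤ b * (C * ‖h‖) := by
    intro k' hk' α' f C hf
    refine (hΛ k' hk' α' _ (hh.mul_left f)).trans (mul_le_mul_of_nonneg_left ?_ hb)
    exact (norm_mul_le _ _).trans (mul_le_mul_of_nonneg_right hf (norm_nonneg _))
  have hs := norm_fieldFun_le hZ (ContinuousLinearMap.snd ℝ ℝ ℝ)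
    (ContinuousLinearMap.norm_snd_le ..) s
  have hf := norm_fieldFun_le hZ (ContinuousLinearMap.fst ℝ ℝ ℝ)
    (ContinuousLinearMap.norm_fst_le ..) s
  have e0 := hprod k hk1 (α + π / 2) _ _ (norm_clipFun_le R)
  have e1 := hprod (k + 1) hk2 (α + π / 2) _ _ hs
  have e2 := hprod (k - 1) hk3 (α + π / 2) _ _ hs
  have e3 := hprod (k + 1) hk2 (α + π / 2 + π / 2) _ _ hf
  have e4 := hprod (k - 1) hk3 (α + π / 2 - π / 2) _ _ hf
  have hkm : |(k : ℝ)| ≤ m := by exact_mod_cast hk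
  -- The frequency term contributes `|R|`; the four field terms contribute `B` each, with weight `1
  -- / 2`, hence `2 * B`.
  rw [modeTransport, map_smul, smul_eq_mul, abs_mul]
  refine mul_le_mul hkm ?_ (abs_nonneg _) m.cast_nonneg
  simp only [map_add, map_smul, smul_eq_mul]
  rw [abs_le] at *
  constructor <;> nlinarith

/-- The quotient is the binomial coefficient of `n + m` over `m`, of polynomial growth in `n`. -/
lemma tendsto_ascFactorial_mul_pow (m : ℕ) {r : ℝ} (h0 : 0 ≤ r) (h1 : r < 1) :
    Tendsto (fun n : ℕ => ((m + 1).ascFactorial n : ℝ) / n.factorial * r ^ n) atTop (𝓝 0) := by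
  have := (summable_choose_mul_geometric_of_norm_lt_one m (r := r)
    (by rwa [norm_eq_abs, abs_of_nonneg h0])).tendsto_atTop_zero
  refine this.congr fun n => ?_
  rw [Nat.ascFactorial_eq_factorial_mul_choose, Nat.cast_mul,
    mul_div_cancel_left₀ _ (by exact_mod_cast n.factorial_ne_zero), Nat.add_comm n m,
    Nat.choose_symm_add]

/-- A Cauchy–Kovalevskaya argument: the equation for the modes has no nonzero solution. -/
lemma modes_eq_zero {B : ℝ} {Z : ℝ → unitInterval → ℝ × ℝ} (hZ : IsMeanField B Z) {R T C : ℝ}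
    {Λ : ℝ → BoundedContinuousFunction PhaseSpace ℝ →L[ℝ] ℝ}
    (hC : ∀ t ∈ Icc 0 T, ‖Λ t‖ ≤ C)
    (heq : ∀ t ∈ Icc 0 T, ∀ k α h, VanishesBeyond R h →
      Λ t (modeFun k α h) = ∫ s in (0 : ℝ)..t, Λ s (modeTransport hZ R s k α h)) :
    ∀ t ∈ Icc 0 T, ∀ k α h, VanishesBeyond R h → Λ t (modeFun k α h) = 0 := by
  set M := |R| + 2 * B with hM
  have hB := hZ.nonneg
  have hM0 : 0 ≤ M := by positivity
  have local_vanish : ∀ a, 0 ≤ a → (∀ t ∈ Icc 0 T, t ≤ a → ∀ k α h, VanishesBeyond R h →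
      Λ t (modeFun k α h) = 0) → ∀ t ∈ Icc 0 T, a ≤ t → M * (t - a) < 1 → ∀ k α h,
      VanishesBeyond R h → Λ t (modeFun k α h) = 0 := by
    intro a ha hzero
    -- Each iteration of the integrated equation costs a factor `m` and widens the range of modes to
    -- `m + 1`, so `n` of them give `m (m + 1) ⋯ (m + n - 1)`. The `n` nested time integrals supply
    -- the compensating `1 / n!`.
    have bound : ∀ n : ℕ, ∀ m : ℕ, ∀ t ∈ Icc 0 T, a ≤ t → ∀ k : ℤ, |k| ≤ m → ∀ α h,
        VanishesBeyond R h → |Λ t (modeFun k α h)| ≤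
          C * (m.ascFactorial n / n.factorial * (M * (t - a)) ^ n) * ‖h‖ := by
      intro n
      induction n with
      | zero =>
        intro m t ht hat k hk α h hh
        simp only [Nat.ascFactorial_zero, Nat.cast_one, Nat.factorial_zero, div_one, pow_zero,
          mul_one]
        exact ((Λ t).le_opNorm _).trans (mul_le_mul (hC t ht) (norm_modeFun_le _ _ _)
          (norm_nonneg _) ((norm_nonneg (Λ t)).trans (hC t ht)))
      | succ n ih =>
        intro m t ht hat k hk α h hh
        have hC0 : 0 ≤ C := (norm_nonneg (Λ t)).trans (hC t ht)
        set f : ℝ → ℝ := fun s => Λ s (modeTransport hZ R s k α h) with hf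
        set c : ℝ := m * (C * ((m + 1).ascFactorial n / n.factorial)) * (M * ‖h‖) * M ^ n with hc
        have hf0 : ∀ s ∈ Ioc 0 t, s ≤ a → f s = 0 := by
          intro s hs hsa
          have hs' : s ∈ Icc 0 T := ⟨hs.1.le, hs.2.trans ht.2⟩
          have := abs_modeTransport_le hZ s hk α hh (Λ := Λ s) (le_refl (0 : ℝ))
            (fun k' _ α' h' hh' => by rw [hzero s hs' hsa k' α' h' hh', abs_zero, zero_mul])
          rw [zero_mul, mul_zero] at this
          exact abs_nonpos_iff.1 this
        have hfb : ∀ s ∈ Ioc a t, |f s| ≤ c * (s - a) ^ n := by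
          intro s hs
          have hs' : s ∈ Icc 0 T := ⟨ha.trans hs.1.le, hs.2.trans ht.2⟩
          have hsa : 0 ≤ s - a := by linarith [hs.1]
          refine (abs_modeTransport_le hZ s hk α hh (Λ := Λ s)
            (b := C * ((m + 1).ascFactorial n / n.factorial * (M * (s - a)) ^ n))
            (by positivity) fun k' hk' α' h' hh' => ih (m + 1) s hs' hs.1.le k' hk' α' h' hh').trans
            (le_of_eq ?_)
          rw [hc, mul_pow]; ring
        have hbig : |∫ s in (0 : ℝ)..t, f s| ≤ ∫ s in a..t, c * (s - a) ^ n := by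
          have hg : ContinuousOn (fun s : ℝ => c * (s - a) ^ n) (uIcc a t) := by fun_prop
          have hgi : IntervalIntegrable (fun s : ℝ => c * (s - a) ^ n) volume a t :=
            hg.intervalIntegrable
          have hset : ∫ s in (0 : ℝ)..t, f s = ∫ s in Ioc a t, f s := by
            rw [intervalIntegral.integral_of_le ht.1]
            refine setIntegral_eq_of_subset_of_forall_sdiff_eq_zero measurableSet_Ioc
              (Ioc_subset_Ioc_left ha) fun s hs => hf0 s hs.1 ?_
            by_contra hcon
            exact hs.2 ⟨not_le.1 hcon, hs.1.2⟩
          rw [hset, ← intervalIntegral.integral_of_le hat]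
          exact intervalIntegral.norm_integral_le_of_norm_le (f := f) hat
            (Eventually.of_forall fun s hs => hfb s hs) hgi
        have hval : ∫ s in a..t, c * (s - a) ^ n = c * ((t - a) ^ (n + 1) / (n + 1)) := by
          rw [intervalIntegral.integral_const_mul,
            intervalIntegral.integral_comp_sub_right (fun s => s ^ n) a, integral_pow]
          simp
        rw [heq t ht k α h hh]
        refine hbig.trans (hval.trans_le (le_of_eq ?_))
        have hasc : (m.ascFactorial (n + 1) : ℝ) = m * (m + 1).ascFactorial n := by
          rw [Nat.ascFactorial_succ]
          exact_mod_cast (Nat.succ_ascFactorial m n).symm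
        rw [hasc, hc, Nat.factorial_succ]
        push_cast
        have h1 : ((n : ℝ) + 1) ≠ 0 := by positivity
        have h2 : (n.factorial : ℝ) ≠ 0 := by exact_mod_cast n.factorial_ne_zero
        rw [mul_pow M]
        field_simp
        ring
    intro t ht hat hlt k α h hh
    have hb : ∀ n : ℕ, |Λ t (modeFun k α h)| ≤ C * (((k.natAbs + 1).ascFactorial n : ℝ)
        / n.factorial * (M * (t - a)) ^ n) * ‖h‖ := fun n =>
      -- Any bound on `|k|` is allowed; one more than `|k|` makes the rising factorial the one whose
      -- limit is known.
      bound n (k.natAbs + 1) t ht hat k (by push_cast; linarith) α h hh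
    have hlim := ((tendsto_ascFactorial_mul_pow k.natAbs
      (mul_nonneg hM0 (sub_nonneg.2 hat)) hlt).const_mul C).mul_const ‖h‖
    rw [mul_zero, zero_mul] at hlim
    exact abs_nonpos_iff.1 (ge_of_tendsto' hlim hb)
  -- The step depends only on `M`, so finitely many steps cover `[0, T]`; `M + 1` keeps it
  -- meaningful when `M = 0`.
  set δ : ℝ := 1 / (2 * (M + 1)) with hδ
  have hδ0 : 0 < δ := by positivity
  have hMδ : M * δ < 1 := by
    rw [hδ, mul_one_div, div_lt_one (by positivity)]; linarith
  have steps : ∀ j : ℕ, ∀ t ∈ Icc 0 T, t ≤ j * δ → ∀ k α h, VanishesBeyond R h →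
      Λ t (modeFun k α h) = 0 := by
    intro j
    induction j with
    | zero =>
      intro t ht htj k α h hh
      have : t = 0 := le_antisymm (by simpa using htj) ht.1
      rw [heq t ht k α h hh, this, intervalIntegral.integral_same]
    | succ j ih =>
      intro t ht htj k α h hh
      rcases le_total t (j * δ) with hle | hle
      · exact ih t ht hle k α h hh
      · refine local_vanish (j * δ) (by positivity) ih t ht hle ?_ k α h hh
        push_cast at htj
        refine lt_of_le_of_lt (mul_le_mul_of_nonneg_left ?_ hM0) hMδ
        linarith
  intro t ht
  obtain ⟨j, hj⟩ := exists_nat_ge (t / δ)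
  exact steps j t ht ((div_le_iff₀ hδ0).1 hj)

/-! ### Densities as functionals, and the mode equation for transported densities -/

/-- Integration against an integrable density. -/
def densityFunctional (σ : PhaseSpace → ℝ) (hσ : Integrable σ) :
    BoundedContinuousFunction PhaseSpace ℝ →L[ℝ] ℝ :=
  LinearMap.mkContinuous
    { toFun := fun f => ∫ P, f P * σ P
      map_add' := fun f g => by
        simp only [BoundedContinuousFunction.add_apply, add_mul]
        exact integral_add (Integrable.bddCont_mul hσ f) (Integrable.bddCont_mul hσ g)
      map_smul' := fun a f => by
        simp only [BoundedContinuousFunction.smul_apply, smul_eq_mul, mul_assoc, RingHom.id_apply]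
        exact integral_const_mul _ _ }
    (∫ P, |σ P|) fun f => by
      refine (norm_integral_le_of_norm_le (hσ.abs.const_mul ‖f‖)
        (Eventually.of_forall fun P => ?_)).trans
        (le_of_eq ?_)
      · rw [norm_mul]
        exact mul_le_mul_of_nonneg_right (f.norm_coe_le_norm P) (norm_nonneg _)
      · rw [integral_const_mul, mul_comm]

lemma densityFunctional_apply {σ : PhaseSpace → ℝ} (hσ : Integrable σ)
    (f : BoundedContinuousFunction PhaseSpace ℝ) :
    densityFunctional σ hσ f = ∫ P, f P * σ P := rfl

/-- A uniform norm bound upgrades weak continuity of the functionals to continuity along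
norm-continuous curves of arguments. It makes the integrands of the mode equation continuous in
time. -/
lemma continuous_functional_apply {E : Type*} [NormedAddCommGroup E] [NormedSpace ℝ E]
    {Λ : ℝ → E →L[ℝ] ℝ} {M : ℝ} (hM : ∀ t, ‖Λ t‖ ≤ M) (hc : ∀ f, Continuous fun t => Λ t f)
    {ψ : ℝ → E} (hψ : Continuous ψ) : Continuous fun t => Λ t (ψ t) := by
  refine continuous_iff_continuousAt.2 fun s => ?_
  rw [ContinuousAt, tendsto_iff_dist_tendsto_zero]
  have hlim : Tendsto (fun t => M * ‖ψ t - ψ s‖ + |Λ t (ψ s) - Λ s (ψ s)|) (𝓝 s)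
      (𝓝 (M * ‖ψ s - ψ s‖ + |Λ s (ψ s) - Λ s (ψ s)|)) := by
    have := hc (ψ s)
    exact Continuous.tendsto (f := fun t => M * ‖ψ t - ψ s‖ + |Λ t (ψ s) - Λ s (ψ s)|)
      (by fun_prop) s
  simp only [sub_self, norm_zero, mul_zero, abs_zero, add_zero] at hlim
  refine squeeze_zero (fun _ => dist_nonneg) (fun t => ?_) hlim
  rw [Real.dist_eq]
  refine (abs_sub_le _ (Λ t (ψ s)) _).trans (add_le_add ?_ le_rfl)
  rw [← map_sub]
  exact ((Λ t).le_opNorm _).trans (mul_le_mul_of_nonneg_right (hM t) (norm_nonneg _))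

section FlowFunctional

variable {B : ℝ} {Z : ℝ → unitInterval → ℝ × ℝ} {r : PhaseSpace → ℝ}

lemma integrable_flowDensity (hZ : IsMeanField B Z) (hr : Continuous r) (hr0 : ∀ P, 0 ≤ r P)
    [IsProbabilityMeasure (densityMeasure r)] (t : ℝ) : Integrable (flowDensity Z r t) := by
  have hm := measurable_flowDensity hZ hr t
  have : IsProbabilityMeasure (densityMeasure (flowDensity Z r t)) := by
    rw [densityMeasure_flowDensity hZ hr hr0]
    exact isProbabilityMeasure_map_flowMap hZ _ _ _
  exact integrable_of_isFiniteMeasure_densityMeasure hm (flowDensity_nonneg Z hr0 t)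

lemma integral_mul_flowDensity (hZ : IsMeanField B Z) (hr : Continuous r) (hr0 : ∀ P, 0 ≤ r P)
    [IsProbabilityMeasure (densityMeasure r)] (t : ℝ) (f : PhaseSpace → ℝ) :
    ∫ P, f P * flowDensity Z r t P = ∫ P, f P ∂((densityMeasure r).map (flowMap Z 0 t)) := by
  have hm := measurable_flowDensity hZ hr t
  rw [← densityMeasure_flowDensity hZ hr hr0,
    integral_densityMeasure hm (flowDensity_nonneg Z hr0 t)]
  simp only [mul_comm]

lemma hasDerivAt_modeFun_flowMap (hZ : IsMeanField B Z) {R : ℝ} (k : ℤ) (α : ℝ)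
    {h : BoundedContinuousFunction (ℝ × unitInterval) ℝ} (hh : VanishesBeyond R h)
    (P : PhaseSpace) (t : ℝ) :
    HasDerivAt (fun t => modeFun k α h (flowMap Z 0 t P))
      (modeTransport hZ R t k α h (flowMap Z 0 t P)) t := by
  obtain ⟨θ, ω, x⟩ := P
  rw [modeTransport_apply hZ t k α hh, ← coe_circRep θ]
  simp only [flowMap_coe hZ, modeFun_apply, circMode_coe, fieldSpeed_coe]
  have h1 := (((isPhaseCurve_phaseFlow hZ 0 (circRep θ) ω x t).const_mul (k : ℝ)).add_const
    α).cos.mul_const (h (ω, x))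
  refine h1.congr_deriv ?_
  rw [← add_assoc, cos_add_pi_div_two]
  ring

lemma continuous_modeTransport_flowMap (hZ : IsMeanField B Z) {R : ℝ} (k : ℤ) (α : ℝ)
    {h : BoundedContinuousFunction (ℝ × unitInterval) ℝ} (hh : VanishesBeyond R h) :
    Continuous fun q : ℝ × PhaseSpace =>
      modeTransport hZ R q.1 k α h (flowMap Z 0 q.1 q.2) := by
  have hpt : ∀ s P, modeTransport hZ R s k α h P
      = k * circMode k (α + π / 2) P.1 * h P.2 * fieldSpeed (Z s P.2.2) P := fun s P =>
    modeTransport_apply hZ s k α hh P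
  have h1 : Continuous fun q : ℝ × PhaseSpace => (q.1, flowMap Z 0 q.1 q.2) :=
    continuous_fst.prodMk ((continuous_flowMap hZ).comp
      (f := fun q : ℝ × PhaseSpace => ((0, q.1), q.2)) (by fun_prop))
  have h2 : Continuous fun q : ℝ × PhaseSpace => modeTransport hZ R q.1 k α h q.2 := by
    simp only [hpt]
    have h3 : Continuous fun q : ℝ × PhaseSpace => q.2.1 := by fun_prop
    have h4 : Continuous fun q : ℝ × PhaseSpace => q.2.2 := by fun_prop
    exact ((continuous_const.mul ((continuous_circMode k _).comp h3)).mul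
      (h.continuous.comp h4)).mul (continuous_fieldSpeed hZ)
  exact Continuous.comp (g := fun q : ℝ × PhaseSpace => modeTransport hZ R q.1 k α h q.2)
    (f := fun q : ℝ × PhaseSpace => (q.1, flowMap Z 0 q.1 q.2)) h2 h1

/-- The equation for the modes of the image of a density under the flow. -/
lemma flowDensity_mode_eq (hZ : IsMeanField B Z) (hr : Continuous r) (hr0 : ∀ P, 0 ≤ r P)
    [IsProbabilityMeasure (densityMeasure r)] {R : ℝ} {t : ℝ} (ht : 0 ≤ t) (k : ℤ) (α : ℝ)
    {h : BoundedContinuousFunction (ℝ × unitInterval) ℝ} (hh : VanishesBeyond R h) :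
    densityFunctional _ (integrable_flowDensity hZ hr hr0 t) (modeFun k α h)
      = (∫ P, modeFun k α h P * r P) + ∫ s in (0 : ℝ)..t,
        densityFunctional _ (integrable_flowDensity hZ hr hr0 s) (modeTransport hZ R s k α h) := by
  have hΦ := fun t => continuous_flowMap_apply hZ 0 t
  have hmap : ∀ (f : BoundedContinuousFunction PhaseSpace ℝ) s,
      densityFunctional _ (integrable_flowDensity hZ hr hr0 s) f
        = ∫ P, f (flowMap Z 0 s P) ∂(densityMeasure r) := fun f s => by
    rw [densityFunctional_apply, integral_mul_flowDensity hZ hr hr0,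
      integral_map (hΦ s).aemeasurable f.continuous.aestronglyMeasurable]
  obtain ⟨C, hC⟩ : ∃ C, ∀ s ∈ Icc 0 t, ‖modeTransport hZ R s k α h‖ ≤ C :=
    isCompact_Icc.exists_bound_of_continuousOn (continuous_modeTransport hZ R k α h).continuousOn
  have hb : ∀ s ∈ Icc 0 t, ∀ P, |modeTransport hZ R s k α h (flowMap Z 0 s P)| ≤ C :=
    fun s hs P => ((modeTransport hZ R s k α h).norm_coe_le_norm _).trans (hC s hs)
  have hi : ∀ s, Integrable (fun P => modeFun k α h (flowMap Z 0 s P)) (densityMeasure r) :=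
    fun s => integrable_of_continuous_of_abs_le ((modeFun k α h).continuous.comp (hΦ s))
      fun P => (modeFun k α h).norm_coe_le_norm _
  have hd : ∀ t P, HasDerivAt (fun t => modeFun k α h (flowMap Z 0 t P))
      (modeTransport hZ R t k α h (flowMap Z 0 t P)) t := fun t P =>
    hasDerivAt_modeFun_flowMap hZ k α hh P t
  have hcont := continuous_modeTransport_flowMap hZ (R := R) k α hh
  have key := integral_sub_integral_eq (μ := densityMeasure r) hd hcont ht hb (hi 0) (hi t)
  simp only [hmap]
  rw [← key]
  have h0 : ∫ P, modeFun k α h (flowMap Z 0 0 P) ∂(densityMeasure r)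
      = ∫ P, modeFun k α h P * r P := by
    simp only [flowMap_self hZ]
    rw [integral_densityMeasure hr.measurable hr0]
    simp only [mul_comm]
  rw [← h0]
  ring

end FlowFunctional

/-! ### Weak solutions are transported by their own mean field -/

section WeakSolution

variable {W : unitInterval → unitInterval → ℝ} {A K T : ℝ} {r : PhaseSpace → ℝ}
  {ρ : ℝ → PhaseSpace → ℝ}

/-- The functional of a weak solution, with the time stopped outside of `[0, T]`. -/
def IsWeakSolution.functional (hρ : IsWeakSolution W K T r ρ) (hT : 0 ≤ T) (t : ℝ) :
    BoundedContinuousFunction PhaseSpace ℝ →L[ℝ] ℝ :=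
  densityFunctional (ρ (max 0 (min t T))) (hρ.integrable _ (clamp_mem_Icc hT t))

lemma IsWeakSolution.continuous_functional (hρ : IsWeakSolution W K T r ρ) (hT : 0 ≤ T)
    (f : BoundedContinuousFunction PhaseSpace ℝ) :
    Continuous fun t => hρ.functional hT t f :=
  (hρ.weak_continuous f).comp_continuous (f := fun t : ℝ => max 0 (min t T)) (by fun_prop)
    fun t => clamp_mem_Icc hT t

/-- The definition bounds no norm uniformly in time. For each test function weak continuity on a
compact interval gives a bound, and the uniform boundedness principle does the rest. -/
lemma IsWeakSolution.exists_norm_functional_le (hρ : IsWeakSolution W K T r ρ) (hT : 0 ≤ T) :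
    ∃ M, ∀ t, ‖hρ.functional hT t‖ ≤ M := by
  refine banach_steinhaus fun f => ?_
  obtain ⟨C, hC⟩ := isCompact_Icc.exists_bound_of_continuousOn (hρ.weak_continuous f)
  exact ⟨C, fun t => hC _ (clamp_mem_Icc hT t)⟩

/-- An observable that is bounded by `a`, as a bounded continuous function. -/
def IsObservable.toBCF {a : ℝ} {f : PhaseSpace → ℝ} (hf : IsObservable a f) :
    BoundedContinuousFunction PhaseSpace ℝ :=
  BoundedContinuousFunction.ofNormedAddCommGroup f hf.continuous a hf.abs_le

lemma IsObservable.norm_toBCF_le {a : ℝ} {f : PhaseSpace → ℝ} (hf : IsObservable a f) :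
    ‖hf.toBCF‖ ≤ a :=
  BoundedContinuousFunction.norm_ofNormedAddCommGroup_le _ hf.nonneg _

/-- The mean field of a weak solution, with the time stopped outside of `[0, T]`. -/
def solutionField (W : unitInterval → unitInterval → ℝ) (K T : ℝ) (ρ : ℝ → PhaseSpace → ℝ) (t : ℝ)
    (x : unitInterval) : ℝ × ℝ :=
  densityField W K (ρ (max 0 (min t T))) x

lemma solutionField_of_mem_Icc (W : unitInterval → unitInterval → ℝ) (K : ℝ)
    (ρ : ℝ → PhaseSpace → ℝ) {t : ℝ} (ht : t ∈ Icc 0 T) (x : unitInterval) :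
    solutionField W K T ρ t x = densityField W K (ρ t) x := by
  rw [solutionField, clamp_of_mem_Icc ht]

/-- With the functionals uniformly bounded, the field inherits the bound and the Lipschitz condition
of `W`, and weak continuity gives continuity in time. So the flow of this field exists, although
nothing is known yet about the sign of the density. -/
lemma IsWeakSolution.isMeanField (hρ : IsWeakSolution W K T r ρ) (hT : 0 ≤ T)
    (hW : IsGraphonBound A W) {M : ℝ} (hM : ∀ t, ‖hρ.functional hT t‖ ≤ M) :
    IsMeanField (|K| * (M * A)) (solutionField W K T ρ) := by
  have hM0 : 0 ≤ M := (norm_nonneg (hρ.functional hT 0)).trans (hM 0)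
  have hcb : ∀ x, IsObservable A fun Q : PhaseSpace => W x Q.2.2 * circCos Q.1 :=
    isObservable_cos hW
  have hsb : ∀ x, IsObservable A fun Q : PhaseSpace => W x Q.2.2 * circSin Q.1 :=
    isObservable_sin hW
  have hval : ∀ t x, solutionField W K T ρ t x = (K * hρ.functional hT t (hcb x).toBCF,
      K * hρ.functional hT t (hsb x).toBCF) := fun t x => rfl
  have hsub : ∀ c : Circ → ℝ, (∀ θ, |c θ| ≤ 1) →
      ∀ (ho : ∀ x, IsObservable A fun Q : PhaseSpace => W x Q.2.2 * c Q.1) x y,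
      ‖(ho x).toBCF - (ho y).toBCF‖ ≤ A * |(x : ℝ) - y| := by
    intro c hc ho x y
    refine (BoundedContinuousFunction.norm_le
      (mul_nonneg (ho x).nonneg (abs_nonneg _))).2 fun Q => ?_
    change |W x Q.2.2 * c Q.1 - W y Q.2.2 * c Q.1| ≤ _
    rw [← sub_mul, abs_mul]
    have h := hW.lipschitz x Q.2.2 y Q.2.2
    rw [sub_self, abs_zero, add_zero] at h
    exact (mul_le_mul h (hc _) (abs_nonneg _) ((abs_nonneg _).trans h)).trans (mul_one _).le
  refine ⟨fun x => ?_, fun t x => ?_, fun t x y => ?_⟩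
  · simp only [hval]
    exact (continuous_const.mul (hρ.continuous_functional hT _)).prodMk
      (continuous_const.mul (hρ.continuous_functional hT _))
  · have key : ∀ {f} (hf : IsObservable A f), |K * hρ.functional hT t hf.toBCF|
      ≤ |K| * (M * A) := by
      intro f hf
      rw [abs_mul]
      exact mul_le_mul_of_nonneg_left (((hρ.functional hT t).le_opNorm _).trans
        (mul_le_mul (hM t) hf.norm_toBCF_le (norm_nonneg _) hM0)) (abs_nonneg K)
    rw [hval]
    exact norm_prod_le_iff.2 ⟨key (hcb x), key (hsb x)⟩
  · have key : ∀ c : Circ → ℝ, (∀ θ, |c θ| ≤ 1) →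
        ∀ (ho : ∀ x, IsObservable A fun Q : PhaseSpace => W x Q.2.2 * c Q.1),
        |K * hρ.functional hT t (ho x).toBCF - K * hρ.functional hT t (ho y).toBCF|
          ≤ |K| * (M * A) * |(x : ℝ) - y| := by
      intro c hc ho
      rw [← mul_sub, ← map_sub, abs_mul, mul_assoc, mul_assoc]
      exact mul_le_mul_of_nonneg_left (((hρ.functional hT t).le_opNorm _).trans
        (mul_le_mul (hM t) (hsub c hc ho x y) (norm_nonneg _) hM0)) (abs_nonneg K)
    rw [hval, hval]
    exact norm_prod_le_iff.2 ⟨key circCos abs_circCos_le_one hcb,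
      key circSin abs_circSin_le_one hsb⟩

lemma derivTheta_mode (c : ℝ) (k : ℤ) (α : ℝ) (h : BoundedContinuousFunction (ℝ × unitInterval) ℝ)
    (P : PhaseSpace) : derivTheta (fun P => c * modeFun k α h P) P
      = c * (k * circMode k (α + π / 2) P.1 * h P.2) := by
  obtain ⟨θ, y⟩ := P
  rw [← coe_circRep θ]
  set t := circRep θ
  simp only [derivTheta, modeFun_apply, ← AddCircle.coe_add, circMode_coe]
  have h1 := (((((hasDerivAt_id (0 : ℝ)).const_add t).const_mul (k : ℝ)).add_const
    α).cos.mul_const (h y)).const_mul c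
  simp only [id_eq] at h1
  rw [h1.deriv, ← add_assoc, cos_add_pi_div_two, add_zero]
  ring

/-- The equation for the smooth modes of a weak solution. -/
lemma IsWeakSolution.mode_eq_of_contDiff (hρ : IsWeakSolution W K T r ρ) (hT : 0 < T)
    (hW : IsGraphonBound A W) {B : ℝ} (hZ : IsMeanField B (solutionField W K T ρ)) {M : ℝ}
    (hM : ∀ t, ‖hρ.functional hT.le t‖ ≤ M) {R : ℝ} (k : ℤ)
    (α : ℝ) {h : BoundedContinuousFunction (ℝ × unitInterval) ℝ} (hh : VanishesBeyond R h)
    {G : ℝ × ℝ → ℝ} (hG : ContDiff ℝ (⊤ : ℕ∞) G)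
    (hGh : ∀ ω (x : unitInterval), h (ω, x) = G (ω, x)) :
    ∀ t ∈ Icc 0 T, hρ.functional hT.le t (modeFun k α h) = (∫ P, modeFun k α h P * r P)
      + ∫ s in (0 : ℝ)..t, hρ.functional hT.le s (modeTransport hZ R s k α h) := by
  refine eq_add_integral_of_weak_derivative hT (hρ.continuous_functional hT.le _)
    (continuous_functional_apply hM (hρ.continuous_functional hT.le)
      (continuous_modeTransport hZ R k α h)) fun χ hχ hχτ => ?_
  obtain ⟨τ, hτ, hχ0⟩ := hχτ
  -- The radius is `R + 1` because test functions must vanish already for `|ω|` equal to the radius,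
  -- whereas `h` vanishes only strictly beyond `R`.
  have htest : IsTestFunction T fun t P => χ t * modeFun k α h P := by
    refine ⟨⟨fun q => χ q.1 * (cos (k * q.2.1 + α) * G q.2.2), ?_, fun t θ ω x => ?_⟩,
      τ, hτ, R + 1, fun t θ ω x htx => ?_⟩
    · exact (hχ.comp contDiff_fst).mul (((contDiff_cos.of_le le_top).comp
        ((contDiff_const.mul (contDiff_fst.comp contDiff_snd)).add contDiff_const)).mul
        (hG.comp (contDiff_snd.comp contDiff_snd)))
    · simp only [modeFun_apply, circMode_coe, hGh]
    · rcases htx with htx | htx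
      · simp only [hχ0 t htx, zero_mul]
      · have : h (ω, x) = 0 := hh (ω, x) (by simp only; linarith)
        simp only [modeFun_apply, this, mul_zero]
  have hweak := hρ.weak_eq _ htest
  have e0 : ∫ P, r P * (χ 0 * modeFun k α h P) = (∫ P, modeFun k α h P * r P) * χ 0 := by
    rw [← integral_mul_const]
    refine integral_congr_ae (Eventually.of_forall fun P => ?_)
    simp only
    ring
  rw [e0] at hweak
  refine Eq.trans ?_ hweak
  congr 1
  refine intervalIntegral.integral_congr fun t ht => ?_
  rw [uIcc_of_le hT.le] at ht
  have hint := hρ.integrable t ht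
  simp only [IsWeakSolution.functional, densityFunctional_apply, clamp_of_mem_Icc ht]
  rw [mul_comm, mul_comm _ (χ t), ← integral_const_mul, ← integral_const_mul, ← integral_add
    ((Integrable.bddCont_mul hint _).const_mul _) ((Integrable.bddCont_mul hint _).const_mul _)]
  refine integral_congr_ae (Eventually.of_forall fun P => ?_)
  have hd : deriv (fun s => χ s * modeFun k α h P) t = deriv χ t * modeFun k α h P :=
    ((hχ.differentiable (by simp) t).hasDerivAt.mul_const _).deriv
  simp only
  rw [hd, derivTheta_mode, modeTransport_apply hZ t k α hh, velocity_eq_fieldSpeed hW K hint,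
    ← solutionField_of_mem_Icc W K ρ ht]
  ring

/-- The function is extended to the plane by projecting the second coordinate to `I`. The smooth
approximation is supported where the extension is nonzero, so it still vanishes beyond `R`. -/
lemma exists_contDiff_approx_of_vanishesBeyond {R : ℝ}
    {h : BoundedContinuousFunction (ℝ × unitInterval) ℝ} (hh : VanishesBeyond R h) {ε : ℝ}
    (hε : 0 < ε) : ∃ h' : BoundedContinuousFunction (ℝ × unitInterval) ℝ, VanishesBeyond R h' ∧
      ‖h - h'‖ ≤ ε ∧ ∃ G : ℝ × ℝ → ℝ, ContDiff ℝ (⊤ : ℕ∞) G ∧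
        ∀ ω (x : unitInterval), h' (ω, x) = G (ω, x) := by
  set f : ℝ × ℝ → ℝ := fun y => h (y.1, projIcc 0 1 zero_le_one y.2) with hf
  have hfc : Continuous f := h.continuous.comp
    (continuous_fst.prodMk (continuous_projIcc.comp continuous_snd))
  obtain ⟨G, hG, hGf, hGs⟩ := hfc.exists_contDiff_approx ⊤ (ε := fun _ => ε) continuous_const
    fun _ => hε
  have hfx : ∀ ω (x : unitInterval), f (ω, x) = h (ω, x) := fun ω x => by
    simp only [hf, projIcc_val]
  have hclose : ∀ y : ℝ × unitInterval, |h y - G (y.1, y.2)| ≤ ε := fun y => by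
    have := hGf (y.1, y.2)
    rw [hfx, dist_comm, Real.dist_eq] at this
    exact this.le
  refine ⟨BoundedContinuousFunction.ofNormedAddCommGroup (fun y => G (y.1, y.2))
    (hG.continuous.comp (by fun_prop)) (‖h‖ + ε) fun y => ?_, fun y hy => ?_, ?_, G, hG,
    fun _ _ => rfl⟩
  · have h1 : G (y.1, y.2) = h y - (h y - G (y.1, y.2)) := by ring
    rw [h1]
    exact (norm_sub_le _ _).trans (add_le_add (h.norm_coe_le_norm y) (hclose y))
  · change G (y.1, y.2) = 0
    by_contra hne
    have := hGs hne
    rw [Function.mem_support, hfx] at this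
    exact this (hh y hy)
  · exact (BoundedContinuousFunction.norm_le hε.le).2 hclose

/-- The equation for the modes of a weak solution. -/
lemma IsWeakSolution.mode_eq (hρ : IsWeakSolution W K T r ρ) (hr : Integrable r) (hT : 0 < T)
    (hW : IsGraphonBound A W) {B : ℝ} (hZ : IsMeanField B (solutionField W K T ρ)) {M : ℝ}
    (hM : ∀ t, ‖hρ.functional hT.le t‖ ≤ M) {R : ℝ} (k : ℤ) (α : ℝ)
    {h : BoundedContinuousFunction (ℝ × unitInterval) ℝ} (hh : VanishesBeyond R h) :
    ∀ t ∈ Icc 0 T, hρ.functional hT.le t (modeFun k α h) = (∫ P, modeFun k α h P * r P)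
      + ∫ s in (0 : ℝ)..t, hρ.functional hT.le s (modeTransport hZ R s k α h) := by
  intro t ht
  have hM0 : 0 ≤ M := (norm_nonneg (hρ.functional hT.le 0)).trans (hM 0)
  -- `E` is the defect in the equation. It is additive and bounded by a multiple of the norm on
  -- functions vanishing beyond `R`, so its vanishing at smooth functions extends to all of them.
  set E : BoundedContinuousFunction (ℝ × unitInterval) ℝ → ℝ := fun h =>
    hρ.functional hT.le t (modeFun k α h) - densityFunctional r hr (modeFun k α h)
      - ∫ s in (0 : ℝ)..t, hρ.functional hT.le s (modeTransport hZ R s k α h) with hE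
  have hcont : ∀ h, IntervalIntegrable
      (fun s => hρ.functional hT.le s (modeTransport hZ R s k α h)) volume 0 t := fun h =>
    (continuous_functional_apply hM (hρ.continuous_functional hT.le)
      (continuous_modeTransport hZ R k α h)).intervalIntegrable _ _
  have hEsub : ∀ h h', E (h - h') = E h - E h' := fun h h' => by
    simp only [hE, modeFun_sub, modeTransport_sub, map_sub]
    rw [intervalIntegral.integral_sub (hcont h) (hcont h')]
    ring
  set C : ℝ := M + ‖densityFunctional r hr‖ + k.natAbs * (M * (|R| + 2 * B)) * t with hC
  have hEb : ∀ h, VanishesBeyond R h → |E h| ≤ C * ‖h‖ := by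
    intro h hh
    have h1 : |hρ.functional hT.le t (modeFun k α h)| ≤ M * ‖h‖ :=
      ((hρ.functional hT.le t).le_opNorm _).trans
        (mul_le_mul (hM t) (norm_modeFun_le _ _ _) (norm_nonneg _) hM0)
    have h2 : |densityFunctional r hr (modeFun k α h)| ≤ ‖densityFunctional r hr‖ * ‖h‖ :=
      ((densityFunctional r hr).le_opNorm _).trans
        (mul_le_mul_of_nonneg_left (norm_modeFun_le _ _ _) (norm_nonneg _))
    have h3 : |∫ s in (0 : ℝ)..t, hρ.functional hT.le s (modeTransport hZ R s k α h)|
        ≤ (k.natAbs * (M * ((|R| + 2 * B) * ‖h‖))) * |t - 0| := by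
      refine intervalIntegral.norm_integral_le_of_norm_le_const
        (f := fun s => hρ.functional hT.le s (modeTransport hZ R s k α h)) fun s _ => ?_
      refine abs_modeTransport_le hZ s (m := k.natAbs) (by push_cast; exact le_rfl) α hh hM0
        fun k' _ α' h' _ => ?_
      exact ((hρ.functional hT.le s).le_opNorm _).trans
        (mul_le_mul (hM s) (norm_modeFun_le _ _ _) (norm_nonneg _) hM0)
    rw [sub_zero, abs_of_nonneg ht.1] at h3
    refine (abs_sub _ _).trans ((add_le_add ((abs_sub _ _).trans (add_le_add h1 h2)) h3).trans
      (le_of_eq ?_))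
    rw [hC]
    ring
  have hC0 : 0 ≤ C := by
    have := hZ.nonneg
    have := ht.1
    positivity
  have hEε : ∀ ε > 0, |E h| ≤ C * ε := by
    intro ε hε
    obtain ⟨h', hh', hclose, G, hG, hGh⟩ := exists_contDiff_approx_of_vanishesBeyond hh hε
    have hz : E h' = 0 := by
      have := hρ.mode_eq_of_contDiff hT hW hZ hM (R := R) k α hh' hG hGh t ht
      simp only [hE, densityFunctional_apply]
      rw [this]
      ring
    have h1 : E h = E (h - h') := by rw [hEsub, hz, sub_zero]
    rw [h1]
    refine (hEb _ fun y hy => ?_).trans (mul_le_mul_of_nonneg_left hclose hC0)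
    rw [BoundedContinuousFunction.sub_apply, hh y hy, hh' y hy, sub_zero]
  have hlim : Tendsto (fun ε : ℝ => C * ε) (𝓝[>] 0) (𝓝 (C * 0)) :=
    ((continuous_const.mul continuous_id).tendsto (0 : ℝ)).mono_left nhdsWithin_le_nhds
  rw [mul_zero] at hlim
  have hE0 : E h = 0 := abs_nonpos_iff.1 (ge_of_tendsto hlim (eventually_mem_nhdsWithin.mono hEε))
  simp only [hE, densityFunctional_apply] at hE0
  linarith

/-- A weak solution is the image of its initial density under the flow of its mean field. -/
lemma IsWeakSolution.ae_eq_flowDensity (hρ : IsWeakSolution W K T r ρ) (hr : Continuous r)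
    (hr0 : ∀ P, 0 ≤ r P) [IsProbabilityMeasure (densityMeasure r)] (hT : 0 < T)
    (hW : IsGraphonBound A W) {B : ℝ} (hZ : IsMeanField B (solutionField W K T ρ)) {M : ℝ}
    (hM : ∀ t, ‖hρ.functional hT.le t‖ ≤ M) :
    ∀ t ∈ Icc 0 T, ρ t =ᵐ[volume] flowDensity (solutionField W K T ρ) r t := by
  set Z := solutionField W K T ρ with hZdef
  have hri : Integrable r := integrable_of_isFiniteMeasure_densityMeasure hr.measurable hr0
  set ν : ℝ → BoundedContinuousFunction PhaseSpace ℝ →L[ℝ] ℝ := fun t =>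
    densityFunctional _ (integrable_flowDensity hZ hr hr0 t) with hν
  have hνI : ∀ t f, ν t f = ∫ P, f P ∂((densityMeasure r).map (flowMap Z 0 t)) := fun t f =>
    integral_mul_flowDensity hZ hr hr0 t f
  have hνM : ∀ t, ‖ν t‖ ≤ 1 := fun t => by
    refine ContinuousLinearMap.opNorm_le_bound _ zero_le_one fun f => ?_
    have := isProbabilityMeasure_map_flowMap hZ (densityMeasure r) 0 t
    rw [hνI, one_mul]
    exact abs_integral_le_of_abs_le fun P => f.norm_coe_le_norm P
  have hνc : ∀ f, Continuous fun t => ν t f := fun f => by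
    simp only [hνI]
    exact continuous_integral_map_flowMap hZ _ f.continuous fun P => f.norm_coe_le_norm P
  intro t ht
  -- Both functionals satisfy the mode equation with the same initial value and the same field, that
  -- of `ρ`. The equation for a fixed field is linear, so the difference satisfies it with zero
  -- initial value.
  have hmodes : ∀ R h, VanishesBeyond R h → ∀ k α,
      (hρ.functional hT.le t - ν t) (modeFun k α h) = 0 := by
    intro R h hh k α
    refine modes_eq_zero hZ (R := R) (T := T) (C := M + 1)
      (Λ := fun t => hρ.functional hT.le t - ν t)
      (fun t _ => (norm_sub_le (hρ.functional hT.le t) (ν t)).trans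
        (add_le_add (hM t) (hνM t))) ?_ t ht k α h hh
    intro t ht k α h hh
    have e1 := hρ.mode_eq hri hT hW hZ hM k α hh t ht
    have e2 := flowDensity_mode_eq hZ hr hr0 ht.1 k α hh
    simp only [_root_.sub_apply]
    rw [intervalIntegral.integral_sub
      ((continuous_functional_apply hM (hρ.continuous_functional hT.le)
        (continuous_modeTransport hZ R k α h)).intervalIntegrable _ _)
      ((continuous_functional_apply hνM hνc
        (continuous_modeTransport hZ R k α h)).intervalIntegrable _ _), e1]
    have e3 : ν t (modeFun k α h) = _ := e2
    rw [e3]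
    ring
  have hint := (hρ.integrable t ht).sub (integrable_flowDensity hZ hr hr0 t)
  have hz := ae_eq_zero_of_integral_modeFun hint fun R h hh k α => by
    have h1 := hmodes R h hh k α
    rw [_root_.sub_apply] at h1
    simp only [IsWeakSolution.functional, hν, densityFunctional_apply, clamp_of_mem_Icc ht] at h1
    rw [← integral_sub (Integrable.bddCont_mul (hρ.integrable t ht) _)
      (Integrable.bddCont_mul (integrable_flowDensity hZ hr hr0 t) _)] at h1
    simpa only [Pi.sub_apply, mul_sub] using h1
  filter_upwards [hz] with P hP
  simpa [sub_eq_zero] using hP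

lemma densityField_congr_ae (W : unitInterval → unitInterval → ℝ) (K : ℝ) {σ σ' : PhaseSpace → ℝ}
    (h : σ =ᵐ[volume] σ') (x : unitInterval) : densityField W K σ x = densityField W K σ' x := by
  unfold densityField
  congr 2 <;> refine integral_congr_ae ?_ <;> filter_upwards [h] with P hP <;> rw [hP]

/-- The mean field of a weak solution is self-consistent. -/
lemma IsWeakSolution.exists_isSelfConsistent (hρ : IsWeakSolution W K T r ρ) (hr : Continuous r)
    (hr0 : ∀ P, 0 ≤ r P) [IsProbabilityMeasure (densityMeasure r)] (hT : 0 < T)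
    (hW : IsGraphonBound A W) : ∃ B Z, IsMeanField B Z ∧
      IsSelfConsistent W K T (densityMeasure r) Z ∧
      ∀ t ∈ Icc 0 T, ρ t =ᵐ[volume] flowDensity Z r t := by
  obtain ⟨M, hM⟩ := hρ.exists_norm_functional_le hT.le
  have hZ := hρ.isMeanField hT.le hW hM
  have hae := hρ.ae_eq_flowDensity hr hr0 hT hW hZ hM
  refine ⟨_, _, hZ, fun t ht x => ?_, hae⟩
  have hm := measurable_flowDensity hZ hr t
  rw [← densityMeasure_flowDensity hZ hr hr0, ← densityField_eq_meanField W K hm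
    (flowDensity_nonneg _ hr0 t), ← densityField_congr_ae W K (hae t ht),
    solutionField_of_mem_Icc W K ρ ht]

end WeakSolution

/-! ### Comparison of flows and of densities -/

lemma flowMap_eq_of_eqOn {B B' T : ℝ} {Z Z' : ℝ → unitInterval → ℝ × ℝ} (hZ : IsMeanField B Z)
    (hZ' : IsMeanField B' Z') (h : ∀ t ∈ Icc 0 T, ∀ x, Z t x = Z' t x) {t : ℝ}
    (ht : t ∈ Icc 0 T) : flowMap Z 0 t = flowMap Z' 0 t := by
  funext P
  refine Prod.ext (dist_le_zero.1 ?_) rfl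
  have := dist_flowMap_flowMap_le (lam := 2 * B + 1) (m := 0) hZ hZ' le_rfl (by linarith)
    (fun t ht x => by rw [h t ht x, sub_self, norm_zero, zero_mul]) ht P
  simpa using this

lemma ae_eq_of_densityMeasure_eq {ρ ρ' : PhaseSpace → ℝ} (hρ : Measurable ρ) (hρ' : Measurable ρ')
    (hρ0 : ∀ P, 0 ≤ ρ P) (hρ0' : ∀ P, 0 ≤ ρ' P) [IsFiniteMeasure (densityMeasure ρ)]
    (h : densityMeasure ρ = densityMeasure ρ') : ρ =ᵐ[volume] ρ' := by
  have hfin : ∫⁻ P, ENNReal.ofReal (ρ P) ≠ ⊤ := by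
    have := measure_lt_top (densityMeasure ρ) univ
    rw [densityMeasure, withDensity_apply _ MeasurableSet.univ, Measure.restrict_univ] at this
    exact this.ne
  have := (withDensity_eq_iff hρ.ennreal_ofReal.aemeasurable hρ'.ennreal_ofReal.aemeasurable
    hfin).1 h
  filter_upwards [this] with P hP
  rwa [ENNReal.ofReal_eq_ofReal_iff (hρ0 P) (hρ0' P)] at hP

/-! ### Empirical measures of the Kuramoto model -/

section Empirical

variable {n : ℕ}

instance isProbabilityMeasure_empiricalMeasure [NeZero n] (P : Fin n → PhaseSpace) :
    IsProbabilityMeasure (empiricalMeasure P) := by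
  refine ⟨?_⟩
  simp only [empiricalMeasure, Measure.smul_apply, Measure.finsetSum_apply, measure_univ,
    Finset.sum_const, Finset.card_univ, Fintype.card_fin, nsmul_eq_mul, mul_one, smul_eq_mul]
  exact ENNReal.inv_mul_cancel (Nat.cast_ne_zero.2 (NeZero.ne n)) (ENNReal.natCast_ne_top n)

lemma integral_empiricalMeasure (P : Fin n → PhaseSpace) (f : PhaseSpace → ℝ) :
    ∫ Q, f Q ∂(empiricalMeasure P) = (n : ℝ)⁻¹ * ∑ i, f (P i) := by
  rw [empiricalMeasure, integral_smul_measure, integral_finsetSum_measure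
    fun i _ => integrable_dirac (by simp)]
  simp

lemma map_empiricalMeasure {Φ : PhaseSpace → PhaseSpace} (hΦ : Measurable Φ)
    (P : Fin n → PhaseSpace) :
    (empiricalMeasure P).map Φ = empiricalMeasure fun i => Φ (P i) := by
  refine Measure.ext fun s hs => ?_
  rw [Measure.map_apply hΦ hs]
  simp only [empiricalMeasure, Measure.smul_apply, Measure.finsetSum_apply]
  congr 1
  refine Finset.sum_congr rfl fun i _ => ?_
  rw [Measure.dirac_apply' _ hs, Measure.dirac_apply' _ (hΦ hs)]
  rfl

variable {W : unitInterval → unitInterval → ℝ} {A K T : ℝ}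

lemma isMeanField_meanField_empiricalMeasure [NeZero n] (hW : IsGraphonBound A W) (K : ℝ)
    {φ : Fin n → ℝ → ℝ} (hφ : ∀ i, Continuous (φ i)) (ω : Fin n → ℝ) (ξ : Fin n → unitInterval) :
    IsMeanField (|K| * A) fun t =>
      meanField W K (empiricalMeasure fun i => ((φ i t : ℝ), ω i, ξ i)) := by
  refine ⟨fun x => ?_, fun t x => norm_meanField_le hW K _ x,
    fun t x y => norm_meanField_sub_le hW K _ x y⟩
  simp only [meanField, integral_empiricalMeasure, circCos_coe, circSin_coe]
  have := hφ
  fun_prop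

/-- The speed of an oscillator in the Kuramoto model is its speed in the mean field of the
empirical measure. -/
lemma phaseSpeed_meanField_empiricalMeasure (W : unitInterval → unitInterval → ℝ) (K : ℝ)
    (φ ω : Fin n → ℝ) (ξ : Fin n → unitInterval) (i : Fin n) :
    phaseSpeed (meanField W K (empiricalMeasure fun j => ((φ j : ℝ), ω j, ξ j)) (ξ i)) (ω i) (φ i)
      = ω i + K * (n : ℝ)⁻¹ * ∑ j, graphWeight W ξ i j * circSin ((φ j : Circ) - φ i) := by
  simp only [phaseSpeed, meanField, integral_empiricalMeasure, circSin_sub, circCos_coe,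
    circSin_coe, graphWeight, mul_sub, Finset.sum_sub_distrib]
  have e1 : ∑ j, W (ξ i) (ξ j) * (sin (φ j) * cos (φ i))
      = (∑ j, W (ξ i) (ξ j) * sin (φ j)) * cos (φ i) := by
    rw [Finset.sum_mul]; exact Finset.sum_congr rfl fun _ _ => by ring
  have e2 : ∑ j, W (ξ i) (ξ j) * (cos (φ j) * sin (φ i))
      = (∑ j, W (ξ i) (ξ j) * cos (φ j)) * sin (φ i) := by
    rw [Finset.sum_mul]; exact Finset.sum_congr rfl fun _ _ => by ring
  rw [e1, e2]
  ring

/-- The empirical measure of a solution of the Kuramoto model is the image of its initial value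
under the flow of a self-consistent mean field. -/
lemma IsKuramotoSolution.exists_isSelfConsistent [NeZero n] (hW : IsGraphonBound A W) (hT : 0 ≤ T)
    {ω : Fin n → ℝ} {ξ : Fin n → unitInterval} {θ : Fin n → ℝ → Circ}
    (h : IsKuramotoSolution K T (graphWeight W ξ) ω θ) :
    ∃ Z, IsMeanField (|K| * A) Z ∧
      IsSelfConsistent W K T (empiricalMeasure fun i => (θ i 0, ω i, ξ i)) Z ∧
      ∀ t ∈ Icc 0 T, (empiricalMeasure fun i => (θ i 0, ω i, ξ i)).map (flowMap Z 0 t)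
        = empiricalMeasure fun i => (θ i t, ω i, ξ i) := by
  obtain ⟨φ, hφθ, hφ⟩ := h
  -- The phases are controlled only on `[0, T]`; stopping time outside gives a field that is
  -- continuous on the whole line.
  set ψ : Fin n → ℝ → ℝ := fun i t => φ i (max 0 (min t T)) with hψ
  have hψc : ∀ i, Continuous (ψ i) := fun i =>
    ContinuousOn.comp_continuous (f := fun t : ℝ => max 0 (min t T))
      (fun t ht => (hφ i t ht).continuousWithinAt) (by fun_prop) fun t => clamp_mem_Icc hT t
  have hZ := isMeanField_meanField_empiricalMeasure hW K hψc ω ξ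
  set Z : ℝ → unitInterval → ℝ × ℝ := fun t =>
      meanField W K (empiricalMeasure fun i => ((ψ i t : ℝ), ω i, ξ i)) with hZdef
  have hψφ : ∀ i, ∀ t ∈ Icc 0 T, ψ i t = φ i t := fun i t ht => by
    simp only [hψ, clamp_of_mem_Icc ht]
  have h0 : (0 : ℝ) ∈ Icc 0 T := ⟨le_rfl, hT⟩
  have hflow : ∀ i, ∀ t ∈ Icc 0 T, phaseFlow Z 0 t (φ i 0) (ω i) (ξ i) = φ i t := by
    intro i t ht
    have hγ : ∀ t ∈ Icc 0 T,
        HasDerivWithinAt (φ i) (phaseSpeed (Z t (ξ i)) (ω i) (φ i t)) (Icc 0 T) t := by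
      intro t ht
      refine (hφ i t ht).congr_deriv ?_
      simp only [hZdef, hψφ _ t ht, phaseSpeed_meanField_empiricalMeasure, ← hφθ _ t ht]
    -- With equal fields, frequencies and starting phases the stability estimate, with `m = 0`, says
    -- that the given phase is the characteristic.
    have h1 := abs_sub_le_of_hasDerivWithinAt (B := |K| * A) (m := 0) (lam := 2 * (|K| * A) + 1)
      (z := fun t => Z t (ξ i)) (z' := fun t => Z t (ξ i)) (ω := ω i) (ω' := ω i)
      (fun t _ => hZ.norm_le t (ξ i))
      (fun t _ => (isPhaseCurve_phaseFlow hZ 0 (φ i 0) (ω i) (ξ i) t).hasDerivWithinAt) hγ le_rfl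
      (fun t _ => by simp) (by linarith) t ht
    simp only [phaseFlow_self hZ, sub_self, abs_zero, zero_div, add_zero, zero_mul] at h1
    exact sub_eq_zero.1 (abs_nonpos_iff.1 h1)
  have hmap : ∀ t ∈ Icc 0 T, (empiricalMeasure fun i => (θ i 0, ω i, ξ i)).map (flowMap Z 0 t)
      = empiricalMeasure fun i => (θ i t, ω i, ξ i) := by
    intro t ht
    rw [map_empiricalMeasure (continuous_flowMap_apply hZ 0 t).measurable]
    simp only [← hφθ _ 0 h0, ← hφθ _ t ht, flowMap_coe hZ, hflow _ t ht]
  refine ⟨Z, hZ, fun t ht x => ?_, hmap⟩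
  rw [hmap t ht]
  simp only [hZdef, hψφ _ t ht, hφθ _ t ht]

end Empirical

end

end KuramotoGraph

/-! ### The theorem -/

open KuramotoGraph in
theorem theorem2p1
    (W : unitInterval → unitInterval → ℝ) (hW : IsLipschitzGraphon W) (K : ℝ)
    (g : ℝ → ℝ) (hg : IsFrequencyDensity g)
    (p : PhaseSpace → ℝ) (hp : IsInitialConditionalDensity p)
    (T : ℝ) (hT : 0 < T) :
    ∃ ρ : ℝ → PhaseSpace → ℝ,
      IsWeakSolution W K T (fun P => p P * g P.2.1) ρ ∧
      (∀ ρ' : ℝ → PhaseSpace → ℝ, IsWeakSolution W K T (fun P => p P * g P.2.1) ρ' →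
        ∀ t ∈ Icc 0 T, ρ' t =ᵐ[volume] ρ t) ∧
      (∀ t ∈ Icc 0 T, (∀ᵐ P, 0 ≤ ρ t P) ∧ IsProbabilityMeasure (densityMeasure (ρ t))) ∧
      ∀ (ω : ℕ → ℝ) (ξ : (n : ℕ) → Fin n → unitInterval) (θ : (n : ℕ) → Fin n → ℝ → Circ),
        (∀ n, IsKuramotoSolution K T (graphWeight W (ξ n)) (fun i => ω i) (θ n)) →
        Tendsto (fun n => dBL (empiricalMeasure fun i => (θ n i 0, ω i, ξ n i))
          (densityMeasure (ρ 0))) atTop (𝓝 0) →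
        TendstoUniformlyOn
          (fun n t => dBL (empiricalMeasure fun i => (θ n i t, ω i, ξ n i))
            (densityMeasure (ρ t)))
          (fun _ => 0) atTop (Icc 0 T) := by
  obtain ⟨A, hA⟩ := hW.exists_isGraphonBound
  set r : PhaseSpace → ℝ := fun P => p P * g P.2.1
  have hr : Continuous r := hp.continuous.mul (hg.continuous.comp (by fun_prop))
  have hr0 : ∀ P, 0 ≤ r P := fun P => mul_nonneg (hp.nonneg P) (hg.nonneg _)
  have hprob : IsProbabilityMeasure (densityMeasure r) := isProbabilityMeasure_initial hg hp
  obtain ⟨Z, hZ, hsc⟩ := exists_isSelfConsistent hA K hT.le (densityMeasure r)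
  have hprob_t : ∀ t, IsProbabilityMeasure (densityMeasure (flowDensity Z r t)) := fun t => by
    rw [densityMeasure_flowDensity hZ hr hr0]
    exact isProbabilityMeasure_map_flowMap hZ _ 0 t
  refine ⟨flowDensity Z r, isWeakSolution_flowDensity hA hT hZ hr hr0 hsc, ?_,
    fun t _ => ⟨Eventually.of_forall (flowDensity_nonneg Z hr0 t), hprob_t t⟩, ?_⟩
  · intro ρ' hρ' t ht
    -- The other solution is transported by a field `Z'` that is self-consistent for the same
    -- initial measure, so `Z'` equals `Z` on `[0, T]` and the transported measures coincide.
    obtain ⟨B, Z', hZ', hsc', hae⟩ := hρ'.exists_isSelfConsistent hr hr0 hT hA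
    have hflow := flowMap_eq_of_eqOn hZ hZ' (IsSelfConsistent.eq hA hZ hZ' hsc hsc') ht
    have := hprob_t t
    refine (hae t ht).trans (ae_eq_of_densityMeasure_eq (measurable_flowDensity hZ hr t)
      (measurable_flowDensity hZ' hr t) (flowDensity_nonneg Z hr0 t)
      (flowDensity_nonneg Z' hr0 t) ?_).symm
    rw [densityMeasure_flowDensity hZ hr hr0, densityMeasure_flowDensity hZ' hr hr0, hflow]
  · intro ω ξ θ hθ hlim
    rw [flowDensity_zero hZ r] at hlim
    rw [Metric.tendstoUniformlyOn_iff]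
    intro ε hε
    have hlim' := hlim.const_mul (stabilityConst (|K| * A) T)
    rw [mul_zero] at hlim'
    -- For `n = 0` the empirical measure is zero rather than a probability measure, so `n ≥ 1` is
    -- required. The stability constant depends on neither `n` nor `t`, which makes the convergence
    -- uniform.
    filter_upwards [hlim'.eventually_lt_const hε, eventually_ge_atTop 1] with n hn hn1 t ht
    have : NeZero n := ⟨by omega⟩
    obtain ⟨Zn, hZn, hscn, hmap⟩ := (hθ n).exists_isSelfConsistent hA hT.le
    rw [dist_comm, dist_zero_right, Real.norm_eq_abs, abs_of_nonneg (dBL_nonneg _ _), ← hmap t ht,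
      densityMeasure_flowDensity hZ hr hr0]
    exact (IsSelfConsistent.dBL_map_le hA hZn hZ hscn hsc ht).trans_lt hn
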